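/- **Setting.** Let $(\mathcal X,d)$ be a connected compact metric space with infinitely many points, and let $\nu$ be a finite Borel measure on $\mathcal X$ that is positive on non-empty open sets. Put $L_2=L_2(\mathcal X,\nu)$. Let $\varrho,\tilde\varrho:\mathcal X\times\mathcal X\to\mathbb R$ be continuous, symmetric, strictly positive definite covariance functions whose covariance operators $(\mathcal C w)(x)=\int_{\mathcal X}\varrho(x,x')w(x')\,d\nu(x')$ and $\tilde{\mathcal C}$ (defined likewise from $\tilde\varrho$) are positive definite on $L_2$, i.e. $(\mathcal C w,w)_{L_2}>0$ and $(\tilde{\mathcal C} w,w)_{L_2}>0$ for $w\neq0$. Let $m,\tilde m\in L_2$, and let $\mu=N(m,\mathcal C)$ and $\tilde\mu=N(\tilde m,\tilde{\mathcal C})$ be the Gaussian measures on $L_2$ with these means and covariance operators. Write $E,\mathrm{Var}$ and $\tilde E,\widetilde{\mathrm{Var}}$ for expectation and variance under $\mu$ and $\tilde\mu$. **Observations.** Let $Z^0:\mathcal X\to L_2(\mu)$ be the continuous version of the centred field $y-m$, $y\sim\mu$; that is, $Z^0(x)$ is the limit in $L_2(\mu)$, as $r\downarrow0$, of the averages of $y-m$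 over the balls $B(x,r)$. Let $\mathcal H^0$ be the closure in $L_2(\mu)$ of the linear span of $\{Z^0(x):x\in\mathcal X\}$, and let $\mathcal H=\mathbb R\oplus\mathcal H^0$. Let $\mathcal D\subset L_2(\mu)\times L_2(\tilde\mu)$ be the closure of the set of pairs formed by the $\mu$-class and the $\tilde\mu$-class of one continuous affine functional $y\mapsto c+(w,y)_{L_2}$, $c\in\mathbb R$, $w\in L_2$. An element $h$ of $\mathcal D$ is a linear functional of the field that has a meaning under both measures; $E$ and $\mathrm{Var}$ are applied to its first component, $\tilde E$ and $\widetilde{\mathrm{Var}}$ to its second. An *admissible observation sequence* consists, for each $n\in\mathbb N$, of elements $y_{n1},\dots,y_{nn}$ of $\mathcal D$ whose first components lie in $\mathcal H^0$ and are linearly independent, and such that for every $h\in\mathcal H$ the $L_2(\mu)$-orthogonal projections of $h$ onto the spans of $1$ and the first components of $y_{n1},\dots,y_{nn}$ converge to $h$ in $L_2(\mu)$ as $n\to\infty$. (Nestedness is not required.) Put $\mathcal H_n=\operatorname{span}\{1,y_{n1},\dots,y_{nn}\}\subset\mathcal D$. For $h\in\mathcal D$, a best linear predictor of $h$ based on $\mathcal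 H_n$ and $\mu$ is an element $h_n\in\mathcal H_n$ with $E[(h_n-h)f]=0$ for all $f\in\mathcal H_n$; a best linear predictor based on $\mathcal H_n$ and $\tilde\mu$ is an element $\tilde h_n\in\mathcal H_n$ with $\tilde E[(\tilde h_n-h)f]=0$ for all $f\in\mathcal H_n$. Below, $\sup_h$ denotes the supremum over all $h\in\mathcal D$ with $E[(h_n-h)^2]>0$ (and over all choices of $h_n,\tilde h_n$, should these not be unique). **Assumptions.** Let $H^*=\mathcal C^{1/2}(L_2)$ and $\tilde H^*=\tilde{\mathcal C}^{1/2}(L_2)$ be the Cameron–Martin spaces, with norms $\|\mathcal C^{-1/2}\cdot\|_{L_2}$ and $\|\tilde{\mathcal C}^{-1/2}\cdot\|_{L_2}$. * (I) $H^*=\tilde H^*$ as sets, with equivalent norms. * (II) $m-\tilde m\in H^*$. * (III$_a$) for the given $a\in(0,\infty)$: $\mathcal C^{-1/2}\tilde{\mathcal C}\,\mathcal C^{-1/2}$ extends to a bounded operator on $L_2$, and $\mathcal C^{-1/2}\tilde{\mathcal C}\,\mathcal C^{-1/2}-a\mathcal I$ is compact. **Assertions.** For an admissible observation sequence, consider $$(1)\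 \lim_{n\to\infty}\sup_h\frac{E[(\tilde h_n-h)^2]}{E[(h_n-h)^2]}=1,\qquad (2)\ \lim_{n\to\infty}\sup_h\frac{\tilde E[(h_n-h)^2]}{\tilde E[(\tilde h_n-h)^2]}=1,$$ $$(3)_a\ \lim_{n\to\infty}\sup_h\left|\frac{\tilde E[(h_n-h)^2]}{E[(h_n-h)^2]}-a\right|=0,\qquad (4)_a\ \lim_{n\to\infty}\sup_h\left|\frac{E[(\tilde h_n-h)^2]}{\tilde E[(\tilde h_n-h)^2]}-\frac1a\right|=0 .$$ Let (V) be the condition that no $h\in\mathcal D$ has zero variance under exactly one of the two measures, i.e. $\mathrm{Var}[h]=0\iff\widetilde{\mathrm{Var}}[h]=0$ for all $h\in\mathcal D$. **Theorem.** * (0) If (I) and (II) hold, then for every $h\in\mathcal H$ there is exactly one $\tilde h\in L_2(\tilde\mu)$ with $(h,\tilde h)\in\mathcal D$. Thus all elements of $\mathcal H$ and all sequences of subspaces $\mathbb R\oplus\operatorname{span}\{y^0_{n1},\dots,y^0_{nn}\}$ with $\mu$-consistent predictors, $y_{nj}^0\in\mathcal H^0$ linearly independent, are covered. * (i) Assertion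 (1) holds for all admissible observation sequences if and only if (I), (II) and, for some $a\in(0,\infty)$, (III$_a$) hold. * (ii) The same is true of assertion (2). * (iii) For every $a\in(0,\infty)$: (V) holds and assertion $(3)_a$ holds for all admissible observation sequences if and only if (I), (II) and (III$_a$) hold. * (iv) For every $a\in(0,\infty)$: (V) holds and assertion $(4)_a$ holds for all admissible observation sequences if and only if (I), (II) and (III$_a$) hold. -/

import Mathlib

open MeasureTheory ProbabilityTheory Filter Topology
open scoped ENNReal RealInnerProductSpace

noncomputable section

namespace Kriging

/-! ### Covariance functions and covariance operators -/

section Operators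

variable {X : Type*} [MetricSpace X]

/-- A continuous kernel `ϱ` on `X × X` is a (strictly) positive definite covariance function. -/
structure IsStrictlyPosDef (ϱ : C(X × X, ℝ)) : Prop where
  symm : ∀ x x', ϱ (x, x') = ϱ (x', x)
  pos : ∀ (s : Finset X) (α : X → ℝ), (∃ x ∈ s, α x ≠ 0) →
    0 < ∑ x ∈ s, ∑ x' ∈ s, α x * α x' * ϱ (x, x')

variable [CompactSpace X] [MeasurableSpace X] [BorelSpace X]

/-- The section `ϱ(x, ·)` as an element of `L²(X, ν)`. -/
def kernelSection (ν : Measure X) [IsFiniteMeasure ν] (ϱ : C(X × X, ℝ)) : C(X, Lp ℝ 2 ν) :=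
  ⟨fun x => ContinuousMap.toLp 2 ν ℝ (ϱ.curry x),
    (ContinuousMap.toLp (E := ℝ) 2 ν ℝ).continuous.comp ϱ.curry.continuous⟩

theorem inner_kernelSection (ν : Measure X) [IsFiniteMeasure ν] (ϱ : C(X × X, ℝ))
    (w : Lp ℝ 2 ν) (x : X) :
    ⟪kernelSection ν ϱ x, w⟫ = ∫ x', ϱ (x, x') * w x' ∂ν := by
  rw [L2.inner_def]
  refine integral_congr_ae ?_
  filter_upwards [ContinuousMap.coeFn_toLp (p := 2) (𝕜 := ℝ) ν (ϱ.curry x)] with x' hx'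
  have : (kernelSection ν ϱ x : X → ℝ) x' = ϱ (x, x') := hx'
  simp [this, mul_comm]

/-- The function `x ↦ ∫ ϱ(x, x') w(x') dν(x')`, which is continuous. -/
def integralFun (ν : Measure X) [IsFiniteMeasure ν] (ϱ : C(X × X, ℝ)) (w : Lp ℝ 2 ν) : C(X, ℝ) :=
  ⟨fun x => ∫ x', ϱ (x, x') * w x' ∂ν, by
    simp_rw [← inner_kernelSection]
    exact (kernelSection ν ϱ).continuous.inner continuous_const⟩

theorem integralFun_apply (ν : Measure X) [IsFiniteMeasure ν] (ϱ : C(X × X, ℝ)) (w : Lp ℝ 2 ν)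
    (x : X) : integralFun ν ϱ w x = ⟪kernelSection ν ϱ x, w⟫ :=
  (inner_kernelSection ν ϱ w x).symm

/-- `integralFun` as a linear map. -/
def integralLin (ν : Measure X) [IsFiniteMeasure ν] (ϱ : C(X × X, ℝ)) :
    Lp ℝ 2 ν →ₗ[ℝ] C(X, ℝ) where
  toFun := integralFun ν ϱ
  map_add' := fun u v => by
    ext x
    simp only [ContinuousMap.add_apply, integralFun_apply, inner_add_right]
  map_smul' := fun c u => by
    ext x
    simp only [ContinuousMap.smul_apply, integralFun_apply, inner_smul_right,
      RingHom.id_apply, smul_eq_mul]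

theorem norm_integralLin_le (ν : Measure X) [IsFiniteMeasure ν] (ϱ : C(X × X, ℝ))
    (w : Lp ℝ 2 ν) : ‖integralLin ν ϱ w‖ ≤ ‖kernelSection ν ϱ‖ * ‖w‖ := by
  refine (ContinuousMap.norm_le _ (by positivity)).2 fun x => ?_
  change ‖integralFun ν ϱ w x‖ ≤ _
  rw [integralFun_apply]
  exact (norm_inner_le_norm _ _).trans
    (mul_le_mul_of_nonneg_right ((kernelSection ν ϱ).norm_coe_le_norm x) (norm_nonneg _))

/-- The covariance operator `(𝒞 w)(x) = ∫ ϱ(x, x') w(x') dν(x')` on `L²(X, ν)`. -/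
def covOp (ν : Measure X) [IsFiniteMeasure ν] (ϱ : C(X × X, ℝ)) : Lp ℝ 2 ν →L[ℝ] Lp ℝ 2 ν :=
  (ContinuousMap.toLp (E := ℝ) 2 ν ℝ).comp
    ((integralLin ν ϱ).mkContinuous ‖kernelSection ν ϱ‖ (norm_integralLin_le ν ϱ))

theorem covOp_apply (ν : Measure X) [IsFiniteMeasure ν] (ϱ : C(X × X, ℝ)) (w : Lp ℝ 2 ν) :
    covOp ν ϱ w =ᵐ[ν] fun x => ∫ x', ϱ (x, x') * w x' ∂ν :=
  ContinuousMap.coeFn_toLp (p := 2) (𝕜 := ℝ) ν (integralFun ν ϱ w)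

end Operators

section CameronMartin

variable {E : Type*} [NormedAddCommGroup E] [InnerProductSpace ℝ E]

open Classical in
/-- The positive square root `T^{1/2}` of a positive (compact) operator `T`, i.e. the positive
operator whose square is `T`. -/
def posSqrt (T : E →L[ℝ] E) : E →L[ℝ] E :=
  if h : ∃ S : E →L[ℝ] E, S.IsPositive ∧ S.comp S = T then h.choose else 0

/-- The Cameron–Martin space `H* = T^{1/2}(E)`. -/
def cameronMartin (T : E →L[ℝ] E) : Submodule ℝ E :=
  LinearMap.range (posSqrt T : E →ₗ[ℝ] E)

/-- The Cameron–Martin norm `‖T^{-1/2} g‖`, for `g ∈ H*` (the smallest norm of a preimage of `g`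
under `T^{1/2}`; there is exactly one preimage when `T` is injective). -/
def cmNorm (T : E →L[ℝ] E) (g : E) : ℝ :=
  sInf ((fun u => ‖u‖) '' {u : E | posSqrt T u = g})

/-- Assumption I: the Cameron–Martin spaces of `C` and `C'` are norm equivalent. -/
def AssumptionI (C C' : E →L[ℝ] E) : Prop :=
  cameronMartin C = cameronMartin C' ∧
    ∃ k K : ℝ, 0 < k ∧ 0 < K ∧ ∀ g ∈ cameronMartin C,
      k * cmNorm C g ≤ cmNorm C' g ∧ cmNorm C' g ≤ K * cmNorm C g

/-- Assumption II: `m - m'` belongs to the Cameron–Martin space of `C`. -/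
def AssumptionII (C : E →L[ℝ] E) (m m' : E) : Prop :=
  m - m' ∈ cameronMartin C

/-- Assumption III for a given `a`: the operator `A - a I` is compact, where
`A = C^{-1/2} C' C^{-1/2}`. Since `C^{1/2}` is injective with dense range, the bounded
operator `A` is characterized by `C^{1/2} A C^{1/2} = C'`. -/
def AssumptionIII (C C' : E →L[ℝ] E) (a : ℝ) : Prop :=
  ∃ A : E →L[ℝ] E, (posSqrt C).comp (A.comp (posSqrt C)) = C' ∧
    IsCompactOperator (A - a • ContinuousLinearMap.id ℝ E)

end CameronMartin

/-! ### Gaussian measures, spaces of observations and predictors -/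

section Prediction

/-- `μ = N(m, C)`: `μ` is a Gaussian measure with mean `m` and covariance operator `C`. -/
structure IsNormal {E : Type*} [NormedAddCommGroup E] [InnerProductSpace ℝ E] [MeasurableSpace E]
    (μ : Measure E) (m : E) (C : E →L[ℝ] E) : Prop where
  gaussian : IsGaussian μ
  mean : ∀ u, ∫ y, ⟪u, y⟫ ∂μ = ⟪u, m⟫
  cov : ∀ u v, cov[fun y => ⟪u, y⟫, fun y => ⟪v, y⟫; μ] = ⟪C u, v⟫

variable {X : Type*} [MetricSpace X] [MeasurableSpace X]
  {ν : Measure X} [MeasurableSpace (Lp ℝ 2 ν)]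

/-- `ζ ∈ L²(μ)` is the value `Z⁰(x)` at `x` of the continuous version `X → L²(μ)` of the centred
field `Z⁰ = y - m`, `y ∼ μ`: it is the limit in `L²(μ)` of the averages of `y - m` over the balls
`B(x, r)` as `r ↓ 0`. -/
def IsPointValue (μ : Measure (Lp ℝ 2 ν)) (m : Lp ℝ 2 ν) (x : X) (ζ : Lp ℝ 2 μ) : Prop :=
  Tendsto (fun r : ℝ => eLpNorm
      (fun y : Lp ℝ 2 ν => ζ y - ⨍ x' in Metric.ball x r, (y x' - m x') ∂ν) 2 μ)
    (𝓝[>] 0) (𝓝 0)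

/-- The Gaussian Hilbert space `ℋ⁰`: the closure in `L²(μ)` of the linear span of all `Z⁰(x)`. -/
def centredSpace (μ : Measure (Lp ℝ 2 ν)) (m : Lp ℝ 2 ν) : Submodule ℝ (Lp ℝ 2 μ) :=
  (Submodule.span ℝ {ζ | ∃ x, IsPointValue μ m x ζ}).topologicalClosure

/-- `ℋ = ℝ ⊕ ℋ⁰`, with the inner product of `L²(μ)`. -/
def fullSpace (μ : Measure (Lp ℝ 2 ν)) [IsFiniteMeasure μ] (m : Lp ℝ 2 ν) :
    Submodule ℝ (Lp ℝ 2 μ) :=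
  Submodule.span ℝ {Lp.const 2 μ (1 : ℝ)} ⊔ centredSpace μ m

/-- `E[f²]`. -/
def secondMoment {E : Type*} [MeasurableSpace E] {μ : Measure E} (f : Lp ℝ 2 μ) : ℝ≥0∞ :=
  ∫⁻ y, ENNReal.ofReal (f y ^ 2) ∂μ

/-- `g` is the best linear predictor of `h` based on `V`: `g ∈ V` and
`E[(g - h) f] = 0` for all `f ∈ V`. -/
def IsBestPredictor {E : Type*} [MeasurableSpace E] {μ : Measure E}
    (V : Submodule ℝ (Lp ℝ 2 μ)) (h g : Lp ℝ 2 μ) : Prop :=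
  g ∈ V ∧ ∀ f ∈ V, ∫ y, (g y - h y) * f y ∂μ = 0

/-- The observations `z n 0, …, z n (n - 1)`, `n ∈ ℕ`, generate an admissible sequence of subspaces
`ℋ_n = ℝ ⊕ span {z n j}`: they are linearly independent elements of `ℋ⁰` and provide
`μ`-consistent best linear predictors of every `h ∈ ℋ`. The subspaces need not be nested. -/
structure IsAdmissible (μ : Measure (Lp ℝ 2 ν)) [IsFiniteMeasure μ] (m : Lp ℝ 2 ν)
    (z : ∀ n : ℕ, Fin n → Lp ℝ 2 μ) : Prop where
  mem : ∀ n j, z n j ∈ centredSpace μ m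
  indep : ∀ n, LinearIndependent ℝ (z n)
  consistent : ∀ h ∈ fullSpace μ m, ∀ g : ℕ → Lp ℝ 2 μ,
    (∀ n, IsBestPredictor
      (Submodule.span ℝ (insert (Lp.const 2 μ (1 : ℝ)) (Set.range (z n)))) h (g n)) →
    Tendsto (fun n => secondMoment (g n - h)) atTop (𝓝 0)

/-- The pairs `(h, h') ∈ L²(μ) × L²(μ')` such that `h` and `h'` represent the same linear functional
of the field under `μ` and under `μ'`: the closure of the pairs formed by the classes of one
continuous affine functional `y ↦ c + ⟪w, y⟫`. -/
def commonFunctionals (μ μ' : Measure (Lp ℝ 2 ν)) : Set (Lp ℝ 2 μ × Lp ℝ 2 μ') :=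
  closure {p | ∃ (c : ℝ) (w : Lp ℝ 2 ν),
    (p.1 =ᵐ[μ] fun y => c + ⟪w, y⟫) ∧ (p.2 =ᵐ[μ'] fun y => c + ⟪w, y⟫)}

/-- No common linear functional has zero variance under exactly one of the two measures. -/
def VarianceCompatible (μ μ' : Measure (Lp ℝ 2 ν)) : Prop :=
  ∀ p ∈ commonFunctionals μ μ', Var[p.1; μ] = 0 ↔ Var[p.2; μ'] = 0

/-- A sequence of observations which are linear functionals under `μ` and `μ'`, admissible for
`μ`. -/
def IsObservationSequence (μ μ' : Measure (Lp ℝ 2 ν)) [IsFiniteMeasure μ] (m : Lp ℝ 2 ν)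
    (y : ∀ n : ℕ, Fin n → Lp ℝ 2 μ × Lp ℝ 2 μ') : Prop :=
  (∀ n j, y n j ∈ commonFunctionals μ μ') ∧ IsAdmissible μ m (fun n j => (y n j).1)

/-- `ℋ_n`: the span of the constants and the observations, realized under both measures. -/
def observationSpace (μ μ' : Measure (Lp ℝ 2 ν)) [IsFiniteMeasure μ] [IsFiniteMeasure μ']
    {n : ℕ} (y : Fin n → Lp ℝ 2 μ × Lp ℝ 2 μ') : Submodule ℝ (Lp ℝ 2 μ × Lp ℝ 2 μ') :=
  Submodule.span ℝ (insert (Lp.const 2 μ (1 : ℝ), Lp.const 2 μ' (1 : ℝ)) (Set.range y))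

/-- The pairs of prediction errors `(h_n - h, h'_n - h)`, for `h` with `E[(h_n - h)²] > 0`, where
`h_n` and `h'_n` are the best linear predictors of `h` based on `V` and on `μ`, resp. `μ'`.
Each error is itself realized under both measures. -/
def errorPairs (μ μ' : Measure (Lp ℝ 2 ν)) (V : Submodule ℝ (Lp ℝ 2 μ × Lp ℝ 2 μ')) :
    Set ((Lp ℝ 2 μ × Lp ℝ 2 μ') × (Lp ℝ 2 μ × Lp ℝ 2 μ')) :=
  {e | ∃ h ∈ commonFunctionals μ μ', ∃ g ∈ V, ∃ g' ∈ V,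
    IsBestPredictor (V.map (LinearMap.fst ℝ (Lp ℝ 2 μ) (Lp ℝ 2 μ'))) h.1 g.1 ∧
    IsBestPredictor (V.map (LinearMap.snd ℝ (Lp ℝ 2 μ) (Lp ℝ 2 μ'))) h.2 g'.2 ∧
    0 < secondMoment (g - h).1 ∧ e = (g - h, g' - h)}

/-- `|r - s|` for extended nonnegative numbers. -/
def absDiff (r s : ℝ≥0∞) : ℝ≥0∞ := max (r - s) (s - r)

variable (μ μ' : Measure (Lp ℝ 2 ν)) [IsFiniteMeasure μ] [IsFiniteMeasure μ']

/-- `lim sup_h E[(h'_n - h)²] / E[(h_n - h)²] = 1`. -/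
def Efficient (y : ∀ n : ℕ, Fin n → Lp ℝ 2 μ × Lp ℝ 2 μ') : Prop :=
  Tendsto (fun n => ⨆ e ∈ errorPairs μ μ' (observationSpace μ μ' (y n)),
    secondMoment e.2.1 / secondMoment e.1.1) atTop (𝓝 1)

/-- `lim sup_h E'[(h_n - h)²] / E'[(h'_n - h)²] = 1`. -/
def Efficient' (y : ∀ n : ℕ, Fin n → Lp ℝ 2 μ × Lp ℝ 2 μ') : Prop :=
  Tendsto (fun n => ⨆ e ∈ errorPairs μ μ' (observationSpace μ μ' (y n)),
    secondMoment e.1.2 / secondMoment e.2.2) atTop (𝓝 1)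

/-- `lim sup_h |E'[(h_n - h)²] / E[(h_n - h)²] - a| = 0`. -/
def ErrorRatio (a : ℝ) (y : ∀ n : ℕ, Fin n → Lp ℝ 2 μ × Lp ℝ 2 μ') : Prop :=
  Tendsto (fun n => ⨆ e ∈ errorPairs μ μ' (observationSpace μ μ' (y n)),
    absDiff (secondMoment e.1.2 / secondMoment e.1.1) (ENNReal.ofReal a)) atTop (𝓝 0)

/-- `lim sup_h |E[(h'_n - h)²] / E'[(h'_n - h)²] - 1/a| = 0`. -/
def ErrorRatio' (a : ℝ) (y : ∀ n : ℕ, Fin n → Lp ℝ 2 μ × Lp ℝ 2 μ') : Prop :=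
  Tendsto (fun n => ⨆ e ∈ errorPairs μ μ' (observationSpace μ μ' (y n)),
    absDiff (secondMoment e.2.1 / secondMoment e.2.2) (ENNReal.ofReal (1 / a))) atTop (𝓝 0)

end Prediction

end Kriging

end

/-!
The functionals that are meaningful under both measures form a closed linear relation `D` between
the Hilbert spaces `L²(μ)` and `L²(μ')`. The prediction errors for a space `V ⊆ D` of observations
are the pairs `(e, e')` of elements of `D` with `e - e' ∈ V`, where `e` is orthogonal to `V` under
`μ` and `e'` is orthogonal to `V` under `μ'` (`errorPairs_eq`). Thus everything is a statement about
the two quadratic forms `p ↦ E[p²]` and `p ↦ E'[p²]` on `D`.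

The central notion is `AsympConformal D a`: the relation `D` is bounded in both directions, and
`E'[p²]` is `a E[p²]` up to an arbitrarily small relative error on a subspace of `D` of finite
codimension. As `D` is the closure of the affine functionals `c + ⟪w, y⟫` of the field, boundedness
in both directions amounts to the equivalence of the Cameron–Martin spaces and of the means
(Assumptions I and II), and near proportionality amounts to the compactness of
`C^{-1/2} C' C^{-1/2} - a I` (Assumption III); this is `assumptions_iff_asympConformal`, which rests
on `FieldModel.asympConformal_of_assumptions` and `FieldModel.assumptions_of_asympConformal`.

*Sufficiency.* Consistency makes the errors asymptotically orthogonal to every fixed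
finite-dimensional space, so conformality forces both error ratios to converge uniformly to `a` and
`1 / a` (`AsympConformal.eventually_ratioBound` and its counterpart with exchanged measures).
Multiplying these two statements, and using that each predictor is optimal for its own measure,
gives asymptotic efficiency (`effBound_of_ratioBound`).

*Necessity.* An error ratio close to `a` for one space `V` of observations says that the two forms
are nearly proportional on errors, that is, in finite codimension
(`asympConformal_of_ratioBound` and `asympConformal_of_ratioBound'`). Efficiency alone first shows
that `D` contains no pair `(k, 0)` or `(0, k')` except `0`: errors could otherwise be shifted along
such a pair, which is far from zero under one measure only. Efficiency for the standard observation
spaces enlarged by one arbitrary functional `q` then shows that orthogonality under `μ` of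
functionals of equal norm implies approximate orthogonality under `μ'`, on a subspace of finite
codimension. Applied to sums and differences, this makes the two forms proportional up to a small
error, with a factor that has a positive limit point as the error tends to zero
(`exists_asympConformal_of_effBound` and `exists_asympConformal_of_effBound'`). Since observation
sequences need not be nested, the enlarged spaces do occur in admissible sequences
(`eventually_of_forall_isObservationSequence`).
-/

noncomputable section

namespace Kriging

/-! ### Closed linear relations between Hilbert spaces -/

section Relations

variable {H H' : Type*} [NormedAddCommGroup H] [InnerProductSpace ℝ H]
  [NormedAddCommGroup H'] [InnerProductSpace ℝ H']

/-- The relation `D ⊆ H × H'` with the two components exchanged. -/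
def swapRel (D : Submodule ℝ (H × H')) : Submodule ℝ (H' × H) :=
  D.comap (LinearEquiv.prodComm ℝ H' H).toLinearMap

theorem isClosed_swapRel {D : Submodule ℝ (H × H')} (hD : IsClosed (D : Set (H × H'))) :
    IsClosed (swapRel D : Set (H' × H)) :=
  hD.preimage continuous_swap

instance finiteDimensional_swapRel (W : Submodule ℝ (H × H')) [FiniteDimensional ℝ W] :
    FiniteDimensional ℝ (swapRel W) := by
  have : swapRel W = W.map (LinearEquiv.prodComm ℝ H H').toLinearMap := by
    ext p
    exact ⟨fun hp => ⟨p.swap, hp, rfl⟩, by rintro ⟨q, hq, rfl⟩; exact hq⟩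
  rw [this]
  infer_instance

/-- The part of the relation `D` whose first components are orthogonal to `s` and whose second
components are orthogonal to `s'`. -/
def orthPart (D : Submodule ℝ (H × H')) (s : Finset H) (s' : Finset H') :
    Submodule ℝ (H × H') where
  carrier := {p | p ∈ D ∧ (∀ f ∈ s, ⟪f, p.1⟫ = 0) ∧ ∀ f ∈ s', ⟪f, p.2⟫ = 0}
  add_mem' := by
    rintro p q ⟨hp, hp1, hp2⟩ ⟨hq, hq1, hq2⟩
    refine ⟨D.add_mem hp hq, fun f hf => ?_, fun f hf => ?_⟩
    · simp [inner_add_right, hp1 f hf, hq1 f hf]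
    · simp [inner_add_right, hp2 f hf, hq2 f hf]
  zero_mem' := ⟨D.zero_mem, by simp, by simp⟩
  smul_mem' := by
    rintro c p ⟨hp, hp1, hp2⟩
    refine ⟨D.smul_mem c hp, fun f hf => ?_, fun f hf => ?_⟩
    · simp [inner_smul_right, hp1 f hf]
    · simp [inner_smul_right, hp2 f hf]

theorem mem_orthPart {D : Submodule ℝ (H × H')} {s : Finset H} {s' : Finset H'} {p : H × H'} :
    p ∈ orthPart D s s' ↔ p ∈ D ∧ (∀ f ∈ s, ⟪f, p.1⟫ = 0) ∧ ∀ f ∈ s', ⟪f, p.2⟫ = 0 :=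
  Iff.rfl

theorem isClosed_orthPart {D : Submodule ℝ (H × H')} (hD : IsClosed (D : Set (H × H')))
    (s : Finset H) (s' : Finset H') : IsClosed (orthPart D s s' : Set (H × H')) := by
  have : (orthPart D s s' : Set (H × H')) =
      (D : Set (H × H')) ∩ ((⋂ f ∈ s, {p | ⟪f, p.1⟫ = 0}) ∩ ⋂ f ∈ s', {p | ⟪f, p.2⟫ = 0}) := by
    ext p
    simp [mem_orthPart]
  rw [this]
  refine hD.inter (IsClosed.inter ?_ ?_)
  · exact isClosed_biInter fun f _ => isClosed_eq (by fun_prop) continuous_const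
  · exact isClosed_biInter fun f _ => isClosed_eq (by fun_prop) continuous_const

/-- The orthogonality conditions cut out a part of finite codimension. -/
theorem exists_orthPart_sup_eq (D : Submodule ℝ (H × H')) (s : Finset H) (s' : Finset H') :
    ∃ N : Submodule ℝ (H × H'), FiniteDimensional ℝ N ∧ D = orthPart D s s' ⊔ N := by
  let Φ : D →ₗ[ℝ] (s → ℝ) × (s' → ℝ) :=
    { toFun := fun p => (fun f => ⟪(f : H), p.1.1⟫, fun f => ⟪(f : H'), p.1.2⟫)
      map_add' := fun p q => by ext <;> simp [inner_add_right]
      map_smul' := fun c p => by ext <;> simp [inner_smul_right] }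
  obtain ⟨N, hN⟩ := (LinearMap.ker Φ).exists_isCompl
  have hfin : FiniteDimensional ℝ N :=
    LinearEquiv.finiteDimensional
      ((Φ.quotKerEquivRange.symm.trans (Submodule.quotientEquivOfIsCompl _ _ hN)))
  refine ⟨N.map D.subtype, inferInstance, ?_⟩
  have hker : (LinearMap.ker Φ).map D.subtype = orthPart D s s' := by
    ext p
    simp only [Submodule.mem_map, LinearMap.mem_ker, Submodule.subtype_apply, mem_orthPart]
    constructor
    · rintro ⟨q, hq, rfl⟩
      have h1 := congrArg Prod.fst hq
      have h2 := congrArg Prod.snd hq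
      exact ⟨q.2, fun f hf => congrFun h1 ⟨f, hf⟩, fun f hf => congrFun h2 ⟨f, hf⟩⟩
    · rintro ⟨hp, h1, h2⟩
      refine ⟨⟨p, hp⟩, ?_, rfl⟩
      ext f
      · exact h1 f f.2
      · exact h2 f f.2
  rw [← hker, ← Submodule.map_sup, hN.sup_eq_top, Submodule.map_top, Submodule.range_subtype]

theorem exists_ne_zero_mem_orthPart {D : Submodule ℝ (H × H')} (hD : ¬ FiniteDimensional ℝ D)
    (s : Finset H) (s' : Finset H') : ∃ p ∈ orthPart D s s', p ≠ 0 := by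
  by_contra! h
  obtain ⟨N, hN, hDN⟩ := exists_orthPart_sup_eq D s s'
  rw [(Submodule.eq_bot_iff _).2 h, bot_sup_eq] at hDN
  exact hD (hDN ▸ hN)

/-- Orthogonality to the first components of a finite-dimensional space is orthogonality to
finitely many vectors. -/
theorem exists_finset_fst (W : Submodule ℝ (H × H')) [FiniteDimensional ℝ W] :
    ∃ s : Finset H, (∀ f ∈ s, ∃ w ∈ W, w.1 = f) ∧
      ∀ x : H, (∀ f ∈ s, ⟪f, x⟫ = 0) → ∀ w ∈ W, ⟪w.1, x⟫ = 0 := by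
  obtain ⟨s, hs⟩ := Submodule.FG.map (LinearMap.fst ℝ H H')
    (Module.Finite.iff_fg.1 (inferInstance : FiniteDimensional ℝ W))
  refine ⟨s, fun f hf => ?_, fun x hx w hw => ?_⟩
  · have : f ∈ W.map (LinearMap.fst ℝ H H') := hs ▸ Submodule.subset_span hf
    obtain ⟨w, hw, rfl⟩ := this
    exact ⟨w, hw, rfl⟩
  · have hw' : w.1 ∈ Submodule.span ℝ (s : Set H) := hs ▸ ⟨w, hw, rfl⟩
    generalize w.1 = z at hw'
    induction hw' using Submodule.span_induction with
    | mem f hf => exact hx f hf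
    | zero => simp
    | add f g _ _ hf hg => simp [inner_add_left, hf, hg]
    | smul c f _ hf => simp [inner_smul_left, hf]

theorem exists_finset_snd (W : Submodule ℝ (H × H')) [FiniteDimensional ℝ W] :
    ∃ s : Finset H', (∀ f ∈ s, ∃ w ∈ W, w.2 = f) ∧
      ∀ x : H', (∀ f ∈ s, ⟪f, x⟫ = 0) → ∀ w ∈ W, ⟪w.2, x⟫ = 0 := by
  obtain ⟨s, hs, h⟩ := exists_finset_fst (swapRel W)
  refine ⟨s, fun f hf => ?_, fun x hx w hw => h x hx w.swap hw⟩
  obtain ⟨w, hw, rfl⟩ := hs f hf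
  exact ⟨w.swap, hw, rfl⟩

theorem exists_fst_proj (W : Submodule ℝ (H × H')) [FiniteDimensional ℝ W] (x : H) :
    ∃ g ∈ W, ∀ w ∈ W, ⟪w.1, x - g.1⟫ = 0 := by
  obtain ⟨g, hg, hgx⟩ := ((W.map (LinearMap.fst ℝ H H')).starProjection_apply_mem x)
  refine ⟨g, hg, fun w hw => ?_⟩
  have := (W.map (LinearMap.fst ℝ H H')).sub_starProjection_mem_orthogonal x
  rw [← hgx] at this
  exact this w.1 ⟨w, hw, rfl⟩

theorem exists_snd_proj (W : Submodule ℝ (H × H')) [FiniteDimensional ℝ W] (x : H') :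
    ∃ g ∈ W, ∀ w ∈ W, ⟪w.2, x - g.2⟫ = 0 := by
  obtain ⟨g, hg, hgx⟩ := ((W.map (LinearMap.snd ℝ H H')).starProjection_apply_mem x)
  refine ⟨g, hg, fun w hw => ?_⟩
  have := (W.map (LinearMap.snd ℝ H H')).sub_starProjection_mem_orthogonal x
  rw [← hgx] at this
  exact this w.2 ⟨w, hw, rfl⟩

/-- A closed single-valued relation that is bounded on a closed part of finite codimension is the
restriction of a bounded operator: its domain is the sum of a closed and a finite-dimensional
subspace, hence closed, and the open mapping theorem applies to the first projection. -/
theorem exists_operator_of_le [CompleteSpace H] [CompleteSpace H'] {D E N : Submodule ℝ (H × H')}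
    (hD : IsClosed (D : Set (H × H'))) (hE : IsClosed (E : Set (H × H')))
    [FiniteDimensional ℝ N] (hDEN : D = E ⊔ N) (hinj : ∀ k', ((0 : H), k') ∈ D → k' = 0)
    {c : ℝ} (hc : ∀ p ∈ E, ‖p.2‖ ≤ c * ‖p.1‖) : ∃ T : H →L[ℝ] H', ∀ p ∈ D, p.2 = T p.1 := by
  have hEc : CompleteSpace E := hE.completeSpace_coe
  have hDc : CompleteSpace D := hD.completeSpace_coe
  let φ : E →L[ℝ] H := (ContinuousLinearMap.fst ℝ H H').comp E.subtypeL
  have hφ : AntilipschitzWith (max 1 c).toNNReal φ := by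
    refine AddMonoidHomClass.antilipschitz_of_bound φ fun p => ?_
    rw [Real.coe_toNNReal _ (le_max_of_le_left zero_le_one)]
    change max ‖p.1.1‖ ‖p.1.2‖ ≤ max 1 c * ‖p.1.1‖
    refine max_le ?_ ((hc p p.2).trans ?_)
    · exact le_mul_of_one_le_left (norm_nonneg _) (le_max_left _ _)
    · exact mul_le_mul_of_nonneg_right (le_max_right _ _) (norm_nonneg _)
  have hEcl : IsClosed ((E.map (LinearMap.fst ℝ H H') : Submodule ℝ H) : Set H) := by
    convert hφ.isClosed_range φ.uniformContinuous
    ext x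
    simp [φ]
  let g : D →L[ℝ] H := (ContinuousLinearMap.fst ℝ H H').comp D.subtypeL
  have hgr : Set.range g = ((E.map (LinearMap.fst ℝ H H') ⊔ N.map (LinearMap.fst ℝ H H') :
      Submodule ℝ H) : Set H) := by
    rw [← Submodule.map_sup, ← hDEN]
    ext x
    simp [g]
  have hgcl : IsClosed (Set.range g) := by
    rw [hgr]
    exact Submodule.isClosed_sup_finiteDimensional _ _ hEcl
  have hginj : Function.Injective g := by
    refine (injective_iff_map_eq_zero g).2 fun p hp => ?_
    have hp1 : p.1.1 = 0 := hp
    have hp2 : p.1.2 = 0 := hinj _ (by rw [← hp1]; exact p.2)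
    exact Subtype.ext (Prod.ext hp1 hp2)
  have hrc : CompleteSpace g.range := by
    have : IsClosed ((g.range : Submodule ℝ H) : Set H) := by rw [LinearMap.coe_range]; exact hgcl
    exact this.completeSpace_coe
  let e := g.leftInverse_of_injective_of_isClosed_range hginj hgcl
  refine ⟨((ContinuousLinearMap.snd ℝ H H').comp D.subtypeL).comp
    (e.comp g.range.orthogonalProjectionOnto), fun p hp => ?_⟩
  have h1 : g.range.orthogonalProjectionOnto p.1 = g.rangeRestrict ⟨p, hp⟩ := by
    have := g.range.orthogonalProjectionOnto_mem_subspace_eq_self (g.rangeRestrict ⟨p, hp⟩)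
    exact this
  have h2 : e (g.rangeRestrict ⟨p, hp⟩) = ⟨p, hp⟩ :=
    LinearMap.leftInverse_apply_of_inj (f := (g.rangeRestrict : D →ₗ[ℝ] g.range))
      (LinearMap.ker_eq_bot.2 fun a b hab => hginj (congrArg Subtype.val hab)) _
  change p.2 = (e (g.range.orthogonalProjectionOnto p.1)).1.2
  rw [h1, h2]

end Relations

/-! ### Asymptotically conformal relations and prediction errors -/

section Conformal

variable {H H' : Type*} [NormedAddCommGroup H] [InnerProductSpace ℝ H]
  [NormedAddCommGroup H'] [InnerProductSpace ℝ H']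

/-- The relation `D` is an isomorphism between its domain and its range that multiplies the
squared norm by `a` up to arbitrarily small relative errors on subspaces of finite codimension.
In operator language, `D` is the graph of an invertible `T` with `T* T - a` compact. -/
structure AsympConformal (D : Submodule ℝ (H × H')) (a : ℝ) : Prop where
  right : ∃ T : H →L[ℝ] H', ∀ p ∈ D, p.2 = T p.1
  left : ∃ R : H' →L[ℝ] H, ∀ p ∈ D, p.1 = R p.2
  near : ∀ ε > 0, ∃ s : Finset H, ∀ p ∈ D, (∀ f ∈ s, ⟪f, p.1⟫ = 0) →
    |‖p.2‖ ^ 2 - a * ‖p.1‖ ^ 2| ≤ ε * ‖p.1‖ ^ 2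

/-- The finitely many exceptional vectors are carried to `H'` by the adjoint of the inverse
operator. -/
theorem AsympConformal.swap [CompleteSpace H] [CompleteSpace H'] {D : Submodule ℝ (H × H')}
    {a : ℝ} (ha : 0 < a) (h : AsympConformal D a) : AsympConformal (swapRel D) (1 / a) where
  right := by
    obtain ⟨R, hR⟩ := h.left
    exact ⟨R, fun p hp => hR _ hp⟩
  left := by
    obtain ⟨T, hT⟩ := h.right
    exact ⟨T, fun p hp => hT _ hp⟩
  near := by
    classical
    intro ε hε
    obtain ⟨R, hR⟩ := h.left
    obtain ⟨s, hs⟩ := h.near (ε * a / (‖R‖ ^ 2 + 1)) (by positivity)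
    refine ⟨s.image (ContinuousLinearMap.adjoint R), fun p hp hps => ?_⟩
    have hp1 : p.2 = R p.1 := hR _ hp
    have key := hs p.swap hp fun f hf => by
      have := hps _ (Finset.mem_image_of_mem _ hf)
      rw [ContinuousLinearMap.adjoint_inner_left] at this
      simpa [hp1] using this
    simp only [Prod.fst_swap, Prod.snd_swap] at key
    have hle : ‖p.2‖ ^ 2 ≤ (‖R‖ ^ 2 + 1) * ‖p.1‖ ^ 2 := by
      have := R.le_opNorm p.1
      rw [← hp1] at this
      have h2 := pow_le_pow_left₀ (norm_nonneg _) this 2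
      nlinarith [sq_nonneg ‖p.1‖]
    have e1 : ‖p.2‖ ^ 2 - 1 / a * ‖p.1‖ ^ 2 = -(1 / a) * (‖p.1‖ ^ 2 - a * ‖p.2‖ ^ 2) := by
      field_simp
      ring
    rw [e1, abs_mul, abs_neg, abs_of_pos (by positivity : 0 < 1 / a)]
    calc 1 / a * |‖p.1‖ ^ 2 - a * ‖p.2‖ ^ 2|
        ≤ 1 / a * (ε * a / (‖R‖ ^ 2 + 1) * ((‖R‖ ^ 2 + 1) * ‖p.1‖ ^ 2)) := by
          gcongr
          exact key.trans (by gcongr)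
      _ = ε * ‖p.1‖ ^ 2 := by field_simp

theorem AsympConformal.of_swap [CompleteSpace H] [CompleteSpace H'] {D : Submodule ℝ (H × H')}
    {a : ℝ} (ha : 0 < a) (h : AsympConformal (swapRel D) (1 / a)) : AsympConformal D a := by
  have h' := h.swap (by positivity)
  rw [one_div_one_div] at h'
  exact h'

/-- The limit of a sequence in the domain of a closed bounded relation is in the domain. -/
theorem mk_mem_of_mem_closure {D : Submodule ℝ (H × H')} (hD : IsClosed (D : Set (H × H')))
    {T : H →L[ℝ] H'} (hT : ∀ p ∈ D, p.2 = T p.1) {x : H}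
    (hx : x ∈ (D.map (LinearMap.fst ℝ H H')).topologicalClosure) : (x, T x) ∈ D := by
  have hcl : IsClosed {y : H | (y, T y) ∈ D} :=
    hD.preimage (by fun_prop : Continuous fun y : H => (y, T y))
  refine (hcl.closure_subset_iff.2 ?_) hx
  rintro _ ⟨p, hp, rfl⟩
  change (p.1, T p.1) ∈ D
  rw [← hT p hp]
  exact hp

/-- The pairs of prediction errors `(h_n - h, h'_n - h)`, where the first one is orthogonal to
the observations `V` in `H` and non-zero there, and the second one is orthogonal to `V` in `H'`. -/
def errorRel (D V : Submodule ℝ (H × H')) : Set ((H × H') × (H × H')) :=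
  {e | e.1 ∈ D ∧ e.2 ∈ D ∧ e.1 - e.2 ∈ V ∧ (∀ v ∈ V, ⟪v.1, e.1.1⟫ = 0) ∧
    (∀ v ∈ V, ⟪v.2, e.2.2⟫ = 0) ∧ e.1.1 ≠ 0}

/-- The best predictor has the smallest error. -/
theorem norm_fst_le_of_mem_errorRel {D V : Submodule ℝ (H × H')} {e : (H × H') × (H × H')}
    (he : e ∈ errorRel D V) : ‖e.1.1‖ ^ 2 ≤ ‖e.2.1‖ ^ 2 := by
  obtain ⟨-, -, hv, h1, -, -⟩ := he
  have h := h1 _ hv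
  have e1 : e.2.1 = e.1.1 - (e.1 - e.2).1 := by simp
  rw [e1, norm_sub_sq_real, real_inner_comm, h]
  nlinarith [sq_nonneg ‖(e.1 - e.2).1‖]

theorem norm_snd_le_of_mem_errorRel {D V : Submodule ℝ (H × H')} {e : (H × H') × (H × H')}
    (he : e ∈ errorRel D V) : ‖e.2.2‖ ^ 2 ≤ ‖e.1.2‖ ^ 2 := by
  obtain ⟨-, -, hv, -, h2, -⟩ := he
  have h := h2 _ hv
  have e1 : e.1.2 = e.2.2 + (e.1 - e.2).2 := by simp
  rw [e1, norm_add_sq_real, real_inner_comm, h]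
  nlinarith [sq_nonneg ‖(e.1 - e.2).2‖]

/-- `E[(h'_n - h)²] ≤ (1 + δ) E[(h_n - h)²]` for all `h`. -/
def EffBound (D : Submodule ℝ (H × H')) (δ : ℝ) (V : Submodule ℝ (H × H')) : Prop :=
  ∀ e ∈ errorRel D V, ‖e.2.1‖ ^ 2 ≤ (1 + δ) * ‖e.1.1‖ ^ 2

/-- `E'[(h_n - h)²] ≤ (1 + δ) E'[(h'_n - h)²]` for all `h`. -/
def EffBound' (D : Submodule ℝ (H × H')) (δ : ℝ) (V : Submodule ℝ (H × H')) : Prop :=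
  ∀ e ∈ errorRel D V, ‖e.1.2‖ ^ 2 ≤ (1 + δ) * ‖e.2.2‖ ^ 2

/-- `|E'[(h_n - h)²] - a E[(h_n - h)²]| ≤ δ E[(h_n - h)²]` for all `h`. -/
def RatioBound (D : Submodule ℝ (H × H')) (a δ : ℝ) (V : Submodule ℝ (H × H')) : Prop :=
  ∀ e ∈ errorRel D V, |‖e.1.2‖ ^ 2 - a * ‖e.1.1‖ ^ 2| ≤ δ * ‖e.1.1‖ ^ 2

/-- `|E[(h'_n - h)²] - a⁻¹ E'[(h'_n - h)²]| ≤ δ E'[(h'_n - h)²]` for all `h`. -/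
def RatioBound' (D : Submodule ℝ (H × H')) (a δ : ℝ) (V : Submodule ℝ (H × H')) : Prop :=
  ∀ e ∈ errorRel D V, |‖e.2.1‖ ^ 2 - 1 / a * ‖e.2.2‖ ^ 2| ≤ δ * ‖e.2.2‖ ^ 2

/-- Vectors orthogonal to asymptotically dense subspaces are almost orthogonal to any
finite-dimensional space `U`. -/
theorem eventually_norm_starProjection_le {U : Submodule ℝ H} [FiniteDimensional ℝ U]
    {V : ℕ → Submodule ℝ (H × H')}
    (hV : ∀ x ∈ U, ∀ η > 0, ∀ᶠ n in atTop, ∃ v ∈ V n, ‖x - v.1‖ ≤ η) {θ : ℝ} (hθ : 0 < θ) :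
    ∀ᶠ n in atTop, ∀ x : H, (∀ v ∈ V n, ⟪v.1, x⟫ = 0) → ‖U.starProjection x‖ ≤ θ * ‖x‖ := by
  let b := stdOrthonormalBasis ℝ U
  set k := Module.finrank ℝ U
  have hev : ∀ᶠ n in atTop, ∀ i : Fin k, ∃ v ∈ V n, ‖(b i : H) - v.1‖ ≤ θ / (k + 1) :=
    Filter.eventually_all.2 fun i => hV _ (b i).2 _ (by positivity)
  filter_upwards [hev] with n hn x hx
  have hcoef : ∀ i, ‖⟪(b i : H), x⟫ • (b i : H)‖ ≤ θ / (k + 1) * ‖x‖ := fun i => by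
    obtain ⟨v, hv, hvi⟩ := hn i
    have h1 : ⟪(b i : H), x⟫ = ⟪(b i : H) - v.1, x⟫ := by rw [inner_sub_left, hx v hv, sub_zero]
    have h2 : ‖(b i : H)‖ = 1 := b.orthonormal.1 i
    rw [norm_smul, h2, mul_one, h1]
    exact (norm_inner_le_norm _ _).trans (by gcongr)
  have hsum : U.starProjection x = ∑ i, ⟪(b i : H), x⟫ • (b i : H) := by
    rw [Submodule.starProjection_apply, b.orthogonalProjectionOnto_apply_eq_sum]
    simp
  rw [hsum]
  refine (norm_sum_le _ _).trans ((Finset.sum_le_sum fun i _ => hcoef i).trans ?_)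
  rw [Finset.sum_const, Finset.card_univ, Fintype.card_fin, nsmul_eq_mul, ← mul_assoc]
  gcongr
  rw [mul_div_assoc', div_le_iff₀ (by positivity)]
  nlinarith

variable {D : Submodule ℝ (H × H')}

/-- The finitely many vectors that govern the near proportionality need not be in the domain of `D`;
their projections to its closure do the same and are approximated by the spaces `V n`. Hence errors
are almost orthogonal to them, and removing the small component along them is harmless. -/
theorem AsympConformal.eventually_near [CompleteSpace H] (hD : IsClosed (D : Set (H × H')))
    {a : ℝ} (ha : 0 < a)
    (hDa : AsympConformal D a) {V : ℕ → Submodule ℝ (H × H')}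
    (hV : ∀ p ∈ D, ∀ η > 0, ∀ᶠ n in atTop, ∃ v ∈ V n, ‖p.1 - v.1‖ ≤ η) {δ : ℝ} (hδ : 0 < δ) :
    ∀ᶠ n in atTop, ∀ e ∈ D, (∀ v ∈ V n, ⟪v.1, e.1⟫ = 0) →
      |‖e.2‖ ^ 2 - a * ‖e.1‖ ^ 2| ≤ δ * ‖e.1‖ ^ 2 := by
  obtain ⟨T, hT⟩ := hDa.right
  obtain ⟨s, hs⟩ := hDa.near (δ / 2) (by positivity)
  set F : Submodule ℝ H := (D.map (LinearMap.fst ℝ H H')).topologicalClosure with hF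
  have hFc : CompleteSpace F := (Submodule.isClosed_topologicalClosure _).completeSpace_coe
  let U : Submodule ℝ H := (Submodule.span ℝ (s : Set H)).map (F.starProjection : H →ₗ[ℝ] H)
  have hUF : ∀ u ∈ U, (u, T u) ∈ D := by
    rintro _ ⟨z, -, rfl⟩
    exact mk_mem_of_mem_closure hD hT (F.starProjection_apply_mem z)
  have hU : FiniteDimensional ℝ U := by infer_instance
  set M := ‖T‖
  have hM : 0 ≤ M := norm_nonneg T
  set θ : ℝ := δ / 2 / (a + 2 * M ^ 2 + 1) with hθdef
  have hθ : 0 < θ := by positivity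
  filter_upwards [eventually_norm_starProjection_le (U := U) (fun x hx => hV _ (hUF x hx)) hθ]
    with n hn e he hev
  set u := U.starProjection e.1 with hu
  have hw : (u, T u) ∈ D := hUF u (U.starProjection_apply_mem e.1)
  have hun : ‖u‖ ≤ θ * ‖e.1‖ := hn e.1 hev
  have hpD : e - (u, T u) ∈ D := D.sub_mem he hw
  have hpU : ∀ z ∈ U, ⟪z, e.1 - u⟫ = 0 := U.sub_starProjection_mem_orthogonal e.1
  have hps : ∀ f ∈ s, ⟪f, (e - (u, T u)).1⟫ = 0 := fun f hf => by
    have h1 : e.1 - u ∈ F := Submodule.le_topologicalClosure _ ⟨_, hpD, rfl⟩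
    have h3 := hpU _ ⟨f, Submodule.subset_span hf, rfl⟩
    change ⟪F.starProjection f, e.1 - u⟫ = 0 at h3
    rw [Submodule.inner_starProjection_left_eq_right,
      Submodule.starProjection_eq_self_iff.2 h1] at h3
    exact h3
  have key := hs _ hpD hps
  have hp2 : (e - (u, T u)).2 = T (e.1 - u) := hT _ hpD
  have he2 : e.2 = T e.1 := hT _ he
  have hpyth : ‖e.1‖ ^ 2 = ‖e.1 - u‖ ^ 2 + ‖u‖ ^ 2 := by
    have := hpU u (U.starProjection_apply_mem e.1)
    have h1 : e.1 = (e.1 - u) + u := by abel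
    conv_lhs => rw [h1]
    rw [norm_add_sq_real, real_inner_comm, this]
    ring
  rw [hp2] at key
  change |‖T (e.1 - u)‖ ^ 2 - a * ‖e.1 - u‖ ^ 2| ≤ δ / 2 * ‖e.1 - u‖ ^ 2 at key
  rw [he2]
  set x := ‖e.1‖
  have hx : 0 ≤ x := norm_nonneg e.1
  have hpx : ‖e.1 - u‖ ≤ x := by
    nlinarith [norm_nonneg (e.1 - u), sq_nonneg ‖u‖]
  have hTe : ‖T e.1‖ ≤ M * x := T.le_opNorm _
  have hTp : ‖T (e.1 - u)‖ ≤ M * x := (T.le_opNorm _).trans (by gcongr)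
  have hdiff : |‖T e.1‖ - ‖T (e.1 - u)‖| ≤ M * (θ * x) := by
    refine (abs_norm_sub_norm_le _ _).trans ?_
    rw [← map_sub, sub_sub_cancel]
    exact (T.le_opNorm _).trans (by gcongr)
  have hsq : |‖T e.1‖ ^ 2 - ‖T (e.1 - u)‖ ^ 2| ≤ 2 * M ^ 2 * θ * x ^ 2 := by
    rw [sq_sub_sq, abs_mul, abs_of_nonneg (by positivity : 0 ≤ ‖T e.1‖ + ‖T (e.1 - u)‖)]
    calc (‖T e.1‖ + ‖T (e.1 - u)‖) * |‖T e.1‖ - ‖T (e.1 - u)‖|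
        ≤ (M * x + M * x) * (M * (θ * x)) := by gcongr
      _ = _ := by ring
  have hu2 : ‖u‖ ^ 2 ≤ θ * x ^ 2 := by
    have h1 : ‖u‖ ≤ x := by nlinarith [norm_nonneg (e.1 - u), sq_nonneg ‖e.1 - u‖, norm_nonneg u]
    nlinarith [norm_nonneg u]
  have hθ' : θ * (a + 2 * M ^ 2) ≤ δ / 2 := by
    rw [hθdef, div_mul_eq_mul_div, div_le_iff₀ (by positivity)]
    nlinarith
  have hfin : (θ * (a + 2 * M ^ 2)) * x ^ 2 ≤ δ / 2 * x ^ 2 := by gcongr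
  have hkey' : δ / 2 * ‖e.1 - u‖ ^ 2 ≤ δ / 2 * x ^ 2 := by gcongr
  have hau : a * ‖u‖ ^ 2 ≤ a * (θ * x ^ 2) := by gcongr
  have hau0 : 0 ≤ a * ‖u‖ ^ 2 := by positivity
  rw [abs_le] at key hsq ⊢
  rw [hpyth]
  constructor <;> nlinarith

/-! ### Sufficiency -/

theorem AsympConformal.eventually_ratioBound [CompleteSpace H]
    (hD : IsClosed (D : Set (H × H'))) {a : ℝ} (ha : 0 < a)
    (hDa : AsympConformal D a) {V : ℕ → Submodule ℝ (H × H')}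
    (hV : ∀ p ∈ D, ∀ η > 0, ∀ᶠ n in atTop, ∃ v ∈ V n, ‖p.1 - v.1‖ ≤ η) {δ : ℝ} (hδ : 0 < δ) :
    ∀ᶠ n in atTop, RatioBound D a δ (V n) := by
  filter_upwards [hDa.eventually_near hD ha hV hδ] with n hn e he
  exact hn e.1 he.1 he.2.2.2.1

theorem AsympConformal.eventually_ratioBound' [CompleteSpace H] [CompleteSpace H']
    (hD : IsClosed (D : Set (H × H'))) {a : ℝ} (ha : 0 < a) (hDa : AsympConformal D a)
    {V : ℕ → Submodule ℝ (H × H')} (hVD : ∀ n, V n ≤ D)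
    (hV : ∀ p ∈ D, ∀ η > 0, ∀ᶠ n in atTop, ∃ v ∈ V n, ‖p.1 - v.1‖ ≤ η) {δ : ℝ} (hδ : 0 < δ) :
    ∀ᶠ n in atTop, RatioBound' D a δ (V n) := by
  obtain ⟨T, hT⟩ := hDa.right
  have hV' : ∀ p ∈ swapRel D, ∀ η > 0, ∀ᶠ n in atTop, ∃ v ∈ swapRel (V n), ‖p.1 - v.1‖ ≤ η := by
    intro p hp η hη
    filter_upwards [hV p.swap hp (η / (‖T‖ + 1)) (by positivity)] with n ⟨v, hv, hvp⟩
    refine ⟨v.swap, hv, ?_⟩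
    have h1 : p.1 = T p.2 := hT _ hp
    rw [h1, Prod.fst_swap, hT v (hVD n hv), ← map_sub]
    refine (T.le_opNorm _).trans ?_
    rw [Prod.fst_swap] at hvp
    calc ‖T‖ * ‖p.2 - v.1‖ ≤ (‖T‖ + 1) * (η / (‖T‖ + 1)) := by gcongr; linarith
      _ = η := by field_simp
  filter_upwards [(hDa.swap ha).eventually_near (isClosed_swapRel hD) (by positivity) hV' hδ]
    with n hn e he
  exact hn e.2.swap he.2.1 fun v hv => he.2.2.2.2.1 v.swap hv

theorem exists_pos_mul_le {a δ : ℝ} (ha : 0 < a) (hδ : 0 < δ) :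
    ∃ η > 0, (1 / a + η) * (a + η) ≤ 1 + δ := by
  refine ⟨min 1 (δ / (a + 1 / a + 1)), by positivity, ?_⟩
  set η := min 1 (δ / (a + 1 / a + 1)) with hη
  have h0 : 0 < η := by positivity
  have h1 : η ≤ 1 := min_le_left _ _
  have h2 : η * (a + 1 / a + 1) ≤ δ := (le_div_iff₀ (by positivity)).1 (min_le_right _ _)
  have h3 : 1 / a * a = 1 := by field_simp
  nlinarith

/-- Both kinds of efficiency follow from the two error ratios: `E[e'²] ≈ E'[e'²] / a ≤ E'[e²] / a ≈
E[e²]` by optimality of the second predictor under `μ'`, and similarly with exchanged measures. -/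
theorem effBound_of_ratioBound {a δ η : ℝ} (ha : 0 < a) (hη : 0 < η)
    (h : (1 / a + η) * (a + η) ≤ 1 + δ) {V : Submodule ℝ (H × H')}
    (h3 : RatioBound D a η V) (h4 : RatioBound' D a η V) :
    EffBound D δ V ∧ EffBound' D δ V := by
  have ha' : 0 < 1 / a := by positivity
  have aux : ∀ e ∈ errorRel D V, ‖e.1.2‖ ^ 2 ≤ (a + η) * ‖e.1.1‖ ^ 2 ∧
      ‖e.2.1‖ ^ 2 ≤ (1 / a + η) * ‖e.2.2‖ ^ 2 := fun e he =>
    ⟨by linarith [(abs_le.1 (h3 e he)).2], by linarith [(abs_le.1 (h4 e he)).2]⟩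
  refine ⟨fun e he => ?_, fun e he => ?_⟩
  · calc ‖e.2.1‖ ^ 2 ≤ (1 / a + η) * ((a + η) * ‖e.1.1‖ ^ 2) :=
        (aux e he).2.trans (by gcongr; exact (norm_snd_le_of_mem_errorRel he).trans (aux e he).1)
      _ ≤ (1 + δ) * ‖e.1.1‖ ^ 2 := by rw [← mul_assoc]; gcongr
  · calc ‖e.1.2‖ ^ 2 ≤ (a + η) * ((1 / a + η) * ‖e.2.2‖ ^ 2) :=
        (aux e he).1.trans (by gcongr; exact (norm_fst_le_of_mem_errorRel he).trans (aux e he).2)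
      _ ≤ (1 + δ) * ‖e.2.2‖ ^ 2 := by rw [← mul_assoc, mul_comm (a + η)]; gcongr

end Conformal

/-! ### From bounds on subspaces of finite codimension to conformality -/

section NearConformal

variable {H H' : Type*} [NormedAddCommGroup H] [InnerProductSpace ℝ H]
  [NormedAddCommGroup H'] [InnerProductSpace ℝ H'] {D : Submodule ℝ (H × H')}

theorem exists_operator_of_orthPart [CompleteSpace H] [CompleteSpace H']
    (hD : IsClosed (D : Set (H × H'))) (hr : ∀ k', ((0 : H), k') ∈ D → k' = 0) {s : Finset H}
    {s' : Finset H'} {c : ℝ} (hc : ∀ p ∈ orthPart D s s', ‖p.2‖ ^ 2 ≤ c * ‖p.1‖ ^ 2) :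
    ∃ T : H →L[ℝ] H', ∀ p ∈ D, p.2 = T p.1 := by
  obtain ⟨N, hN, hDN⟩ := exists_orthPart_sup_eq D s s'
  refine exists_operator_of_le hD (isClosed_orthPart hD s s') hDN hr (c := |c| + 1) fun p hp => ?_
  refine abs_le_of_sq_le_sq' ?_ (by positivity) |>.2
  refine (hc p hp).trans ?_
  rw [mul_pow]
  have : c ≤ (|c| + 1) ^ 2 := by nlinarith [le_abs_self c, abs_nonneg c]
  gcongr

theorem asympConformal_of_orthPart [CompleteSpace H] [CompleteSpace H']
    (hD : IsClosed (D : Set (H × H'))) (hr : ∀ k', ((0 : H), k') ∈ D → k' = 0)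
    (hl : ∀ k, (k, (0 : H')) ∈ D → k = 0) {a : ℝ} (ha : 0 < a)
    (h : ∀ ε > 0, ∃ (s : Finset H) (s' : Finset H'), ∀ p ∈ orthPart D s s',
      |‖p.2‖ ^ 2 - a * ‖p.1‖ ^ 2| ≤ ε * ‖p.1‖ ^ 2) : AsympConformal D a := by
  classical
  obtain ⟨s, s', hs⟩ := h (a / 2) (by positivity)
  obtain ⟨T, hT⟩ := exists_operator_of_orthPart hD hr (s := s) (s' := s') (c := 2 * a)
    fun p hp => by nlinarith [(abs_le.1 (hs p hp)).2, sq_nonneg ‖p.1‖]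
  obtain ⟨R, hR⟩ := exists_operator_of_orthPart (isClosed_swapRel hD) (fun k hk => hl k hk)
    (s := s') (s' := s) (c := 2 / a) fun p hp => by
      have h1 := (abs_le.1 (hs p.swap ⟨hp.1, hp.2.2, hp.2.1⟩)).1
      simp only [Prod.fst_swap, Prod.snd_swap] at h1
      rw [div_mul_eq_mul_div, le_div_iff₀ ha]
      linarith
  refine ⟨⟨T, hT⟩, ⟨R, fun p hp => hR p.swap hp⟩, fun ε hε => ?_⟩
  obtain ⟨s, s', hs⟩ := h ε hε
  refine ⟨s ∪ s'.image (ContinuousLinearMap.adjoint T), fun p hp hps => hs p ⟨hp, fun f hf =>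
    hps f (Finset.mem_union_left _ hf), fun f hf => ?_⟩⟩
  have := hps _ (Finset.mem_union_right _ (Finset.mem_image_of_mem _ hf))
  rwa [ContinuousLinearMap.adjoint_inner_left, ← hT p hp] at this

/-- If the conformality factors `κ` may depend on the precision, they still accumulate at some
`a > 0`, since they are bounded by the norms of the relation and of its inverse. -/
theorem exists_asympConformal [CompleteSpace H] [CompleteSpace H']
    (hD : IsClosed (D : Set (H × H'))) (hr : ∀ k', ((0 : H), k') ∈ D → k' = 0)
    (hl : ∀ k, (k, (0 : H')) ∈ D → k = 0) (hinf : ¬ FiniteDimensional ℝ D)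
    (h : ∀ ε > 0, ∃ (s : Finset H) (s' : Finset H') (κ : ℝ), 0 < κ ∧ ∀ p ∈ orthPart D s s',
      |‖p.2‖ ^ 2 - κ * ‖p.1‖ ^ 2| ≤ ε * κ * ‖p.1‖ ^ 2) : ∃ a, 0 < a ∧ AsympConformal D a := by
  obtain ⟨s, s', κ, hκ, hs⟩ := h (1 / 2) (by norm_num)
  obtain ⟨T, hT⟩ := exists_operator_of_orthPart hD hr (s := s) (s' := s') (c := 2 * κ)
    fun p hp => by nlinarith [(abs_le.1 (hs p hp)).2, mul_nonneg hκ.le (sq_nonneg ‖p.1‖)]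
  obtain ⟨R, hR⟩ := exists_operator_of_orthPart (isClosed_swapRel hD) (fun k hk => hl k hk)
    (s := s') (s' := s) (c := 2 / κ) fun p hp => by
      have h1 := (abs_le.1 (hs p.swap ⟨hp.1, hp.2.2, hp.2.1⟩)).1
      simp only [Prod.fst_swap, Prod.snd_swap] at h1
      rw [div_mul_eq_mul_div, le_div_iff₀ hκ]
      linarith
  clear hs hκ κ s s'
  set ε : ℕ → ℝ := fun n => 1 / ((n : ℝ) + 2) with hεdef
  have hε : ∀ n, 0 < ε n := fun n => by simp only [hεdef]; positivity
  have hε2 : ∀ n, ε n ≤ 1 / 2 := fun n => by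
    simp only [hεdef]
    gcongr
    linarith [(Nat.cast_nonneg n : (0 : ℝ) ≤ n)]
  have hε0 : Tendsto ε atTop (𝓝 0) := by
    have := (tendsto_const_div_atTop_nhds_zero_nat (1 : ℝ)).comp (tendsto_add_atTop_nat 2)
    refine this.congr fun n => ?_
    simp [hεdef]
  choose s s' κ hκ hs using fun n => h (ε n) (hε n)
  set b := 1 / (2 * (‖R‖ ^ 2 + 1)) with hb
  have hb0 : 0 < b := by positivity
  have hκb : ∀ n, κ n ∈ Set.Icc b (2 * ‖T‖ ^ 2) := fun n => by
    obtain ⟨p, hp, hp0⟩ := exists_ne_zero_mem_orthPart hinf (s n) (s' n)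
    have hpD : p ∈ D := hp.1
    have hp1 : 0 < ‖p.1‖ ^ 2 := by
      have : p.1 ≠ 0 := fun h0 => hp0 (Prod.ext h0 (hr p.2 (by rw [← h0]; exact hpD)))
      positivity
    have hκ1 := mul_nonneg (hκ n).le hp1.le
    have h1 : ‖p.2‖ ^ 2 ≤ ‖T‖ ^ 2 * ‖p.1‖ ^ 2 := by
      rw [← mul_pow, hT p hpD]; gcongr; exact T.le_opNorm _
    have h2 : ‖p.1‖ ^ 2 ≤ ‖R‖ ^ 2 * ‖p.2‖ ^ 2 := by
      have : p.1 = R p.2 := hR p.swap hpD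
      rw [← mul_pow]; nth_rewrite 1 [this]; gcongr; exact R.le_opNorm _
    obtain ⟨h3, h4⟩ := abs_le.1 (hs n p hp)
    have h5 : ε n * κ n * ‖p.1‖ ^ 2 ≤ 1 / 2 * (κ n * ‖p.1‖ ^ 2) := by
      rw [mul_assoc]; gcongr; exact hε2 n
    constructor
    · rw [hb, div_le_iff₀ (by positivity)]
      have h6 : ‖p.1‖ ^ 2 ≤ (κ n * (2 * (‖R‖ ^ 2 + 1))) * ‖p.1‖ ^ 2 := by
        have h7 : ‖R‖ ^ 2 * ‖p.2‖ ^ 2 ≤ ‖R‖ ^ 2 * (3 / 2 * (κ n * ‖p.1‖ ^ 2)) := by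
          gcongr; linarith
        nlinarith [mul_nonneg (sq_nonneg ‖R‖) hκ1]
      exact le_of_mul_le_mul_right (by linarith) hp1
    · exact le_of_mul_le_mul_right (by linarith) hp1
  obtain ⟨a, ha, φ, hφ, hlim⟩ := isCompact_Icc.tendsto_subseq hκb
  have ha0 : 0 < a := hb0.trans_le ha.1
  refine ⟨a, ha0, asympConformal_of_orthPart hD hr hl ha0 fun δ hδ => ?_⟩
  have hlim2 : Tendsto (fun n => |κ (φ n) - a| + ε (φ n) * κ (φ n)) atTop (𝓝 0) := by
    have h1 : Tendsto (fun n => |κ (φ n) - a|) atTop (𝓝 0) := by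
      simpa using (hlim.sub_const a).abs
    simpa using h1.add ((hε0.comp hφ.tendsto_atTop).mul hlim)
  obtain ⟨n, hn⟩ := (hlim2.eventually (gt_mem_nhds hδ)).exists
  refine ⟨s (φ n), s' (φ n), fun p hp => ?_⟩
  have e1 : ‖p.2‖ ^ 2 - a * ‖p.1‖ ^ 2 =
      (‖p.2‖ ^ 2 - κ (φ n) * ‖p.1‖ ^ 2) + (κ (φ n) - a) * ‖p.1‖ ^ 2 := by ring
  rw [e1]
  refine (abs_add_le _ _).trans ?_
  rw [abs_mul, abs_of_nonneg (sq_nonneg ‖p.1‖)]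
  calc _ ≤ ε (φ n) * κ (φ n) * ‖p.1‖ ^ 2 + |κ (φ n) - a| * ‖p.1‖ ^ 2 := by
        gcongr; exact hs _ p hp
    _ = (|κ (φ n) - a| + ε (φ n) * κ (φ n)) * ‖p.1‖ ^ 2 := by ring
    _ ≤ δ * ‖p.1‖ ^ 2 := by gcongr

/-- Comparing the almost orthogonal vectors `x + y` and `x - y` shows that `x` and `y` have almost
the same length. -/
theorem sq_norm_le_of_inner_add_sub {x y : H} {η : ℝ} (hη : 0 ≤ η)
    (h : ⟪x + y, x - y⟫ ^ 2 ≤ η ^ 2 * (‖x + y‖ ^ 2 * ‖x - y‖ ^ 2)) :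
    (1 - η) * ‖x‖ ^ 2 ≤ (1 + η) * ‖y‖ ^ 2 := by
  have e1 : ⟪x + y, x - y⟫ = ‖x‖ ^ 2 - ‖y‖ ^ 2 := by
    simp only [inner_add_left, inner_sub_right, real_inner_self_eq_norm_sq, real_inner_comm x y]
    ring
  have e2 : ‖x + y‖ ^ 2 + ‖x - y‖ ^ 2 = 2 * (‖x‖ ^ 2 + ‖y‖ ^ 2) := by
    rw [norm_add_sq_real, norm_sub_sq_real]; ring
  have h2 : (‖x‖ ^ 2 - ‖y‖ ^ 2) ^ 2 ≤ (η * (‖x‖ ^ 2 + ‖y‖ ^ 2)) ^ 2 := by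
    rw [← e1, mul_pow]
    refine h.trans ?_
    gcongr
    nlinarith [sq_nonneg (‖x + y‖ ^ 2 - ‖x - y‖ ^ 2)]
  have := (abs_le_of_sq_le_sq' h2 (by positivity)).2
  linarith

/-- Linear maps that almost preserve orthogonality are almost conformal. -/
theorem exists_conformal_factor (hr : ∀ k', ((0 : H), k') ∈ D → k' = 0)
    (hl : ∀ k, (k, (0 : H')) ∈ D → k = 0) (hinf : ¬ FiniteDimensional ℝ D) {s : Finset H}
    {s' : Finset H'} {η : ℝ} (hη : 0 < η) (hη1 : η < 1)
    (h : ∀ p ∈ orthPart D s s', ∀ q ∈ orthPart D s s', ⟪p.1, q.1⟫ = 0 → ‖p.1‖ = ‖q.1‖ →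
      p.1 ≠ 0 → ⟪p.2, q.2⟫ ^ 2 ≤ η ^ 2 * (‖p.2‖ ^ 2 * ‖q.2‖ ^ 2)) :
    ∃ κ, 0 < κ ∧ ∀ p ∈ orthPart D s s',
      |‖p.2‖ ^ 2 - κ * ‖p.1‖ ^ 2| ≤ (((1 + η) / (1 - η)) ^ 2 - 1) * κ * ‖p.1‖ ^ 2 := by
  classical
  have hη' : 0 < 1 - η := by linarith
  set r := (1 + η) / (1 - η) with hrdef
  have hr0 : 0 < r := by positivity
  -- vectors with orthogonal first components of equal length
  have step1 : ∀ p ∈ orthPart D s s', ∀ q ∈ orthPart D s s', ⟪p.1, q.1⟫ = 0 → ‖p.1‖ = ‖q.1‖ →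
      ‖p.2‖ ^ 2 ≤ r * ‖q.2‖ ^ 2 := by
    intro p hp q hq hpq hn
    by_cases hp0 : p.1 = 0
    · rw [hr p.2 (by rw [← hp0]; exact hp.1)]
      rw [norm_zero, zero_pow two_ne_zero]
      positivity
    have hpos : 0 < ‖p.1‖ ^ 2 := by positivity
    have hadd : ‖p.1 + q.1‖ ^ 2 = 2 * ‖p.1‖ ^ 2 := by
      rw [norm_add_sq_real, hpq, ← hn]; ring
    have hsub : ‖p.1 - q.1‖ ^ 2 = 2 * ‖p.1‖ ^ 2 := by
      rw [norm_sub_sq_real, hpq, ← hn]; ring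
    have key := h (p + q) ((orthPart D s s').add_mem hp hq) (p - q)
      ((orthPart D s s').sub_mem hp hq) (by
        rw [Prod.fst_add, Prod.fst_sub]
        simp only [inner_add_left, inner_sub_right, real_inner_self_eq_norm_sq, hpq,
          real_inner_comm p.1 q.1, hn]
        ring) (by
        rw [Prod.fst_add, Prod.fst_sub]
        exact (sq_eq_sq₀ (norm_nonneg _) (norm_nonneg _)).1 (by rw [hadd, hsub])) (by
        intro h0
        rw [← Prod.fst_add, h0, norm_zero] at hadd
        nlinarith)
    have := sq_norm_le_of_inner_add_sub hη.le key
    rw [hrdef, div_mul_eq_mul_div, le_div_iff₀ hη']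
    linarith
  -- vectors with orthogonal first components
  have step2 : ∀ p ∈ orthPart D s s', ∀ q ∈ orthPart D s s', ⟪p.1, q.1⟫ = 0 → q.1 ≠ 0 →
      ‖p.2‖ ^ 2 * ‖q.1‖ ^ 2 ≤ r * (‖q.2‖ ^ 2 * ‖p.1‖ ^ 2) := by
    intro p hp q hq hpq hq0
    have hq1 : 0 < ‖q.1‖ := norm_pos_iff.2 hq0
    have := step1 p hp ((‖p.1‖ / ‖q.1‖) • q) ((orthPart D s s').smul_mem _ hq)
      (by rw [Prod.smul_fst, inner_smul_right, hpq, mul_zero])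
      (by rw [Prod.smul_fst, norm_smul, Real.norm_of_nonneg (by positivity)]; field_simp)
    rw [Prod.smul_snd, norm_smul, Real.norm_of_nonneg (by positivity), mul_pow, div_pow] at this
    calc _ ≤ r * (‖p.1‖ ^ 2 / ‖q.1‖ ^ 2 * ‖q.2‖ ^ 2) * ‖q.1‖ ^ 2 := by gcongr
      _ = _ := by field_simp
  -- arbitrary vectors, compared by means of a third one that is orthogonal to both
  have step3 : ∀ p ∈ orthPart D s s', ∀ q ∈ orthPart D s s', q.1 ≠ 0 →
      ‖p.2‖ ^ 2 * ‖q.1‖ ^ 2 ≤ r ^ 2 * (‖q.2‖ ^ 2 * ‖p.1‖ ^ 2) := by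
    intro p hp q hq hq0
    obtain ⟨g, hg, hg0⟩ := exists_ne_zero_mem_orthPart hinf (insert p.1 (insert q.1 s)) s'
    have hgE : g ∈ orthPart D s s' := ⟨hg.1, fun f hf => hg.2.1 f (by simp [hf]), hg.2.2⟩
    have hg1 : g.1 ≠ 0 := fun h0 => hg0 (Prod.ext h0 (hr g.2 (by rw [← h0]; exact hg.1)))
    have hgp : ⟪p.1, g.1⟫ = 0 := hg.2.1 _ (by simp)
    have hgq : ⟪g.1, q.1⟫ = 0 := by rw [real_inner_comm]; exact hg.2.1 _ (by simp)
    have h1 := step2 p hp g hgE hgp hg1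
    have h2 := step2 g hgE q hq hgq hq0
    have hg2 : 0 < ‖g.1‖ ^ 2 := by positivity
    refine le_of_mul_le_mul_right ?_ hg2
    calc ‖p.2‖ ^ 2 * ‖q.1‖ ^ 2 * ‖g.1‖ ^ 2 = ‖p.2‖ ^ 2 * ‖g.1‖ ^ 2 * ‖q.1‖ ^ 2 := by ring
      _ ≤ r * (‖g.2‖ ^ 2 * ‖p.1‖ ^ 2) * ‖q.1‖ ^ 2 := by gcongr
      _ = r * ‖p.1‖ ^ 2 * (‖g.2‖ ^ 2 * ‖q.1‖ ^ 2) := by ring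
      _ ≤ r * ‖p.1‖ ^ 2 * (r * (‖q.2‖ ^ 2 * ‖g.1‖ ^ 2)) := by gcongr
      _ = _ := by ring
  obtain ⟨q, hq, hq0⟩ := exists_ne_zero_mem_orthPart hinf s s'
  have hq1 : q.1 ≠ 0 := fun h0 => hq0 (Prod.ext h0 (hr q.2 (by rw [← h0]; exact hq.1)))
  have hq2 : q.2 ≠ 0 := fun h0 => hq0 (Prod.ext (hl q.1 (by rw [← h0]; exact hq.1)) h0)
  have hq1' : 0 < ‖q.1‖ ^ 2 := by positivity
  refine ⟨‖q.2‖ ^ 2 / ‖q.1‖ ^ 2, by positivity, fun p hp => ?_⟩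
  set κ := ‖q.2‖ ^ 2 / ‖q.1‖ ^ 2 with hκ
  have hκ0 : 0 < κ := by positivity
  have hκq : ‖q.2‖ ^ 2 = κ * ‖q.1‖ ^ 2 := by rw [hκ]; field_simp
  have h1 : ‖p.2‖ ^ 2 ≤ r ^ 2 * (κ * ‖p.1‖ ^ 2) := by
    have := step3 p hp q hq hq1
    rw [hκq] at this
    exact le_of_mul_le_mul_right (by linarith) hq1'
  have h2 : κ * ‖p.1‖ ^ 2 ≤ r ^ 2 * ‖p.2‖ ^ 2 := by
    by_cases hp1 : p.1 = 0
    · rw [hp1, norm_zero, zero_pow two_ne_zero, mul_zero]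
      positivity
    have := step3 q hq p hp hp1
    rw [hκq] at this
    exact le_of_mul_le_mul_right (by linarith) hq1'
  have hr1 : 1 ≤ r ^ 2 := by
    have : 1 ≤ r := by rw [hrdef, le_div_iff₀ hη']; linarith
    nlinarith
  have h0 : 0 ≤ κ * ‖p.1‖ ^ 2 := by positivity
  rw [mul_assoc, abs_le]
  constructor
  · rcases le_total (‖p.2‖ ^ 2) (κ * ‖p.1‖ ^ 2) with hle | hle <;> nlinarith
  · linarith

end NearConformal

/-! ### Necessity: shifting errors -/

section Necessity

variable {H H' : Type*} [NormedAddCommGroup H] [InnerProductSpace ℝ H]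
  [NormedAddCommGroup H'] [InnerProductSpace ℝ H'] {D V : Submodule ℝ (H × H')}

theorem eq_zero_of_norm_add_smul_le {x k : H} {c : ℝ} (h : ∀ t : ℝ, ‖x + t • k‖ ^ 2 ≤ c) :
    k = 0 := by
  by_contra hk
  have hk' : 0 < ‖k‖ := norm_pos_iff.2 hk
  have hc : 0 ≤ c := (sq_nonneg _).trans (h 0)
  have h1 := h ((‖x‖ + c + 1) / ‖k‖)
  have h2 : ‖((‖x‖ + c + 1) / ‖k‖) • k‖ = ‖x‖ + c + 1 := by
    rw [norm_smul, Real.norm_of_nonneg (by positivity)]; field_simp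
  have h3 : c + 1 ≤ ‖x + ((‖x‖ + c + 1) / ‖k‖) • k‖ := by
    have := norm_sub_le (x + ((‖x‖ + c + 1) / ‖k‖) • k) x
    rw [add_sub_cancel_left, h2] at this
    linarith
  nlinarith

theorem exists_mem_errorRel [FiniteDimensional ℝ V] (hV : V ≤ D) {p : H × H'} (hp : p ∈ D)
    (hpV : ∀ v ∈ V, ⟪v.1, p.1⟫ = 0) (hp1 : p.1 ≠ 0) : ∃ q, (p, q) ∈ errorRel D V := by
  obtain ⟨g, hg, hgV⟩ := exists_snd_proj V p.2
  exact ⟨p - g, hp, D.sub_mem hp (hV hg), by simpa using hg, hpV, hgV, hp1⟩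

theorem exists_notMem_map_fst (hinf : ¬ FiniteDimensional ℝ (D.map (LinearMap.fst ℝ H H')))
    (V : Submodule ℝ (H × H')) [FiniteDimensional ℝ V] :
    ∃ p ∈ D, p.1 ∉ V.map (LinearMap.fst ℝ H H') := by
  by_contra! h
  refine hinf (Submodule.finiteDimensional_of_le (S₂ := V.map (LinearMap.fst ℝ H H')) ?_)
  rintro _ ⟨p, hp, rfl⟩
  exact h p hp

theorem errorRel_nonempty (hinf : ¬ FiniteDimensional ℝ (D.map (LinearMap.fst ℝ H H')))
    [FiniteDimensional ℝ V] (hV : V ≤ D) : (errorRel D V).Nonempty := by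
  obtain ⟨p, hp, hpV⟩ := exists_notMem_map_fst hinf V
  obtain ⟨g, hg, hgV⟩ := exists_fst_proj V p.1
  obtain ⟨q, hq⟩ := exists_mem_errorRel hV (p := p - g) (D.sub_mem hp (hV hg)) hgV
    fun h0 => hpV ⟨g, hg, (sub_eq_zero.1 h0).symm⟩
  exact ⟨_, hq⟩

theorem not_finiteDimensional_of_map_fst
    (hinf : ¬ FiniteDimensional ℝ (D.map (LinearMap.fst ℝ H H'))) : ¬ FiniteDimensional ℝ D :=
  fun _ => hinf inferInstance

/-- If `D` contains `(v.1, 0)` for an observation `v`, then it contains `(0, v.2)` as well, and the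
second error can be shifted by multiples of `(v.1, 0)` without changing the orthogonality
relations. -/
theorem shift_mem_errorRel {e : (H × H') × (H × H')} (he : e ∈ errorRel D V) {v : H × H'}
    (hv : v ∈ V) (hVD : V ≤ D) (hvD : (v.1, (0 : H')) ∈ D) (t : ℝ) :
    (e.1 - t • ((0 : H), v.2), e.2 + t • (v.1, (0 : H'))) ∈ errorRel D V := by
  have hv2 : ((0 : H), v.2) ∈ D := by
    have := D.sub_mem (hVD hv) hvD
    simpa [Prod.sub_def] using this
  obtain ⟨h1, h2, h3, h4, h5, h6⟩ := he
  refine ⟨D.sub_mem h1 (D.smul_mem t hv2), D.add_mem h2 (D.smul_mem t hvD), ?_, ?_, ?_, ?_⟩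
  · have : e.1 - t • ((0 : H), v.2) - (e.2 + t • (v.1, (0 : H'))) = e.1 - e.2 - t • v := by
      ext
      · simp [sub_sub]
      · simp [sub_right_comm]
    rw [this]
    exact V.sub_mem h3 (V.smul_mem t hv)
  · simpa using h4
  · simpa using h5
  · simpa using h6

theorem fst_eq_zero_of_effBound (hinf : ¬ FiniteDimensional ℝ (D.map (LinearMap.fst ℝ H H')))
    [FiniteDimensional ℝ V] (hVD : V ≤ D) {δ : ℝ} (h : EffBound D δ V) {v : H × H'}
    (hv : v ∈ V) (hvD : (v.1, (0 : H')) ∈ D) : v.1 = 0 := by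
  obtain ⟨e, he⟩ := errorRel_nonempty hinf hVD
  refine eq_zero_of_norm_add_smul_le (x := e.2.1) (c := (1 + δ) * ‖e.1.1‖ ^ 2) fun t => ?_
  simpa using h _ (shift_mem_errorRel he hv hVD hvD t)

theorem fst_eq_zero_of_ratioBound' (hinf : ¬ FiniteDimensional ℝ (D.map (LinearMap.fst ℝ H H')))
    [FiniteDimensional ℝ V] (hVD : V ≤ D) {a δ : ℝ} (h : RatioBound' D a δ V) {v : H × H'}
    (hv : v ∈ V) (hvD : (v.1, (0 : H')) ∈ D) : v.1 = 0 := by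
  obtain ⟨e, he⟩ := errorRel_nonempty hinf hVD
  refine eq_zero_of_norm_add_smul_le (x := e.2.1) (c := (1 / a + δ) * ‖e.2.2‖ ^ 2) fun t => ?_
  have := (abs_le.1 (h _ (shift_mem_errorRel he hv hVD hvD t))).2
  simp only [Prod.fst_add, Prod.smul_fst, Prod.snd_add, Prod.smul_snd, smul_zero, add_zero] at this
  linarith

/-! ### Necessity: error ratios -/

section Ratio

variable [CompleteSpace H] [CompleteSpace H']

/-- Every element of `D` that is orthogonal to `V` in `H` is a first error, so the error ratio is a
statement about a part of `D` of finite codimension. The condition on variances excludes pairs `(k,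
0)`, which the error ratio does not see; pairs `(0, k')` are excluded because they could be added to
a first error without changing its norm in `H`. -/
theorem asympConformal_of_ratioBound (hD : IsClosed (D : Set (H × H')))
    (hinf : ¬ FiniteDimensional ℝ (D.map (LinearMap.fst ℝ H H'))) {o : H} {o' : H'}
    (ho' : o' ≠ 0) (hoD : (o, o') ∈ D)
    (hvar : ∀ p ∈ D, (∃ c : ℝ, p.2 = c • o') → ∃ c : ℝ, p.1 = c • o) {a : ℝ} (ha : 0 < a)
    (h : ∀ δ > 0, ∃ V : Submodule ℝ (H × H'), FiniteDimensional ℝ V ∧ V ≤ D ∧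
      RatioBound D a δ V) : AsympConformal D a := by
  have hr : ∀ k', ((0 : H), k') ∈ D → k' = 0 := by
    intro k hk
    obtain ⟨V, hVf, hVD, hV⟩ := h 1 one_pos
    obtain ⟨e, he⟩ := errorRel_nonempty hinf hVD
    refine eq_zero_of_norm_add_smul_le (x := e.1.2) (c := (a + 1) * ‖e.1.1‖ ^ 2) fun t => ?_
    have h1 : (e.1 + t • ((0 : H), k)).1 = e.1.1 := by simp
    obtain ⟨q, hq⟩ := exists_mem_errorRel hVD (p := e.1 + t • ((0 : H), k))
      (D.add_mem he.1 (D.smul_mem t hk)) (by rw [h1]; exact he.2.2.2.1)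
      (by rw [h1]; exact he.2.2.2.2.2)
    have := (abs_le.1 (hV _ hq)).2
    rw [h1] at this
    simp only [Prod.snd_add, Prod.smul_snd] at this
    linarith
  have hl : ∀ k, (k, (0 : H')) ∈ D → k = 0 := by
    intro k hk
    obtain ⟨c, hc⟩ := hvar _ hk ⟨0, by simp⟩
    simp only at hc
    have h0 : ((0 : H), c • o') ∈ D := by
      have := D.sub_mem (D.smul_mem c hoD) hk
      simpa [hc] using this
    rcases smul_eq_zero.1 (hr _ h0) with h1 | h1
    · rw [hc, h1, zero_smul]
    · exact absurd h1 ho'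
  refine asympConformal_of_orthPart hD hr hl ha fun ε hε => ?_
  obtain ⟨V, hVf, hVD, hV⟩ := h ε hε
  obtain ⟨s, -, hs⟩ := exists_finset_fst V
  refine ⟨s, ∅, fun p hp => ?_⟩
  by_cases hp0 : p.1 = 0
  · rw [hp0, hr p.2 (by rw [← hp0]; exact hp.1)]
    simp
  obtain ⟨q, hq⟩ := exists_mem_errorRel hVD hp.1 (hs _ hp.2.1) hp0
  exact hV _ hq

/-- The counterpart of `asympConformal_of_ratioBound` for the second error. Here every element of
`D` that is orthogonal to `V` in `H'` is a second error; its first error is its remainder after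
projection to `V` in `H`. -/
theorem asympConformal_of_ratioBound' (hD : IsClosed (D : Set (H × H')))
    (hinf : ¬ FiniteDimensional ℝ (D.map (LinearMap.fst ℝ H H'))) {o : H} {o' : H'}
    (ho : o ≠ 0)
    (hvar : ∀ p ∈ D, (∃ c : ℝ, p.1 = c • o) ↔ ∃ c : ℝ, p.2 = c • o') {a : ℝ} (ha : 0 < a)
    (h : ∀ δ > 0, ∃ V : Submodule ℝ (H × H'), FiniteDimensional ℝ V ∧ V ≤ D ∧ (o, o') ∈ V ∧
      RatioBound' D a δ V) : AsympConformal D a := by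
  obtain ⟨V, hVf, hVD, hoV, hV⟩ := h 1 one_pos
  have hoD := hVD hoV
  have hl : ∀ k, (k, (0 : H')) ∈ D → k = 0 := by
    intro k hk
    obtain ⟨c, hc⟩ := (hvar _ hk).2 ⟨0, by simp⟩
    have h1 := fst_eq_zero_of_ratioBound' hinf hVD hV (V.smul_mem c hoV)
      (by simp only [Prod.smul_fst, ← hc]; exact hk)
    exact hc.trans h1
  have hr : ∀ k', ((0 : H), k') ∈ D → k' = 0 := by
    intro k hk
    obtain ⟨c, hc⟩ := (hvar _ hk).1 ⟨0, by simp⟩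
    simp only at hc
    have h0 : (c • o, (0 : H')) ∈ D := by
      have := D.sub_mem (D.smul_mem c hoD) hk
      simpa [hc] using this
    rcases smul_eq_zero.1 (hl _ h0) with h1 | h1
    · rw [hc, h1, zero_smul]
    · exact absurd h1 ho
  refine AsympConformal.of_swap ha (asympConformal_of_orthPart (isClosed_swapRel hD)
    (fun k hk => hl k hk) (fun k hk => hr k hk) (by positivity) fun ε hε => ?_)
  clear hV hoV hVf hVD V hoD
  obtain ⟨V, hVf, hVD, hoV, hV⟩ := h ε hε
  obtain ⟨s, -, hs⟩ := exists_finset_snd V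
  refine ⟨s, ∅, fun p hp => ?_⟩
  by_cases hp0 : p.1 = 0
  · have : p.2 = 0 := hl p.2 (by rw [← hp0]; exact hp.1)
    rw [hp0, this]
    simp
  obtain ⟨g, hg, hgV⟩ := exists_fst_proj V p.2
  refine hV (p.swap - g, p.swap) ⟨D.sub_mem hp.1 (hVD hg), hp.1, by simpa using hg, hgV,
    hs _ hp.2.1, fun h0 => hp0 ?_⟩
  -- a non-zero error orthogonal to `V` in `H'` cannot be an element of `V`
  have h1 : p.swap = g := by
    refine sub_eq_zero.1 (Prod.ext h0 (hr _ ?_))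
    have h0' : (p.swap - g).1 = 0 := h0
    rw [← h0']
    exact D.sub_mem hp.1 (hVD hg)
  have h2 := hs _ hp.2.1 g hg
  rw [← h1] at h2
  exact inner_self_eq_zero.1 h2

end Ratio

/-! ### Necessity: efficiency -/

/-- If `p` is orthogonal to `W` in both spaces and to `q` in `H`, and `q` is orthogonal to `W` in
`H'`, then the predictor of `p` based on `W` and `q` is `0` in `H`, and the regression of `p` on `q`
in `H'`. -/
theorem mem_errorRel_sup_span {W : Submodule ℝ (H × H')} {p q : H × H'}
    (hp : p ∈ D) (hq : q ∈ D) (hp1 : ∀ w ∈ W, ⟪w.1, p.1⟫ = 0) (hp2 : ∀ w ∈ W, ⟪w.2, p.2⟫ = 0)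
    (hq2 : ∀ w ∈ W, ⟪w.2, q.2⟫ = 0)
    (hpq : ⟪p.1, q.1⟫ = 0) (hp0 : p.1 ≠ 0) (hq0 : q.2 ≠ 0) :
    (p, p - (⟪p.2, q.2⟫ / ‖q.2‖ ^ 2) • q) ∈ errorRel D (W ⊔ Submodule.span ℝ {q}) := by
  set β := ⟪p.2, q.2⟫ / ‖q.2‖ ^ 2 with hβ
  have hqV : q ∈ W ⊔ Submodule.span ℝ {q} :=
    Submodule.mem_sup_right (Submodule.mem_span_singleton_self q)
  refine ⟨hp, D.sub_mem hp (D.smul_mem β hq), ?_, fun v hv => ?_, fun v hv => ?_, hp0⟩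
  · simpa using Submodule.smul_mem _ β hqV
  · obtain ⟨w, hw, z, hz, rfl⟩ := Submodule.mem_sup.1 hv
    obtain ⟨c, rfl⟩ := Submodule.mem_span_singleton.1 hz
    simp [inner_add_left, inner_smul_left, hp1 w hw, real_inner_comm, hpq]
  · obtain ⟨w, hw, z, hz, rfl⟩ := Submodule.mem_sup.1 hv
    obtain ⟨c, rfl⟩ := Submodule.mem_span_singleton.1 hz
    have h1 : ⟪q.2, p.2 - β • q.2⟫ = 0 := by
      rw [inner_sub_right, inner_smul_right, real_inner_self_eq_norm_sq, real_inner_comm, hβ]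
      have : ‖q.2‖ ≠ 0 := norm_ne_zero_iff.2 hq0
      field_simp
      ring
    simp only [Prod.snd_add, Prod.smul_snd, Prod.snd_sub, inner_add_left, inner_smul_left, h1]
    rw [inner_sub_right, inner_smul_right, hp2 w hw, hq2 w hw]
    simp

theorem notMem_map_fst_of_orthogonal {W : Submodule ℝ (H × H')} {q : H × H'}
    (hq1 : ∀ w ∈ W, ⟪w.1, q.1⟫ = 0) (hq0 : q.1 ≠ 0) : q.1 ∉ W.map (LinearMap.fst ℝ H H') := by
  rintro ⟨w, hw, hwq⟩
  have := hq1 w hw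
  change w.1 = q.1 at hwq
  rw [hwq] at this
  exact hq0 (inner_self_eq_zero.1 this)

/-- The second error of `p` is its first error minus the regression on `q`. Efficiency in `H` bounds
the regression coefficient, and by symmetry also that of `q` on `p`. -/
theorem inner_sq_le_of_effBound {W : Submodule ℝ (H × H')} {δ : ℝ} (hδ : 0 ≤ δ)
    (h : ∀ q ∈ D, q.1 ∉ W.map (LinearMap.fst ℝ H H') →
      EffBound D δ (W ⊔ Submodule.span ℝ {q})) {p q : H × H'}
    (hp : p ∈ D) (hq : q ∈ D) (hp1 : ∀ w ∈ W, ⟪w.1, p.1⟫ = 0) (hp2 : ∀ w ∈ W, ⟪w.2, p.2⟫ = 0)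
    (hq1 : ∀ w ∈ W, ⟪w.1, q.1⟫ = 0) (hq2 : ∀ w ∈ W, ⟪w.2, q.2⟫ = 0)
    (hpq : ⟪p.1, q.1⟫ = 0) (hn : ‖p.1‖ = ‖q.1‖) (hp0 : p.1 ≠ 0) (hp0' : p.2 ≠ 0)
    (hq0' : q.2 ≠ 0) : ⟪p.2, q.2⟫ ^ 2 ≤ δ * (‖p.2‖ ^ 2 * ‖q.2‖ ^ 2) := by
  have hq0 : q.1 ≠ 0 := by rwa [← norm_ne_zero_iff, ← hn, norm_ne_zero_iff]
  have aux : ∀ {p q : H × H'}, p ∈ D → q ∈ D → (∀ w ∈ W, ⟪w.1, p.1⟫ = 0) →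
      (∀ w ∈ W, ⟪w.2, p.2⟫ = 0) → (∀ w ∈ W, ⟪w.1, q.1⟫ = 0) → (∀ w ∈ W, ⟪w.2, q.2⟫ = 0) →
      ⟪p.1, q.1⟫ = 0 → ‖p.1‖ = ‖q.1‖ → p.1 ≠ 0 → q.1 ≠ 0 → q.2 ≠ 0 →
      ⟪p.2, q.2⟫ ^ 2 ≤ δ * (‖q.2‖ ^ 2) ^ 2 := by
    intro p q hp hq hp1 hp2 hq1 hq2 hpq hn hp0 hq0 hq0'
    have key := h q hq (notMem_map_fst_of_orthogonal hq1 hq0) _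
      (mem_errorRel_sup_span hp hq hp1 hp2 hq2 hpq hp0 hq0')
    simp only [Prod.fst_sub, Prod.smul_fst] at key
    rw [norm_sub_sq_real, inner_smul_right, hpq, norm_smul, mul_pow, Real.norm_eq_abs, sq_abs,
      hn, div_pow] at key
    have hq1' : 0 < ‖q.1‖ ^ 2 := by positivity
    have hq2' : 0 < (‖q.2‖ ^ 2) ^ 2 := by positivity
    rw [← div_le_iff₀ hq2']
    exact le_of_mul_le_mul_right (by linarith) hq1'
  have h1 := aux hp hq hp1 hp2 hq1 hq2 hpq hn hp0 hq0 hq0'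
  have h2 := aux hq hp hq1 hq2 hp1 hp2 (by rwa [real_inner_comm]) hn.symm hq0 hp0 hp0'
  rw [real_inner_comm] at h2
  -- multiply the bounds for the regressions of `p` on `q` and of `q` on `p`
  refine abs_le_of_sq_le_sq' ?_ (by positivity) |>.2
  calc (⟪p.2, q.2⟫ ^ 2) ^ 2 = ⟪p.2, q.2⟫ ^ 2 * ⟪p.2, q.2⟫ ^ 2 := by ring
    _ ≤ (δ * (‖q.2‖ ^ 2) ^ 2) * (δ * (‖p.2‖ ^ 2) ^ 2) := by gcongr
    _ = _ := by ring

/-- The second error of `p` in `H'` is `p` minus its regression on `q`, so efficiency bounds the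
correlation of `p` and `q` directly. -/
theorem inner_sq_le_of_effBound' {W : Submodule ℝ (H × H')} {δ : ℝ} (hδ : 0 ≤ δ)
    (h : ∀ q ∈ D, q.1 ∉ W.map (LinearMap.fst ℝ H H') →
      EffBound' D δ (W ⊔ Submodule.span ℝ {q})) {p q : H × H'}
    (hp : p ∈ D) (hq : q ∈ D) (hp1 : ∀ w ∈ W, ⟪w.1, p.1⟫ = 0) (hp2 : ∀ w ∈ W, ⟪w.2, p.2⟫ = 0)
    (hq1 : ∀ w ∈ W, ⟪w.1, q.1⟫ = 0) (hq2 : ∀ w ∈ W, ⟪w.2, q.2⟫ = 0)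
    (hpq : ⟪p.1, q.1⟫ = 0) (hn : ‖p.1‖ = ‖q.1‖) (hp0 : p.1 ≠ 0)
    (hq0' : q.2 ≠ 0) : ⟪p.2, q.2⟫ ^ 2 ≤ δ * (‖p.2‖ ^ 2 * ‖q.2‖ ^ 2) := by
  have hq0 : q.1 ≠ 0 := by rwa [← norm_ne_zero_iff, ← hn, norm_ne_zero_iff]
  have key := h q hq (notMem_map_fst_of_orthogonal hq1 hq0) _
    (mem_errorRel_sup_span hp hq hp1 hp2 hq2 hpq hp0 hq0')
  simp only [Prod.snd_sub, Prod.smul_snd] at key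
  rw [norm_sub_sq_real, inner_smul_right, norm_smul, mul_pow, Real.norm_eq_abs, sq_abs] at key
  set x := ⟪p.2, q.2⟫
  have hq2' : 0 < ‖q.2‖ ^ 2 := by positivity
  have e1 : (1 + δ) * (‖p.2‖ ^ 2 - 2 * (x / ‖q.2‖ ^ 2 * x) + (x / ‖q.2‖ ^ 2) ^ 2 * ‖q.2‖ ^ 2) *
      ‖q.2‖ ^ 2 = (1 + δ) * (‖p.2‖ ^ 2 * ‖q.2‖ ^ 2 - x ^ 2) := by
    field_simp
    ring
  have h2 := mul_le_mul_of_nonneg_right key hq2'.le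
  rw [e1] at h2
  nlinarith [mul_nonneg hδ (sq_nonneg x)]

theorem exists_conformal_parameter {ε : ℝ} (hε : 0 < ε) :
    ∃ η, 0 < η ∧ η < 1 ∧ ((1 + η) / (1 - η)) ^ 2 - 1 ≤ ε := by
  have hcont : ContinuousAt (fun η : ℝ => ((1 + η) / (1 - η)) ^ 2 - 1) 0 := by
    refine ContinuousAt.sub (ContinuousAt.pow (ContinuousAt.div ?_ ?_ (by norm_num)) 2)
      continuousAt_const <;> fun_prop
  have h0 : (fun η : ℝ => ((1 + η) / (1 - η)) ^ 2 - 1) 0 < ε := by simpa using hε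
  have h1 : ∀ᶠ η : ℝ in 𝓝 0, η < 1 := gt_mem_nhds one_pos
  have h2 := (((hcont.eventually (gt_mem_nhds h0)).and h1).filter_mono
    nhdsWithin_le_nhds).and (self_mem_nhdsWithin (s := Set.Ioi (0 : ℝ)))
  obtain ⟨η, ⟨h3, h4⟩, h5⟩ := h2.exists
  exact ⟨η, h5, h4, h3.le⟩

/-- If, in finite codimension, orthogonality in `H` of vectors of equal norm implies approximate
orthogonality in `H'`, then the relation is asymptotically conformal. -/
theorem exists_asympConformal_of_inner_sq_le [CompleteSpace H] [CompleteSpace H']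
    (hD : IsClosed (D : Set (H × H')))
    (hinf : ¬ FiniteDimensional ℝ (D.map (LinearMap.fst ℝ H H')))
    (hr : ∀ k', ((0 : H), k') ∈ D → k' = 0) (hl : ∀ k, (k, (0 : H')) ∈ D → k = 0)
    (h : ∀ δ > 0, ∃ W : Submodule ℝ (H × H'), FiniteDimensional ℝ W ∧
      ∀ p ∈ D, ∀ q ∈ D, (∀ w ∈ W, ⟪w.1, p.1⟫ = 0) → (∀ w ∈ W, ⟪w.2, p.2⟫ = 0) →
      (∀ w ∈ W, ⟪w.1, q.1⟫ = 0) → (∀ w ∈ W, ⟪w.2, q.2⟫ = 0) → ⟪p.1, q.1⟫ = 0 →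
      ‖p.1‖ = ‖q.1‖ → p.1 ≠ 0 → p.2 ≠ 0 → q.2 ≠ 0 →
      ⟪p.2, q.2⟫ ^ 2 ≤ δ * (‖p.2‖ ^ 2 * ‖q.2‖ ^ 2)) :
    ∃ a, 0 < a ∧ AsympConformal D a := by
  have hinf' := not_finiteDimensional_of_map_fst hinf
  refine exists_asympConformal hD hr hl hinf' fun ε hε => ?_
  obtain ⟨η, hη0, hη1, hηε⟩ := exists_conformal_parameter hε
  obtain ⟨W, hW, hstar⟩ := h (η ^ 2) (by positivity)
  obtain ⟨s, -, hs⟩ := exists_finset_fst W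
  obtain ⟨s', -, hs'⟩ := exists_finset_snd W
  obtain ⟨κ, hκ, hκp⟩ := exists_conformal_factor (s := s) (s' := s') hr hl hinf' hη0 hη1 (by
    intro p hp q hq hpq hn hp0
    have hq0 : q.1 ≠ 0 := by rwa [← norm_ne_zero_iff, ← hn, norm_ne_zero_iff]
    exact hstar p hp.1 q hq.1 (hs _ hp.2.1) (hs' _ hp.2.2) (hs _ hq.2.1) (hs' _ hq.2.2) hpq hn hp0
      (fun h0 => hp0 (hl p.1 (by rw [← h0]; exact hp.1)))
      (fun h0 => hq0 (hl q.1 (by rw [← h0]; exact hq.1))))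
  refine ⟨s, s', κ, hκ, fun p hp => (hκp p hp).trans ?_⟩
  gcongr

/-- If `D` were multivalued, then the errors of the second predictor could be shifted along a
multivalued direction, without changing those of the first one. -/
theorem eq_zero_of_effBound (hinf : ¬ FiniteDimensional ℝ (D.map (LinearMap.fst ℝ H H')))
    {W : Submodule ℝ (H × H')} [FiniteDimensional ℝ W] (hWD : W ≤ D)
    (hWinj : ∀ w ∈ W, w.1 = 0 → w = 0) {δ : ℝ}
    (h : ∀ q ∈ D, q.1 ∉ W.map (LinearMap.fst ℝ H H') →
      EffBound D δ (W ⊔ Submodule.span ℝ {q})) {k' : H'} (hk : ((0 : H), k') ∈ D) : k' = 0 := by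
  have aux : ∀ q ∈ D, q.1 ∉ W.map (LinearMap.fst ℝ H H') → ⟪q.2, k'⟫ = 0 := by
    intro q hq hqW
    set V := W ⊔ Submodule.span ℝ {q} with hVdef
    have hVD : V ≤ D := sup_le hWD ((Submodule.span_singleton_le_iff_mem _ _).2 hq)
    have hqV : q ∈ V := Submodule.mem_sup_right (Submodule.mem_span_singleton_self q)
    obtain ⟨e, he⟩ := errorRel_nonempty hinf hVD
    obtain ⟨g, hg, hgV⟩ := exists_snd_proj V k'
    have hg1 : g.1 = 0 := by
      refine eq_zero_of_norm_add_smul_le (x := e.2.1) (c := (1 + δ) * ‖e.1.1‖ ^ 2) fun t => ?_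
      have hmem : (e.1 - t • ((0 : H), k'), e.2 - t • (((0 : H), k') - g)) ∈ errorRel D V := by
        obtain ⟨a1, a2, a3, a4, a5, a6⟩ := he
        refine ⟨D.sub_mem a1 (D.smul_mem t hk),
          D.sub_mem a2 (D.smul_mem t (D.sub_mem hk (hVD hg))), ?_, ?_, ?_, ?_⟩
        · have : e.1 - t • ((0 : H), k') - (e.2 - t • (((0 : H), k') - g)) =
              e.1 - e.2 - t • g := by rw [smul_sub]; abel
          rw [this]
          exact V.sub_mem a3 (V.smul_mem t hg)
        · simpa using a4
        · intro v hv
          change ⟪v.2, e.2.2 - t • (k' - g.2)⟫ = 0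
          rw [inner_sub_right, inner_smul_right, a5 v hv, hgV v hv, mul_zero, sub_zero]
        · simpa using a6
      simpa using h q hq hqW _ hmem
    have hg0 : g = 0 := by
      obtain ⟨w, hw, z, hz, hwz⟩ := Submodule.mem_sup.1 hg
      obtain ⟨c, rfl⟩ := Submodule.mem_span_singleton.1 hz
      have h1 : w.1 + c • q.1 = 0 := by rw [← hg1, ← hwz]; rfl
      by_cases hc : c = 0
      · rw [hc, zero_smul, add_zero] at h1
        rw [← hwz, hc, hWinj w hw h1]
        simp
      · refine absurd ⟨-(c⁻¹ • w), W.neg_mem (W.smul_mem _ hw), ?_⟩ hqW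
        change -(c⁻¹ • w.1) = q.1
        rw [eq_neg_of_add_eq_zero_left h1, smul_neg, neg_neg, smul_smul, inv_mul_cancel₀ hc,
          one_smul]
    simpa [hg0] using hgV q hqV
  obtain ⟨f, hf, hfW⟩ := exists_notMem_map_fst hinf W
  have h1 := aux f hf hfW
  have h2 := aux (f + ((0 : H), k')) (D.add_mem hf hk) (by simpa using hfW)
  rw [Prod.snd_add, inner_add_left, h1, zero_add] at h2
  exact inner_self_eq_zero.1 h2

/-- Pairs `(k, 0)` are excluded by shifting second errors, after `k` has been made an observation if
necessary. -/
theorem exists_asympConformal_of_effBound [CompleteSpace H] [CompleteSpace H']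
    (hD : IsClosed (D : Set (H × H')))
    (hinf : ¬ FiniteDimensional ℝ (D.map (LinearMap.fst ℝ H H')))
    {W : ℕ → Submodule ℝ (H × H')} (hWf : ∀ n, FiniteDimensional ℝ (W n)) (hWD : ∀ n, W n ≤ D)
    (hWinj : ∀ n, ∀ w ∈ W n, w.1 = 0 → w = 0)
    (hmono : Monotone W) (h1 : ∀ δ > 0, ∀ᶠ n in atTop, EffBound D δ (W n))
    (h2 : ∀ δ > 0, ∀ᶠ n in atTop, ∀ q ∈ D, q.1 ∉ (W n).map (LinearMap.fst ℝ H H') →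
      EffBound D δ (W n ⊔ Submodule.span ℝ {q})) : ∃ a, 0 < a ∧ AsympConformal D a := by
  have hl : ∀ k, (k, (0 : H')) ∈ D → k = 0 := by
    intro k hk
    by_cases hkW : ∃ n, k ∈ (W n).map (LinearMap.fst ℝ H H')
    · obtain ⟨n, w, hw, hwk⟩ := hkW
      change w.1 = k at hwk
      obtain ⟨N, hN, hnN⟩ := ((h1 1 one_pos).and (eventually_ge_atTop n)).exists
      have := fst_eq_zero_of_effBound hinf (hWD N) hN (hmono hnN hw) (by rw [hwk]; exact hk)
      rw [← hwk, this]
    · push Not at hkW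
      obtain ⟨n, hn⟩ := (h2 1 one_pos).exists
      exact fst_eq_zero_of_effBound hinf
        (sup_le (hWD n) ((Submodule.span_singleton_le_iff_mem _ _).2 hk))
        (hn _ hk (hkW n))
        (Submodule.mem_sup_right (Submodule.mem_span_singleton_self (k, (0 : H')))) hk
  have hr : ∀ k', ((0 : H), k') ∈ D → k' = 0 := fun k hk => by
    obtain ⟨n, hn⟩ := (h2 1 one_pos).exists
    exact eq_zero_of_effBound hinf (hWD n) (hWinj n) hn hk
  refine exists_asympConformal_of_inner_sq_le hD hinf hr hl fun δ hδ => ?_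
  obtain ⟨n, hn⟩ := (h2 δ hδ).exists
  exact ⟨W n, hWf n, fun p hp q hq a1 a2 a3 a4 a5 a6 a7 a8 a9 =>
    inner_sq_le_of_effBound hδ.le hn hp hq a1 a2 a3 a4 a5 a6 a7 a8 a9⟩

/-- If `D` were multivalued, then observations close to a multivalued direction of `D` would
predict its second component well under the second measure, but not at all under the first. -/
theorem eq_zero_of_effBound' (hinf : ¬ FiniteDimensional ℝ (D.map (LinearMap.fst ℝ H H')))
    {W : Submodule ℝ (H × H')} [FiniteDimensional ℝ W] (hWD : W ≤ D)
    (h : ∀ q ∈ D, q.1 ∉ W.map (LinearMap.fst ℝ H H') →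
      EffBound' D 1 (W ⊔ Submodule.span ℝ {q})) {k' : H'} (hk : ((0 : H), k') ∈ D) : k' = 0 := by
  by_contra hk0
  have hkn : 0 < ‖k'‖ := norm_pos_iff.2 hk0
  obtain ⟨f, hf, hfW⟩ := exists_notMem_map_fst hinf W
  set t := 2 * (‖f.2‖ + 1) / ‖k'‖ with ht
  have ht0 : 0 < t := by positivity
  set q := f + t • ((0 : H), k') with hqdef
  have hq1 : q.1 = f.1 := by simp [hqdef]
  have hq2 : q.2 = f.2 + t • k' := by simp [hqdef]
  have hqD : q ∈ D := D.add_mem hf (D.smul_mem t hk)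
  set V := W ⊔ Submodule.span ℝ {q} with hVdef
  have hVD : V ≤ D := sup_le hWD ((Submodule.span_singleton_le_iff_mem _ _).2 hqD)
  have hqV : q ∈ V := Submodule.mem_sup_right (Submodule.mem_span_singleton_self q)
  have hV : EffBound' D 1 V := h q hqD (by rwa [hq1])
  obtain ⟨e, he⟩ := errorRel_nonempty hinf hVD
  obtain ⟨g, hg, hgV⟩ := exists_snd_proj V k'
  -- the distance of `k'` to the second components of `V` is at most `‖k'‖ / 2`
  have hdist : ‖k' - g.2‖ ≤ ‖k'‖ / 2 := by
    have h1 : ‖k' - g.2‖ ≤ ‖k' - t⁻¹ • q.2‖ := by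
      have hz : g - t⁻¹ • q ∈ V := V.sub_mem hg (V.smul_mem _ hqV)
      have h2 := hgV _ hz
      have e1 : k' - t⁻¹ • q.2 = (k' - g.2) + (g - t⁻¹ • q).2 := by simp
      have h3 : ‖k' - t⁻¹ • q.2‖ ^ 2 = ‖k' - g.2‖ ^ 2 + ‖(g - t⁻¹ • q).2‖ ^ 2 := by
        rw [e1, norm_add_sq_real, real_inner_comm, h2]; ring
      exact abs_le_of_sq_le_sq' (by rw [h3]; nlinarith [sq_nonneg ‖(g - t⁻¹ • q).2‖])
        (norm_nonneg _) |>.2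
    refine h1.trans ?_
    have e2 : k' - t⁻¹ • q.2 = -(t⁻¹ • f.2) := by
      rw [hq2, smul_add, smul_smul, inv_mul_cancel₀ ht0.ne', one_smul]; abel
    rw [e2, norm_neg, norm_smul, Real.norm_of_nonneg (by positivity), inv_mul_le_iff₀ ht0, ht]
    have : 2 * (‖f.2‖ + 1) / ‖k'‖ * (‖k'‖ / 2) = ‖f.2‖ + 1 := by field_simp
    rw [this]
    linarith
  -- errors shifted far in the multivalued direction
  have key : ∀ r : ℝ, ‖e.1.2 + r • k'‖ ^ 2 ≤ 2 * ‖e.2.2 + r • (k' - g.2)‖ ^ 2 := by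
    intro r
    have hmem : (e.1 + r • ((0 : H), k'), e.2 + r • (((0 : H), k') - g)) ∈ errorRel D V := by
      obtain ⟨a1, a2, a3, a4, a5, a6⟩ := he
      refine ⟨D.add_mem a1 (D.smul_mem r hk),
        D.add_mem a2 (D.smul_mem r (D.sub_mem hk (hVD hg))), ?_, ?_, ?_, ?_⟩
      · have : e.1 + r • ((0 : H), k') - (e.2 + r • (((0 : H), k') - g)) =
            e.1 - e.2 + r • g := by rw [smul_sub]; abel
        rw [this]
        exact V.add_mem a3 (V.smul_mem r hg)
      · simpa using a4
      · intro v hv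
        simp [inner_add_right, inner_smul_right, a5 v hv, hgV v hv]
      · simpa using a6
    have := hV _ hmem
    simp only [Prod.snd_add, Prod.smul_snd, Prod.snd_sub] at this
    linarith
  have key2 : ∀ r : ℝ, 0 ≤ r → r * ‖k'‖ - ‖e.1.2‖ ≤ 3 / 2 * (‖e.2.2‖ + r * (‖k'‖ / 2)) := by
    intro r hr
    have h1 : r * ‖k'‖ - ‖e.1.2‖ ≤ ‖e.1.2 + r • k'‖ := by
      have := norm_sub_le (e.1.2 + r • k') e.1.2
      rw [add_sub_cancel_left, norm_smul, Real.norm_of_nonneg hr] at this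
      linarith
    have h2 : ‖e.2.2 + r • (k' - g.2)‖ ≤ ‖e.2.2‖ + r * (‖k'‖ / 2) := by
      refine (norm_add_le _ _).trans ?_
      rw [norm_smul, Real.norm_of_nonneg hr]
      gcongr
    have h3 : ‖e.1.2 + r • k'‖ ≤ 3 / 2 * ‖e.2.2 + r • (k' - g.2)‖ := by
      refine abs_le_of_sq_le_sq' ?_ (by positivity) |>.2
      nlinarith [key r, sq_nonneg ‖e.2.2 + r • (k' - g.2)‖]
    linarith
  have := key2 (8 * (‖e.1.2‖ + 3 / 2 * ‖e.2.2‖ + 1) / ‖k'‖) (by positivity)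
  have e3 : 8 * (‖e.1.2‖ + 3 / 2 * ‖e.2.2‖ + 1) / ‖k'‖ * ‖k'‖ =
      8 * (‖e.1.2‖ + 3 / 2 * ‖e.2.2‖ + 1) := by field_simp
  rw [← mul_div_assoc, e3] at this
  nlinarith [norm_nonneg e.1.2, norm_nonneg e.2.2]

/-- A pair `(k, 0)` is excluded because its second predictor vanishes, without error under the
second measure, whereas its first predictor does not vanish if `k` is approximated by observations.
-/
theorem exists_asympConformal_of_effBound' [CompleteSpace H] [CompleteSpace H']
    (hD : IsClosed (D : Set (H × H')))
    (hinf : ¬ FiniteDimensional ℝ (D.map (LinearMap.fst ℝ H H')))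
    {W : ℕ → Submodule ℝ (H × H')} (hWf : ∀ n, FiniteDimensional ℝ (W n)) (hWD : ∀ n, W n ≤ D)
    (hWinj : ∀ n, ∀ w ∈ W n, w.2 = 0 → w = 0)
    (hdense : ∀ p ∈ D, ∀ η > 0, ∀ᶠ n in atTop, ∃ v ∈ W n, ‖p.1 - v.1‖ ≤ η)
    (h1 : ∀ δ > 0, ∀ᶠ n in atTop, EffBound' D δ (W n))
    (h2 : ∀ δ > 0, ∀ᶠ n in atTop, ∀ q ∈ D, q.1 ∉ (W n).map (LinearMap.fst ℝ H H') →
      EffBound' D δ (W n ⊔ Submodule.span ℝ {q})) : ∃ a, 0 < a ∧ AsympConformal D a := by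
  have hr : ∀ k', ((0 : H), k') ∈ D → k' = 0 := fun k hk => by
    obtain ⟨n, hn⟩ := (h2 1 one_pos).exists
    exact eq_zero_of_effBound' hinf (hWD n) hn hk
  have hl : ∀ k, (k, (0 : H')) ∈ D → k = 0 := by
    intro k hk
    by_contra hk0
    have hkn : 0 < ‖k‖ := norm_pos_iff.2 hk0
    obtain ⟨n, hn, v, hv, hvk⟩ :=
      ((h1 1 one_pos).and (hdense _ hk (‖k‖ / 2) (by positivity))).exists
    obtain ⟨g, hg, hgW⟩ := exists_fst_proj (W n) k
    -- the second predictor of `(k, 0)` vanishes, but the first one does not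
    have hmem : ((k, (0 : H')) - g, (k, (0 : H'))) ∈ errorRel D (W n) := by
      refine ⟨D.sub_mem hk (hWD n hg), hk, by simpa using hg, hgW, by simp, fun h0 => hk0 ?_⟩
      have h3 : k = g.1 := sub_eq_zero.1 h0
      have h4 : g.2 = 0 := hr _ (by
        have := D.sub_mem (hWD n hg) hk
        simpa [Prod.sub_def, h3] using this)
      rw [h3, hWinj n g hg h4]
      rfl
    have h5 := hn _ hmem
    have h6 : g.2 = 0 := by simpa using h5
    have h7 : g = 0 := hWinj n g hg h6
    have h8 := hgW v hv
    rw [h7] at h8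
    simp only [Prod.fst_zero, sub_zero] at h8
    have h9 : ‖k - v.1‖ ^ 2 = ‖k‖ ^ 2 + ‖v.1‖ ^ 2 := by
      rw [norm_sub_sq_real, real_inner_comm, h8]; ring
    have h10 := pow_le_pow_left₀ (norm_nonneg _) hvk 2
    simp only at h9 h10
    rw [h9] at h10
    nlinarith [sq_nonneg ‖v.1‖]
  refine exists_asympConformal_of_inner_sq_le hD hinf hr hl fun δ hδ => ?_
  obtain ⟨n, hn⟩ := (h2 δ hδ).exists
  exact ⟨W n, hWf n, fun p hp q hq a1 a2 a3 a4 a5 a6 a7 a8 a9 =>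
    inner_sq_le_of_effBound' hδ.le hn hp hq a1 a2 a3 a4 a5 a6 a7 a9⟩

end Necessity

/-! ### Square roots of positive operators -/

section SquareRoot

/-- The coefficients of the power series `(1 - √(1 - x)) / x = ∑ sqrtCoeff n * x ^ n`. -/
def sqrtCoeff (n : ℕ) : ℝ := catalan n / (2 * 4 ^ n)

theorem sqrtCoeff_nonneg (n : ℕ) : 0 ≤ sqrtCoeff n := by
  unfold sqrtCoeff
  positivity

/-- The generating function `G` satisfies `x G² = 2 G - 1`. -/
theorem sum_antidiagonal_sqrtCoeff (n : ℕ) :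
    ∑ ij ∈ Finset.HasAntidiagonal.antidiagonal n, sqrtCoeff ij.1 * sqrtCoeff ij.2 =
      2 * sqrtCoeff (n + 1) := by
  have h : ∀ ij ∈ Finset.HasAntidiagonal.antidiagonal n, sqrtCoeff ij.1 * sqrtCoeff ij.2 =
      (catalan ij.1 * catalan ij.2 : ℝ) / (4 * 4 ^ n) := by
    intro ij hij
    rw [← Finset.HasAntidiagonal.mem_antidiagonal.1 hij]
    unfold sqrtCoeff
    rw [pow_add]
    field_simp
    ring
  rw [Finset.sum_congr rfl h, ← Finset.sum_div]
  unfold sqrtCoeff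
  rw [catalan_succ']
  push_cast
  rw [pow_succ]
  field_simp

/-- The partial sums telescope, by the relation between Catalan numbers and central binomial
coefficients. -/
theorem sum_range_sqrtCoeff (n : ℕ) :
    ∑ k ∈ Finset.range n, sqrtCoeff k = 1 - n.centralBinom / 4 ^ n := by
  induction n with
  | zero => simp
  | succ n ih =>
    rw [Finset.sum_range_succ, ih]
    have h1 : ((n : ℝ) + 1) * (n + 1).centralBinom = 2 * (2 * n + 1) * n.centralBinom := by
      exact_mod_cast Nat.succ_mul_centralBinom_succ n
    have h2 : ((n : ℝ) + 1) * catalan n = n.centralBinom := by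
      exact_mod_cast succ_mul_catalan_eq_centralBinom n
    have h3 : ((n + 1).centralBinom : ℝ) = 2 * (2 * n + 1) * n.centralBinom / (n + 1) := by
      field_simp
      linarith
    unfold sqrtCoeff
    rw [h3, ← h2, pow_succ]
    field_simp
    ring

theorem sum_range_sqrtCoeff_le (n : ℕ) : ∑ k ∈ Finset.range n, sqrtCoeff k ≤ 1 := by
  rw [sum_range_sqrtCoeff]
  have : (0 : ℝ) ≤ n.centralBinom / 4 ^ n := by positivity
  linarith

theorem summable_sqrtCoeff : Summable sqrtCoeff :=
  summable_of_sum_range_le sqrtCoeff_nonneg sum_range_sqrtCoeff_le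

theorem tsum_sqrtCoeff_le : ∑' n, sqrtCoeff n ≤ 1 :=
  Real.tsum_le_of_sum_range_le sqrtCoeff_nonneg sum_range_sqrtCoeff_le

variable {E : Type*} [NormedAddCommGroup E] [InnerProductSpace ℝ E]

/-- The binomial series for `√(1 - B)` converges for `‖B‖ ≤ 1`. -/
theorem exists_isPositive_mul_self_eq_one_sub [CompleteSpace E] {B : E →L[ℝ] E}
    (hB : ‖B‖ ≤ 1) (hBs : IsSelfAdjoint B) : ∃ S : E →L[ℝ] E, S.IsPositive ∧ S * S = 1 - B := by
  have hpow : ∀ n, ‖B ^ n‖ ≤ 1 := by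
    intro n
    induction n with
    | zero => exact ContinuousLinearMap.norm_id_le
    | succ n ih =>
      rw [pow_succ]
      exact (norm_mul_le _ _).trans (mul_le_one₀ ih (norm_nonneg _) hB)
  have hterm : ∀ n, ‖sqrtCoeff n • B ^ n‖ ≤ sqrtCoeff n := fun n => by
    rw [norm_smul, Real.norm_of_nonneg (sqrtCoeff_nonneg n)]
    exact mul_le_of_le_one_right (sqrtCoeff_nonneg n) (hpow n)
  have hsumn : Summable fun n => ‖sqrtCoeff n • B ^ n‖ :=
    summable_sqrtCoeff.of_nonneg_of_le (fun _ => norm_nonneg _) hterm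
  have hsum : Summable fun n => sqrtCoeff n • B ^ n := hsumn.of_norm
  set G := ∑' n, sqrtCoeff n • B ^ n with hG
  have hGn : ‖G‖ ≤ 1 :=
    (norm_tsum_le_tsum_norm hsumn).trans
      ((hsumn.tsum_le_tsum hterm summable_sqrtCoeff).trans tsum_sqrtCoeff_le)
  have hcomm : Commute B G := Commute.tsum_right B fun n =>
    (Commute.refl B).pow_right n |>.smul_right _
  have hGs : star G = G := by
    rw [hG, tsum_star]
    refine tsum_congr fun n => ?_
    rw [star_smul, star_pow, hBs.star_eq, star_trivial]
  have hGG : G * G = ∑' n, (2 * sqrtCoeff (n + 1)) • B ^ n := by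
    rw [hG, tsum_mul_tsum_eq_tsum_sum_antidiagonal_of_summable_norm hsumn hsumn]
    refine tsum_congr fun n => ?_
    rw [← sum_antidiagonal_sqrtCoeff, Finset.sum_smul]
    refine Finset.sum_congr rfl fun ij hij => ?_
    rw [smul_mul_smul_comm, ← pow_add, Finset.HasAntidiagonal.mem_antidiagonal.1 hij]
  have hshift : B * (G * G) = (2 : ℝ) • G - 1 := by
    have h1 : G = sqrtCoeff 0 • B ^ 0 + ∑' n, sqrtCoeff (n + 1) • B ^ (n + 1) :=
      hsum.tsum_eq_zero_add
    have hsum2 : Summable fun n => (2 * sqrtCoeff (n + 1)) • B ^ n := by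
      refine Summable.of_norm_bounded (g := fun n => 2 * sqrtCoeff (n + 1))
        (((summable_nat_add_iff 1).2 summable_sqrtCoeff).mul_left 2) fun n => ?_
      have := sqrtCoeff_nonneg (n + 1)
      rw [norm_smul, Real.norm_of_nonneg (by positivity)]
      exact mul_le_of_le_one_right (by positivity) (hpow n)
    have h0 : (2 : ℝ) • sqrtCoeff 0 • B ^ 0 = 1 := by
      simp [sqrtCoeff, smul_smul]
    rw [hGG, ← hsum2.tsum_mul_left, h1, smul_add, h0, add_sub_cancel_left]
    rw [← Summable.tsum_const_smul _ ((summable_nat_add_iff 1).2 hsum)]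
    refine tsum_congr fun n => ?_
    rw [mul_smul_comm, ← pow_succ', smul_smul]
  -- the operator `R = 1 - √(1 - B)` satisfies `R² = 2 R - B`
  set R := B * G with hR
  have hRn : ‖R‖ ≤ 1 := (norm_mul_le _ _).trans (mul_le_one₀ hB (norm_nonneg _) hGn)
  have hRs : star R = R := by rw [hR, star_mul, hGs, hBs.star_eq, hcomm.eq]
  have hRR : R * R = (2 : ℝ) • R - B := by
    have : R * R = B * (B * (G * G)) := by
      rw [hR, mul_assoc, ← mul_assoc G, ← hcomm.eq, mul_assoc]
    rw [this, hshift, mul_sub, mul_smul_comm, mul_one]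
  refine ⟨1 - R, ?_, ?_⟩
  · rw [ContinuousLinearMap.isPositive_def']
    refine ⟨(IsSelfAdjoint.one _).sub hRs, fun x => ?_⟩
    rw [ContinuousLinearMap.reApplyInnerSelf_apply]
    have h1 : ⟪R x, x⟫ ≤ ‖x‖ * ‖x‖ :=
      (real_inner_le_norm _ _).trans (by
        gcongr
        exact (R.le_opNorm x).trans (mul_le_of_le_one_left (norm_nonneg _) hRn))
    have h2 : ⟪(1 - R) x, x⟫ = ‖x‖ * ‖x‖ - ⟪R x, x⟫ := by
      simp [inner_sub_left, sq]
    simp only [RCLike.re_to_real]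
    rw [h2]
    linarith
  · rw [sub_mul, mul_sub, mul_sub, hRR, two_smul]
    simp only [one_mul, mul_one]
    abel

/-- This is the positivity of the quadratic form at `x - ‖C‖⁻¹ • C x`. -/
theorem isPositive_norm_sq_le {C : E →L[ℝ] E} (hC : C.IsPositive) (x : E) :
    ‖C x‖ ^ 2 ≤ ‖C‖ * ⟪C x, x⟫ := by
  rcases eq_or_ne C 0 with rfl | h0
  · simp
  have hc : 0 < ‖C‖ := norm_pos_iff.2 h0
  have hpos : ∀ y, 0 ≤ ⟪C y, y⟫ := hC.inner_nonneg_left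
  have hsym : ⟪C (C x), x⟫ = ‖C x‖ ^ 2 := by
    rw [← real_inner_self_eq_norm_sq]; exact hC.isSymmetric (C x) x
  have h1 := hpos (x - ‖C‖⁻¹ • C x)
  have h2 : ⟪C (C x), C x⟫ ≤ ‖C‖ * ‖C x‖ ^ 2 := by
    refine (real_inner_le_norm _ _).trans ?_
    rw [sq, ← mul_assoc]
    gcongr
    exact C.le_opNorm _
  have h3 : ⟪C (x - ‖C‖⁻¹ • C x), x - ‖C‖⁻¹ • C x⟫ =
      ⟪C x, x⟫ - 2 * ‖C‖⁻¹ * ‖C x‖ ^ 2 + ‖C‖⁻¹ ^ 2 * ⟪C (C x), C x⟫ := by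
    simp only [map_sub, map_smul, inner_sub_left, inner_sub_right, inner_smul_left,
      inner_smul_right, hsym, real_inner_self_eq_norm_sq, RCLike.conj_to_real]
    ring
  rw [h3] at h1
  have h4 : ‖C‖⁻¹ ^ 2 * ⟪C (C x), C x⟫ ≤ ‖C‖⁻¹ * ‖C x‖ ^ 2 := by
    calc _ ≤ ‖C‖⁻¹ ^ 2 * (‖C‖ * ‖C x‖ ^ 2) := by gcongr
      _ = _ := by field_simp
  have h5 : ‖C‖⁻¹ * ‖C x‖ ^ 2 ≤ ⟪C x, x⟫ := by linarith
  rwa [inv_mul_le_iff₀ hc] at h5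

theorem exists_isPositive_comp_self [CompleteSpace E] {C : E →L[ℝ] E} (hC : C.IsPositive) :
    ∃ S : E →L[ℝ] E, S.IsPositive ∧ S.comp S = C := by
  rcases eq_or_ne C 0 with rfl | h0
  · exact ⟨0, ContinuousLinearMap.isPositive_zero, by simp⟩
  have hc : 0 < ‖C‖ := norm_pos_iff.2 h0
  have hCs : IsSelfAdjoint C := hC.isSelfAdjoint
  set B := 1 - ‖C‖⁻¹ • C with hBdef
  have hBs : IsSelfAdjoint B :=
    (IsSelfAdjoint.one _).sub ((IsSelfAdjoint.all ‖C‖⁻¹).smul hCs)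
  have hB : ‖B‖ ≤ 1 := by
    refine ContinuousLinearMap.opNorm_le_bound _ zero_le_one fun x => ?_
    rw [one_mul]
    refine abs_le_of_sq_le_sq' ?_ (norm_nonneg _) |>.2
    have h1 : ‖B x‖ ^ 2 = ‖x‖ ^ 2 - 2 * ‖C‖⁻¹ * ⟪C x, x⟫ + ‖C‖⁻¹ ^ 2 * ‖C x‖ ^ 2 := by
      have : B x = x - ‖C‖⁻¹ • C x := by simp [hBdef]
      rw [this, norm_sub_sq_real, inner_smul_right, norm_smul, mul_pow, norm_inv, norm_norm,
        real_inner_comm]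
      ring
    have h2 : ‖C‖⁻¹ ^ 2 * ‖C x‖ ^ 2 ≤ ‖C‖⁻¹ * ⟪C x, x⟫ := by
      calc _ ≤ ‖C‖⁻¹ ^ 2 * (‖C‖ * ⟪C x, x⟫) := by gcongr; exact isPositive_norm_sq_le hC x
        _ = _ := by field_simp
    have h3 : 0 ≤ ‖C‖⁻¹ * ⟪C x, x⟫ := mul_nonneg (by positivity) (hC.inner_nonneg_left x)
    rw [h1]
    linarith
  obtain ⟨S, hS, hSS⟩ := exists_isPositive_mul_self_eq_one_sub hB hBs
  refine ⟨√‖C‖ • S, hS.smul_of_nonneg (Real.sqrt_nonneg _), ?_⟩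
  change (√‖C‖ • S) * (√‖C‖ • S) = C
  rw [smul_mul_smul_comm, Real.mul_self_sqrt (norm_nonneg _), hSS, hBdef, sub_sub_cancel,
    smul_smul, mul_inv_cancel₀ hc.ne', one_smul]

theorem posSqrt_spec [CompleteSpace E] {C : E →L[ℝ] E} (hC : C.IsPositive) :
    (posSqrt C).IsPositive ∧ (posSqrt C).comp (posSqrt C) = C := by
  have h := exists_isPositive_comp_self hC
  rw [posSqrt, dif_pos h]
  exact h.choose_spec

end SquareRoot

/-! ### Compactness and quadratic forms on subspaces of finite codimension -/

section Compactness

variable {E : Type*} [NormedAddCommGroup E] [InnerProductSpace ℝ E]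

/-- The vectors of `s` form a finite `ε`-net of the image of the unit ball. -/
theorem exists_finset_of_isCompactOperator {B : E →L[ℝ] E} (hB : IsCompactOperator B) {ε : ℝ}
    (hε : 0 < ε) :
    ∃ s : Finset E, ∀ u, (∀ f ∈ s, ⟪f, u⟫ = 0) → |⟪B u, u⟫| ≤ ε * ‖u‖ ^ 2 := by
  have hc : IsCompact (closure (B '' Metric.closedBall 0 1)) :=
    IsCompactOperator.isCompact_closure_image_closedBall (𝕜₁ := ℝ)
      (f := (B : E →ₗ[ℝ] E)) hB 1
  obtain ⟨t, htf, ht⟩ := Metric.totallyBounded_iff.1 hc.totallyBounded ε hε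
  refine ⟨htf.toFinset, fun u hu => ?_⟩
  by_cases hu0 : u = 0
  · simp [hu0]
  have hun : 0 < ‖u‖ := norm_pos_iff.2 hu0
  have hmem : B (‖u‖⁻¹ • u) ∈ closure (B '' Metric.closedBall 0 1) := by
    refine subset_closure ⟨_, ?_, rfl⟩
    rw [mem_closedBall_zero_iff, norm_smul, norm_inv, norm_norm, inv_mul_cancel₀ hun.ne']
  obtain ⟨f, hf, hfu⟩ := Set.mem_iUnion₂.1 (ht hmem)
  rw [Metric.mem_ball, dist_eq_norm] at hfu
  have h1 : ⟪B u, u⟫ = ‖u‖ * ⟪B (‖u‖⁻¹ • u) - f, u⟫ := by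
    rw [inner_sub_left, hu f (htf.mem_toFinset.2 hf), map_smul, inner_smul_left]
    simp only [RCLike.conj_to_real]
    field_simp
    ring
  rw [h1, abs_mul, abs_norm]
  calc ‖u‖ * |⟪B (‖u‖⁻¹ • u) - f, u⟫| ≤ ‖u‖ * (‖B (‖u‖⁻¹ • u) - f‖ * ‖u‖) := by
        gcongr; exact abs_real_inner_le_norm _ _
    _ ≤ ‖u‖ * (ε * ‖u‖) := by gcongr
    _ = ε * ‖u‖ ^ 2 := by ring

theorem norm_le_of_abs_inner_le {B : E →L[ℝ] E} (hB : ∀ u v, ⟪B u, v⟫ = ⟪u, B v⟫) {ε : ℝ}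
    (hε : 0 ≤ ε) (h : ∀ u, |⟪B u, u⟫| ≤ ε * ‖u‖ ^ 2) : ‖B‖ ≤ ε := by
  have key : ∀ u v, ⟪B u, v⟫ ≤ ε / 2 * (‖u‖ ^ 2 + ‖v‖ ^ 2) := by
    intro u v
    have h1 : 4 * ⟪B u, v⟫ = ⟪B (u + v), u + v⟫ - ⟪B (u - v), u - v⟫ := by
      have : ⟪B v, u⟫ = ⟪B u, v⟫ := by rw [hB, real_inner_comm]
      simp only [map_add, map_sub, inner_add_left, inner_add_right, inner_sub_left,
        inner_sub_right, this]
      ring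
    have h2 := (abs_le.1 (h (u + v))).2
    have h3 := (abs_le.1 (h (u - v))).1
    have h4 : ‖u + v‖ ^ 2 + ‖u - v‖ ^ 2 = 2 * (‖u‖ ^ 2 + ‖v‖ ^ 2) := by
      rw [norm_add_sq_real, norm_sub_sq_real]; ring
    nlinarith
  refine ContinuousLinearMap.opNorm_le_bound _ hε fun u => ?_
  by_cases hu : u = 0
  · simp [hu]
  by_cases hBu : B u = 0
  · rw [hBu, norm_zero]; positivity
  have hun : 0 < ‖u‖ := norm_pos_iff.2 hu
  have hBun : 0 < ‖B u‖ := norm_pos_iff.2 hBu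
  have h1 := key u ((‖u‖ / ‖B u‖) • B u)
  rw [inner_smul_right, real_inner_self_eq_norm_sq, norm_smul,
    Real.norm_of_nonneg (by positivity)] at h1
  have h2 : ‖u‖ / ‖B u‖ * ‖B u‖ ^ 2 = ‖u‖ * ‖B u‖ := by field_simp
  have h3 : ‖u‖ / ‖B u‖ * ‖B u‖ = ‖u‖ := by field_simp
  rw [h2, h3] at h1
  exact le_of_mul_le_mul_left (by linarith) hun

theorem isCompactOperator_starProjection (K : Submodule ℝ E) [FiniteDimensional ℝ K] :
    IsCompactOperator K.starProjection :=
  IsCompactOperator.clm_comp (f := K.orthogonalProjectionOnto)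
    (isCompactOperator_of_locallyCompactSpace_dom K.orthogonalProjectionOnto) K.subtypeL

/-- Compressing `B` to the orthogonal complement of `s` changes it by an operator of finite rank,
and the compression is small in norm. -/
theorem isCompactOperator_of_forall_finset [CompleteSpace E] {B : E →L[ℝ] E}
    (hB : ∀ u v, ⟪B u, v⟫ = ⟪u, B v⟫)
    (h : ∀ ε > 0, ∃ s : Finset E, ∀ u, (∀ f ∈ s, ⟪f, u⟫ = 0) → |⟪B u, u⟫| ≤ ε * ‖u‖ ^ 2) :
    IsCompactOperator B := by
  have hcl := isClosed_setOfPred_isCompactOperator (σ₁₂ := RingHom.id ℝ) (M₁ := E) (M₂ := E)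
  refine hcl.closure_subset (Metric.mem_closure_iff.2 fun ε hε => ?_)
  obtain ⟨s, hs⟩ := h (ε / 2) (by positivity)
  let Q := Submodule.span ℝ (s : Set E)
  have hQ : FiniteDimensional ℝ Q := FiniteDimensional.span_finset ℝ s
  let P : E →L[ℝ] E := 1 - Q.starProjection
  have hP : ∀ u, P u = u - Q.starProjection u := fun u => rfl
  have hPs : ∀ u v, ⟪P u, v⟫ = ⟪u, P v⟫ := fun u v => by
    rw [hP, hP, inner_sub_left, inner_sub_right, Submodule.inner_starProjection_left_eq_right]
  have hPn : ∀ u, ‖P u‖ ≤ ‖u‖ := fun u => by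
    have h1 : ‖u‖ ^ 2 = ‖P u‖ ^ 2 + ‖Q.starProjection u‖ ^ 2 := by
      have h2 : u = P u + Q.starProjection u := by rw [hP]; abel
      have h3 := Q.sub_starProjection_mem_orthogonal u _ (Q.starProjection_apply_mem u)
      rw [← hP, real_inner_comm] at h3
      nth_rewrite 1 [h2]
      rw [norm_add_sq_real, h3]
      ring
    exact abs_le_of_sq_le_sq' (by nlinarith [sq_nonneg ‖Q.starProjection u‖])
      (norm_nonneg _) |>.2
  refine ⟨B - P * B * P, ?_, ?_⟩
  · have h1 : B - P * B * P = Q.starProjection * B + P * B * Q.starProjection := by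
      simp only [P]; noncomm_ring
    have h2 := isCompactOperator_starProjection Q
    rw [Set.mem_ofPred_eq, h1]
    exact (h2.comp_clm B).add (h2.clm_comp (P * B))
  · rw [dist_eq_norm, sub_sub_cancel]
    refine lt_of_le_of_lt (norm_le_of_abs_inner_le (ε := ε / 2) (fun u v => ?_) (by positivity)
      fun u => ?_) (half_lt_self hε)
    · change ⟪P (B (P u)), v⟫ = ⟪u, P (B (P v))⟫
      rw [hPs, hB, hPs]
    · change |⟪P (B (P u)), u⟫| ≤ _
      rw [hPs]
      refine (hs (P u) fun f hf => ?_).trans (by gcongr; exact hPn u)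
      exact Q.sub_starProjection_mem_orthogonal u f (Submodule.subset_span hf)

end Compactness

/-! ### Square roots of covariance operators and Cameron–Martin spaces -/

section CovarianceOperators

variable {E : Type*} [NormedAddCommGroup E] [InnerProductSpace ℝ E]

/-- A symmetric operator with a positive definite quadratic form. -/
structure IsStrictCov (C : E →L[ℝ] E) : Prop where
  symm : ∀ u v, ⟪C u, v⟫ = ⟪u, C v⟫
  pos : ∀ w, w ≠ 0 → 0 < ⟪C w, w⟫

/-- A linear map that is dominated by a linear map with dense range factors through it. -/
theorem exists_factor {F G E₀ : Type*} [AddCommGroup E₀] [Module ℝ E₀] [NormedAddCommGroup F]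
    [NormedSpace ℝ F] [NormedAddCommGroup G] [NormedSpace ℝ G] [CompleteSpace G]
    {e : E₀ →ₗ[ℝ] F} {f : E₀ →ₗ[ℝ] G} (he : DenseRange e) {c : ℝ}
    (h : ∀ x, ‖f x‖ ≤ c * ‖e x‖) : ∃ g : F →L[ℝ] G, ∀ x, g (e x) = f x :=
  ⟨f.extendOfNorm e, LinearMap.extendOfNorm_eq he ⟨c, h⟩⟩

variable {C C' : E →L[ℝ] E}

theorem IsStrictCov.isPositive (hC : IsStrictCov C) : C.IsPositive := by
  refine ⟨fun u v => hC.symm u v, fun x => ?_⟩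
  rw [ContinuousLinearMap.reApplyInnerSelf_apply]
  rcases eq_or_ne x 0 with rfl | hx
  · simp
  · exact (hC.pos x hx).le

theorem mem_cameronMartin {g : E} : g ∈ cameronMartin C ↔ ∃ u, posSqrt C u = g :=
  Iff.rfl

variable [CompleteSpace E]

theorem IsStrictCov.posSqrt_symm (hC : IsStrictCov C) (u v : E) :
    ⟪posSqrt C u, v⟫ = ⟪u, posSqrt C v⟫ :=
  (posSqrt_spec hC.isPositive).1.isSymmetric u v

theorem IsStrictCov.posSqrt_posSqrt (hC : IsStrictCov C) (u : E) :
    posSqrt C (posSqrt C u) = C u := by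
  have := (posSqrt_spec hC.isPositive).2
  exact congrArg (fun T : E →L[ℝ] E => T u) this

theorem IsStrictCov.norm_posSqrt_sq (hC : IsStrictCov C) (u : E) :
    ‖posSqrt C u‖ ^ 2 = ⟪C u, u⟫ := by
  rw [← real_inner_self_eq_norm_sq, ← hC.posSqrt_posSqrt, hC.posSqrt_symm]
  exact real_inner_comm _ _

theorem IsStrictCov.posSqrt_injective (hC : IsStrictCov C) :
    Function.Injective (posSqrt C) := by
  refine (injective_iff_map_eq_zero _).2 fun u hu => ?_
  by_contra h0
  have h1 := hC.norm_posSqrt_sq u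
  rw [hu, norm_zero] at h1
  have := hC.pos u h0
  rw [← h1] at this
  norm_num at this

theorem IsStrictCov.denseRange_posSqrt (hC : IsStrictCov C) : DenseRange (posSqrt C) := by
  have h : ((posSqrt C).range : Submodule ℝ E).topologicalClosure = ⊤ := by
    rw [Submodule.topologicalClosure_eq_top_iff, Submodule.eq_bot_iff]
    intro v hv
    refine hC.posSqrt_injective ?_
    rw [map_zero]
    have h1 := hv _ ⟨posSqrt C v, rfl⟩
    change ⟪posSqrt C (posSqrt C v), v⟫ = 0 at h1
    rw [hC.posSqrt_symm] at h1
    exact inner_self_eq_zero.1 h1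
  intro x
  have : x ∈ ((posSqrt C).range : Submodule ℝ E).topologicalClosure := h ▸ Submodule.mem_top
  rwa [← SetLike.mem_coe, Submodule.topologicalClosure_coe, LinearMap.coe_range] at this

theorem IsStrictCov.cmNorm_posSqrt (hC : IsStrictCov C) (u : E) :
    cmNorm C (posSqrt C u) = ‖u‖ := by
  have : {v : E | posSqrt C v = posSqrt C u} = {u} := by
    ext v
    exact hC.posSqrt_injective.eq_iff
  rw [cmNorm, this, Set.image_singleton, csInf_singleton]

/-- The factorization of `C'^{1/2}` through `C^{1/2}` dualizes to an inclusion of Cameron–Martin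
spaces. -/
theorem exists_posSqrt_eq_of_norm_le (hC : IsStrictCov C) (hC' : IsStrictCov C') {c : ℝ}
    (hc0 : 0 ≤ c) (h : ∀ w, ‖posSqrt C' w‖ ≤ c * ‖posSqrt C w‖) (u : E) :
    ∃ v, posSqrt C v = posSqrt C' u ∧ ‖v‖ ≤ c * ‖u‖ := by
  obtain ⟨Y, hY⟩ := exists_factor (e := (posSqrt C : E →ₗ[ℝ] E)) (f := (posSqrt C' : E →ₗ[ℝ] E))
    hC.denseRange_posSqrt h
  have hYn : ∀ x, ‖Y x‖ ≤ c * ‖x‖ := fun x => by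
    refine hC.denseRange_posSqrt.induction_on (p := fun x => ‖Y x‖ ≤ c * ‖x‖) x
      (isClosed_le (by fun_prop) (by fun_prop)) fun w => ?_
    have : Y (posSqrt C w) = posSqrt C' w := hY w
    rw [this]
    exact h w
  refine ⟨ContinuousLinearMap.adjoint Y u, ext_inner_right ℝ fun w => ?_, ?_⟩
  · rw [hC.posSqrt_symm, ContinuousLinearMap.adjoint_inner_left, hC'.posSqrt_symm]
    exact congrArg _ (hY w)
  · refine (ContinuousLinearMap.le_opNorm _ _).trans ?_
    gcongr
    rw [LinearIsometryEquiv.norm_map]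
    exact ContinuousLinearMap.opNorm_le_bound _ hc0 hYn

/-- The converse of `exists_posSqrt_eq_of_norm_le`. -/
theorem norm_posSqrt_le_of_exists (hC : IsStrictCov C) (hC' : IsStrictCov C') {c : ℝ}
    (h : ∀ u, ∃ v, posSqrt C v = posSqrt C' u ∧ ‖v‖ ≤ c * ‖u‖) (w : E) :
    ‖posSqrt C' w‖ ≤ c * ‖posSqrt C w‖ := by
  obtain ⟨v, hv, hvn⟩ := h (posSqrt C' w)
  rcases eq_or_ne (posSqrt C' w) 0 with h0 | h0
  · have hw : w = 0 := hC'.posSqrt_injective (by rw [h0, map_zero])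
    simp [hw]
  have hpos : 0 < ‖posSqrt C' w‖ := norm_pos_iff.2 h0
  have h1 : ‖posSqrt C' w‖ ^ 2 = ⟪posSqrt C w, v⟫ := by
    rw [← real_inner_self_eq_norm_sq, hC'.posSqrt_symm, ← hv, hC.posSqrt_symm]
  have h2 : ‖posSqrt C' w‖ ^ 2 ≤ ‖posSqrt C w‖ * (c * ‖posSqrt C' w‖) := by
    rw [h1]
    exact (real_inner_le_norm _ _).trans (by gcongr)
  exact le_of_mul_le_mul_right (by nlinarith) hpos

/-- Norm equivalence of the Cameron–Martin spaces means that the two quadratic forms are comparable.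
-/
theorem assumptionI_iff (hC : IsStrictCov C) (hC' : IsStrictCov C') :
    AssumptionI C C' ↔ ∃ c, 0 < c ∧ ∀ w, ‖posSqrt C' w‖ ≤ c * ‖posSqrt C w‖ ∧
      ‖posSqrt C w‖ ≤ c * ‖posSqrt C' w‖ := by
  constructor
  · rintro ⟨hcm, k, K, hk, hK, h⟩
    have h1 : ∀ u, ∃ v, posSqrt C v = posSqrt C' u ∧ ‖v‖ ≤ k⁻¹ * ‖u‖ := fun u => by
      obtain ⟨v, hv⟩ : posSqrt C' u ∈ cameronMartin C := by rw [hcm]; exact ⟨u, rfl⟩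
      have hv' : posSqrt C v = posSqrt C' u := hv
      refine ⟨v, hv', ?_⟩
      have := (h _ (mem_cameronMartin.2 ⟨v, rfl⟩)).1
      rw [hC.cmNorm_posSqrt, hv', hC'.cmNorm_posSqrt] at this
      rwa [le_inv_mul_iff₀ hk]
    have h2 : ∀ u, ∃ v, posSqrt C' v = posSqrt C u ∧ ‖v‖ ≤ K * ‖u‖ := fun u => by
      obtain ⟨v, hv⟩ : posSqrt C u ∈ cameronMartin C' := by rw [← hcm]; exact ⟨u, rfl⟩
      have hv' : posSqrt C' v = posSqrt C u := hv
      refine ⟨v, hv', ?_⟩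
      have := (h _ (mem_cameronMartin.2 ⟨u, rfl⟩)).2
      rwa [hC.cmNorm_posSqrt, ← hv', hC'.cmNorm_posSqrt] at this
    refine ⟨max k⁻¹ K, by positivity, fun w => ⟨?_, ?_⟩⟩
    · exact (norm_posSqrt_le_of_exists hC hC' h1 w).trans (by gcongr; exact le_max_left _ _)
    · exact (norm_posSqrt_le_of_exists hC' hC h2 w).trans (by gcongr; exact le_max_right _ _)
  · rintro ⟨c, hc, h⟩
    have h1 := exists_posSqrt_eq_of_norm_le hC hC' hc.le fun w => (h w).1
    have h2 := exists_posSqrt_eq_of_norm_le hC' hC hc.le fun w => (h w).2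
    refine ⟨le_antisymm ?_ ?_, c⁻¹, c, by positivity, hc, ?_⟩
    · rintro _ ⟨u, rfl⟩
      obtain ⟨v, hv, -⟩ := h2 u
      exact ⟨v, hv⟩
    · rintro _ ⟨u, rfl⟩
      obtain ⟨v, hv, -⟩ := h1 u
      exact ⟨v, hv⟩
    · rintro _ ⟨u, rfl⟩
      obtain ⟨v, hv, hvn⟩ := h2 u
      change c⁻¹ * cmNorm C (posSqrt C u) ≤ cmNorm C' (posSqrt C u) ∧
        cmNorm C' (posSqrt C u) ≤ c * cmNorm C (posSqrt C u)
      rw [hC.cmNorm_posSqrt, ← hv, hC'.cmNorm_posSqrt]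
      refine ⟨?_, hvn⟩
      rw [inv_mul_le_iff₀ hc]
      obtain ⟨u', hu', hun⟩ := h1 v
      rwa [hC.posSqrt_injective (hu'.trans hv)] at hun

theorem mem_cameronMartin_of_abs_inner_le (hC : IsStrictCov C) {d : E} {c : ℝ}
    (h : ∀ w, |⟪d, w⟫| ≤ c * ‖posSqrt C w‖) : d ∈ cameronMartin C := by
  obtain ⟨φ, hφ⟩ := exists_factor (e := (posSqrt C : E →ₗ[ℝ] E))
    (f := (innerSL ℝ d : E →ₗ[ℝ] ℝ)) hC.denseRange_posSqrt h
  refine ⟨(InnerProductSpace.toDual ℝ E).symm φ, ext_inner_right ℝ fun w => ?_⟩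
  change ⟪posSqrt C _, w⟫ = _
  rw [hC.posSqrt_symm, InnerProductSpace.toDual_symm_apply]
  exact hφ w

end CovarianceOperators

/-! ### The assumptions in terms of the relation of common functionals -/

section Model

variable {E H H' : Type*} [NormedAddCommGroup E] [InnerProductSpace ℝ E]
  [NormedAddCommGroup H] [InnerProductSpace ℝ H] [NormedAddCommGroup H'] [InnerProductSpace ℝ H']

/-- The pair of affine functionals with constant part `c` (under the first measure) and linear
part `w`, where `i`, `i'` are the centred linear functionals under the two measures, and `d` is
the difference of the means. -/
def modelMap (o : H) (o' : H') (i : E →ₗ[ℝ] H) (i' : E →ₗ[ℝ] H') (d : E) :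
    ℝ × E →ₗ[ℝ] H × H' where
  toFun q := (q.1 • o + i q.2, (q.1 + ⟪d, q.2⟫) • o' + i' q.2)
  map_add' := fun p q => by
    simp only [Prod.fst_add, Prod.snd_add, map_add, inner_add_right, Prod.mk_add_mk, Prod.mk.injEq]
    exact ⟨by module, by module⟩
  map_smul' := fun c q => by
    simp only [Prod.smul_fst, Prod.smul_snd, map_smul, inner_smul_right, smul_eq_mul,
      RingHom.id_apply, Prod.smul_mk, Prod.mk.injEq]
    exact ⟨by module, by module⟩

/-- `D` is the closed relation of the affine functionals of a Gaussian field under two measures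
with covariance operators `C` and `C'` and difference of means `d`. -/
structure FieldModel (C C' : E →L[ℝ] E) (d : E) (o : H) (o' : H') (i : E →ₗ[ℝ] H)
    (i' : E →ₗ[ℝ] H') (D : Submodule ℝ (H × H')) : Prop where
  cov : IsStrictCov C
  cov' : IsStrictCov C'
  norm_o : ‖o‖ = 1
  norm_o' : ‖o'‖ = 1
  inner_o : ∀ w, ⟪o, i w⟫ = 0
  inner_o' : ∀ w, ⟪o', i' w⟫ = 0
  norm_i : ∀ w, ‖i w‖ ^ 2 = ⟪C w, w⟫
  norm_i' : ∀ w, ‖i' w‖ ^ 2 = ⟪C' w, w⟫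
  rel : D = (LinearMap.range (modelMap o o' i i' d)).topologicalClosure

namespace FieldModel

variable {C C' : E →L[ℝ] E} {d : E} {o : H} {o' : H'} {i : E →ₗ[ℝ] H}
  {i' : E →ₗ[ℝ] H'} {D : Submodule ℝ (H × H')}

theorem isClosed (hM : FieldModel C C' d o o' i i' D) : IsClosed (D : Set (H × H')) := by
  rw [hM.rel]
  exact Submodule.isClosed_topologicalClosure _

theorem mem (hM : FieldModel C C' d o o' i i' D) (c : ℝ) (w : E) :
    (c • o + i w, (c + ⟪d, w⟫) • o' + i' w) ∈ D := by
  rw [hM.rel]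
  exact Submodule.le_topologicalClosure _ ⟨(c, w), rfl⟩

theorem induction_on (hM : FieldModel C C' d o o' i i' D) {P : H × H' → Prop}
    (hP : IsClosed {p | P p}) (h : ∀ c w, P (c • o + i w, (c + ⟪d, w⟫) • o' + i' w)) {p : H × H'}
    (hp : p ∈ D) : P p := by
  rw [hM.rel] at hp
  refine (hP.closure_subset_iff.2 ?_) hp
  rintro _ ⟨q, rfl⟩
  exact h q.1 q.2

theorem swap (hM : FieldModel C C' d o o' i i' D) :
    FieldModel C' C (-d) o' o i' i (swapRel D) where
  cov := hM.cov'
  cov' := hM.cov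
  norm_o := hM.norm_o'
  norm_o' := hM.norm_o
  inner_o := hM.inner_o'
  inner_o' := hM.inner_o
  norm_i := hM.norm_i'
  norm_i' := hM.norm_i
  rel := by
    have h1 : (LinearMap.range (modelMap o' o i' i (-d)) : Set (H' × H)) =
        Prod.swap ⁻¹' (LinearMap.range (modelMap o o' i i' d) : Set (H × H')) := by
      ext p
      constructor
      · rintro ⟨q, rfl⟩
        refine ⟨(q.1 - ⟪d, q.2⟫, q.2), ?_⟩
        simp [modelMap, sub_eq_add_neg]
      · rintro ⟨q, hq⟩
        refine ⟨(q.1 + ⟪d, q.2⟫, q.2), ?_⟩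
        rw [← Prod.swap_swap p, ← hq]
        simp [modelMap]
    refine SetLike.coe_injective ?_
    rw [Submodule.topologicalClosure_coe, h1]
    have h2 := (Homeomorph.prodComm H' H).preimage_closure
      (LinearMap.range (modelMap o o' i i' d) : Set (H × H'))
    change _ = closure (Homeomorph.prodComm H' H ⁻¹' _)
    rw [← h2, hM.rel]
    rfl

variable [CompleteSpace E]

theorem norm_i_eq (hM : FieldModel C C' d o o' i i' D) (w : E) : ‖i w‖ = ‖posSqrt C w‖ :=
  (sq_eq_sq₀ (norm_nonneg _) (norm_nonneg _)).1 (by rw [hM.norm_i, hM.cov.norm_posSqrt_sq])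

theorem norm_i'_eq (hM : FieldModel C C' d o o' i i' D) (w : E) : ‖i' w‖ = ‖posSqrt C' w‖ :=
  hM.swap.norm_i_eq w

theorem norm_snd_sq (hM : FieldModel C C' d o o' i i' D) (c : ℝ) (w : E) :
    ‖c • o' + i' w‖ ^ 2 = c ^ 2 + ‖posSqrt C' w‖ ^ 2 := by
  rw [norm_add_sq_real, inner_smul_left, hM.inner_o', norm_smul, hM.norm_o', ← hM.norm_i'_eq]
  simp

/-- The isometry `C^{1/2} w ↦ i w` of the underlying Hilbert space into the space of functionals. -/
theorem exists_isometry [CompleteSpace H] (hM : FieldModel C C' d o o' i i' D) :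
    ∃ J : E →L[ℝ] H, (∀ w, J (posSqrt C w) = i w) ∧ (∀ u v, ⟪J u, J v⟫ = ⟪u, v⟫) ∧
      (∀ u, ⟪o, J u⟫ = 0) ∧ ContinuousLinearMap.adjoint J o = 0 ∧
      ∀ u, ContinuousLinearMap.adjoint J (J u) = u := by
  obtain ⟨J, hJ⟩ := exists_factor (e := (posSqrt C : E →ₗ[ℝ] E)) (f := i)
    hM.cov.denseRange_posSqrt (c := 1) fun w => by
      rw [one_mul]
      exact (hM.norm_i_eq w).le
  have hJ' : ∀ w, J (posSqrt C w) = i w := hJ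
  have hn : ∀ u, ‖J u‖ = ‖u‖ := fun u =>
    hM.cov.denseRange_posSqrt.induction_on (p := fun u => ‖J u‖ = ‖u‖) u
      (isClosed_eq (by fun_prop) (by fun_prop)) fun w => by rw [hJ', hM.norm_i_eq]
  have hin : ∀ u v, ⟪J u, J v⟫ = ⟪u, v⟫ :=
    (LinearMap.norm_map_iff_inner_map_map J).1 hn
  have ho : ∀ u, ⟪o, J u⟫ = 0 := fun u =>
    hM.cov.denseRange_posSqrt.induction_on (p := fun u => ⟪o, J u⟫ = 0) u
      (isClosed_eq (by fun_prop) (by fun_prop)) fun w => by rw [hJ', hM.inner_o]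
  refine ⟨J, hJ', hin, ho, ext_inner_right ℝ fun v => ?_, fun u => ext_inner_right ℝ fun v => ?_⟩
  · rw [ContinuousLinearMap.adjoint_inner_left, ho, inner_zero_left]
  · rw [ContinuousLinearMap.adjoint_inner_left, hin]

/-- The linear functionals with centred first component, realized under the second measure, depend
continuously on `C^{1/2} w`. -/
theorem exists_extension [CompleteSpace H'] (hM : FieldModel C C' d o o' i i' D) {c : ℝ}
    (hc : ∀ w, ‖posSqrt C' w‖ ≤ c * ‖posSqrt C w‖) {v : E} (hv : posSqrt C v = d) :
    ∃ J' : E →L[ℝ] H', ∀ w, J' (posSqrt C w) = ⟪d, w⟫ • o' + i' w := by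
  let f : E →ₗ[ℝ] H' :=
    { toFun := fun w => ⟪d, w⟫ • o' + i' w
      map_add' := fun x y => by
        simp only [inner_add_right, map_add]
        module
      map_smul' := fun r x => by
        simp only [inner_smul_right, map_smul, RingHom.id_apply]
        module }
  refine exists_factor (e := (posSqrt C : E →ₗ[ℝ] E)) (f := f)
    hM.cov.denseRange_posSqrt (c := ‖v‖ + c) fun w => ?_
  change ‖⟪d, w⟫ • o' + i' w‖ ≤ (‖v‖ + c) * ‖posSqrt C w‖
  refine (norm_add_le _ _).trans ?_
  rw [norm_smul, hM.norm_o', mul_one, hM.norm_i'_eq, add_mul, ← hv, hM.cov.posSqrt_symm]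
  exact add_le_add (norm_inner_le_norm _ _) (hc w)

/-- Norm equivalence of the Cameron–Martin spaces and the condition on the means make the
relation of common functionals a bounded operator. -/
theorem exists_operator [CompleteSpace H] [CompleteSpace H']
    (hM : FieldModel C C' d o o' i i' D) (hI : AssumptionI C C') (hII : d ∈ cameronMartin C) :
    ∃ T : H →L[ℝ] H', ∀ p ∈ D, p.2 = T p.1 := by
  obtain ⟨c, hc0, hc⟩ := (assumptionI_iff hM.cov hM.cov').1 hI
  obtain ⟨v, hv⟩ := hII
  obtain ⟨J, hJ, hJi, hJo, hJa, hJJ⟩ := hM.exists_isometry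
  obtain ⟨J', hJ'⟩ := hM.exists_extension (fun w => (hc w).1) hv
  let T : H →L[ℝ] H' :=
    (innerSL ℝ o).smulRight o' + J'.comp (ContinuousLinearMap.adjoint J)
  refine ⟨T, fun p hp => hM.induction_on (P := fun p => p.2 = T p.1)
    (isClosed_eq continuous_snd (T.continuous.comp continuous_fst)) (fun c w => ?_) hp⟩
  have h1 : ⟪o, c • o + i w⟫ = c := by
    rw [inner_add_right, inner_smul_right, hM.inner_o, real_inner_self_eq_norm_sq, hM.norm_o]
    simp
  have h2 : ContinuousLinearMap.adjoint J (c • o + i w) = posSqrt C w := by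
    rw [map_add, map_smul, hJa, ← hJ, hJJ]
    simp
  change _ = ⟪o, c • o + i w⟫ • o' + J' (ContinuousLinearMap.adjoint J (c • o + i w))
  rw [h1, h2, hJ', add_smul, add_assoc]

theorem assumptionI_symm (hC : IsStrictCov C) (hC' : IsStrictCov C') (hI : AssumptionI C C') :
    AssumptionI C' C := by
  obtain ⟨c, hc0, hc⟩ := (assumptionI_iff hC hC').1 hI
  exact (assumptionI_iff hC' hC).2 ⟨c, hc0, fun w => (hc w).symm⟩

/-- On functionals orthogonal to the constants and to `C^{-1/2} d`, the second quadratic form is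
that of `C^{-1/2} C' C^{-1/2}`, and the compact perturbation of `a I` is small in finite
codimension. -/
theorem asympConformal_of_assumptions [CompleteSpace H] [CompleteSpace H']
    (hM : FieldModel C C' d o o' i i' D) {a : ℝ} (hI : AssumptionI C C')
    (hII : d ∈ cameronMartin C) (hIII : AssumptionIII C C' a) : AsympConformal D a where
  right := hM.exists_operator hI hII
  left := by
    obtain ⟨R, hR⟩ := hM.swap.exists_operator (assumptionI_symm hM.cov hM.cov' hI)
      (neg_mem (hI.1 ▸ hII))
    exact ⟨R, fun p hp => hR p.swap hp⟩
  near := by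
    classical
    intro ε hε
    obtain ⟨c, hc0, hc⟩ := (assumptionI_iff hM.cov hM.cov').1 hI
    obtain ⟨v, hv⟩ := hII
    have hv' : posSqrt C v = d := hv
    obtain ⟨A, hA, hAc⟩ := hIII
    obtain ⟨J, hJ, hJi, hJo, hJa, hJJ⟩ := hM.exists_isometry
    obtain ⟨J', hJ'⟩ := hM.exists_extension (fun w => (hc w).1) hv
    obtain ⟨s, hs⟩ := exists_finset_of_isCompactOperator hAc hε
    have hn : ∀ u, ‖J u‖ ^ 2 = ‖u‖ ^ 2 := fun u => by
      rw [← real_inner_self_eq_norm_sq, hJi, real_inner_self_eq_norm_sq]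
    have hn' : ∀ u, ‖J' u‖ ^ 2 = ⟪A u, u⟫ + ⟪v, u⟫ ^ 2 := fun u => by
      refine hM.cov.denseRange_posSqrt.induction_on
        (p := fun u => ‖J' u‖ ^ 2 = ⟪A u, u⟫ + ⟪v, u⟫ ^ 2) u
        (isClosed_eq (by fun_prop) (by fun_prop)) fun w => ?_
      have h1 : ⟪A (posSqrt C w), posSqrt C w⟫ = ⟪C' w, w⟫ := by
        rw [← hM.cov.posSqrt_symm, ← hA]
        rfl
      rw [hJ', hM.norm_snd_sq, h1, hM.cov'.norm_posSqrt_sq, ← hv', hM.cov.posSqrt_symm, add_comm]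
    refine ⟨insert o (insert (J v) (s.image J)), fun p hp hps => ?_⟩
    have hdec := hM.induction_on (P := fun p =>
        p = (⟪o, p.1⟫ • o + J (ContinuousLinearMap.adjoint J p.1),
          ⟪o, p.1⟫ • o' + J' (ContinuousLinearMap.adjoint J p.1)))
      (isClosed_eq continuous_id (by fun_prop)) (fun c w => by
        have h1 : ⟪o, c • o + i w⟫ = c := by
          rw [inner_add_right, inner_smul_right, hM.inner_o, real_inner_self_eq_norm_sq, hM.norm_o]
          simp
        have h2 : ContinuousLinearMap.adjoint J (c • o + i w) = posSqrt C w := by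
          rw [map_add, map_smul, hJa, ← hJ, hJJ]
          simp
        simp only [h1, h2]
        rw [hJ, hJ', add_smul, add_assoc]) hp
    have ho : ⟪o, p.1⟫ = 0 := hps o (by simp)
    set u := ContinuousLinearMap.adjoint J p.1 with hu
    rw [ho, zero_smul, zero_smul, zero_add, zero_add] at hdec
    have hp1 : p.1 = J u := congrArg Prod.fst hdec
    have hp2 : p.2 = J' u := congrArg Prod.snd hdec
    have hvu : ⟪v, u⟫ = 0 := by
      rw [← hJi, ← hp1]
      exact hps _ (by simp)
    have key := hs u fun f hf => by
      rw [← hJi, ← hp1]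
      exact hps _ (Finset.mem_insert_of_mem
        (Finset.mem_insert_of_mem (Finset.mem_image_of_mem _ hf)))
    rw [hp1, hp2, hn, hn', hvu]
    have h3 : ⟪(A - a • ContinuousLinearMap.id ℝ E) u, u⟫ = ⟪A u, u⟫ - a * ‖u‖ ^ 2 := by
      simp [inner_sub_left, inner_smul_left]
    rw [h3] at key
    simpa using key

/-- The estimates behind Assumptions I and II: the covariances and the difference of the means are
controlled by the norm of the operator `T`. -/
theorem norm_posSqrt_le_of_operator (hM : FieldModel C C' d o o' i i' D) {T : H →L[ℝ] H'}
    (hT : ∀ p ∈ D, p.2 = T p.1) (w : E) :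
    ‖posSqrt C' w‖ ≤ ‖T‖ * ‖posSqrt C w‖ ∧ |⟪d, w⟫| ≤ ‖T‖ * ‖posSqrt C w‖ := by
  have h1 := hT _ (hM.mem 0 w)
  simp only [zero_smul, zero_add] at h1
  have h2 : ⟪d, w⟫ ^ 2 + ‖posSqrt C' w‖ ^ 2 ≤ (‖T‖ * ‖posSqrt C w‖) ^ 2 := by
    rw [← hM.norm_snd_sq, h1, ← hM.norm_i_eq]
    gcongr
    exact T.le_opNorm _
  have h0 : 0 ≤ ‖T‖ * ‖posSqrt C w‖ := by positivity
  refine ⟨abs_le_of_sq_le_sq' ?_ h0 |>.2, abs_le_of_sq_le_sq ?_ h0⟩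
  · nlinarith [sq_nonneg ⟪d, w⟫]
  · nlinarith [sq_nonneg ‖posSqrt C' w‖]

/-- The operator `C^{-1/2} C' C^{-1/2}` is `Y* Y`, where `Y` is the bounded extension of
`C^{1/2} w ↦ C'^{1/2} w`. Its quadratic form differs from the squared norm of the functionals under
the second measure by the square of their mean, which is a form of rank one. -/
theorem assumptions_of_asympConformal [CompleteSpace H] [CompleteSpace H']
    (hM : FieldModel C C' d o o' i i' D) {a : ℝ} (h : AsympConformal D a) :
    AssumptionI C C' ∧ d ∈ cameronMartin C ∧ AssumptionIII C C' a := by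
  classical
  obtain ⟨T, hT⟩ := h.right
  obtain ⟨R, hR⟩ := h.left
  have hI1 := hM.norm_posSqrt_le_of_operator hT
  have hI2 := hM.swap.norm_posSqrt_le_of_operator (T := R) fun p hp => hR p.swap hp
  have hII : d ∈ cameronMartin C :=
    mem_cameronMartin_of_abs_inner_le hM.cov fun w => (hI1 w).2
  refine ⟨(assumptionI_iff hM.cov hM.cov').2 ⟨max ‖T‖ ‖R‖ + 1, by positivity, fun w => ⟨?_, ?_⟩⟩,
    hII, ?_⟩
  · exact (hI1 w).1.trans (by gcongr; linarith [le_max_left ‖T‖ ‖R‖])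
  · exact (hI2 w).1.trans (by gcongr; linarith [le_max_right ‖T‖ ‖R‖])
  obtain ⟨v, hv⟩ := hII
  have hv' : posSqrt C v = d := hv
  obtain ⟨Y, hY⟩ := exists_factor (e := (posSqrt C : E →ₗ[ℝ] E)) (f := (posSqrt C' : E →ₗ[ℝ] E))
    hM.cov.denseRange_posSqrt fun w => (hI1 w).1
  have hY' : ∀ w, Y (posSqrt C w) = posSqrt C' w := hY
  set A : E →L[ℝ] E := (ContinuousLinearMap.adjoint Y).comp Y with hAdef
  have hAi : ∀ u v, ⟪A u, v⟫ = ⟪Y u, Y v⟫ := fun u v => by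
    change ⟪ContinuousLinearMap.adjoint Y (Y u), v⟫ = _
    rw [ContinuousLinearMap.adjoint_inner_left]
  refine ⟨A, ?_, ?_⟩
  · ext1 u
    refine ext_inner_right ℝ fun w => ?_
    change ⟪posSqrt C (A (posSqrt C u)), w⟫ = _
    rw [hM.cov.posSqrt_symm, hAi, hY', hY', hM.cov'.posSqrt_symm, hM.cov'.posSqrt_posSqrt]
    exact (hM.cov'.symm u w).symm
  obtain ⟨J, hJ, hJi, hJo, hJa, hJJ⟩ := hM.exists_isometry
  have hmem : ∀ u, (J u, T (J u)) ∈ D := fun u => by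
    refine hM.cov.denseRange_posSqrt.induction_on (p := fun u => (J u, T (J u)) ∈ D) u
      (hM.isClosed.preimage (by fun_prop : Continuous fun u => (J u, T (J u)))) fun w => ?_
    have h1 := hM.mem 0 w
    have h2 := hT _ h1
    simp only [zero_smul, zero_add] at h1 h2
    rw [hJ, ← h2]
    exact h1
  have hn : ∀ u, ‖J u‖ ^ 2 = ‖u‖ ^ 2 := fun u => by
    rw [← real_inner_self_eq_norm_sq, hJi, real_inner_self_eq_norm_sq]
  have hn' : ∀ u, ‖T (J u)‖ ^ 2 = ⟪A u, u⟫ + ⟪v, u⟫ ^ 2 := fun u => by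
    refine hM.cov.denseRange_posSqrt.induction_on
      (p := fun u => ‖T (J u)‖ ^ 2 = ⟪A u, u⟫ + ⟪v, u⟫ ^ 2) u
      (isClosed_eq (by fun_prop) (by fun_prop)) fun w => ?_
    have h2 := hT _ (hM.mem 0 w)
    simp only [zero_smul, zero_add] at h2
    rw [hJ, ← h2, hM.norm_snd_sq, hAi, hY', real_inner_self_eq_norm_sq, ← hv',
      hM.cov.posSqrt_symm, add_comm]
  refine isCompactOperator_of_forall_finset (fun x y => ?_) fun ε hε => ?_
  · simp only [sub_apply, smul_apply,
      ContinuousLinearMap.id_apply, inner_sub_left, inner_sub_right, inner_smul_left,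
      inner_smul_right, RCLike.conj_to_real]
    rw [hAi, real_inner_comm (A y) x, hAi, real_inner_comm (Y x) (Y y)]
  · obtain ⟨s, hs⟩ := h.near ε hε
    refine ⟨insert v (s.image (ContinuousLinearMap.adjoint J)), fun u hu => ?_⟩
    have key := hs _ (hmem u) fun f hf => by
      rw [← ContinuousLinearMap.adjoint_inner_left]
      exact hu _ (Finset.mem_insert_of_mem (Finset.mem_image_of_mem _ hf))
    simp only at key
    rw [hn, hn', hu v (Finset.mem_insert_self _ _)] at key
    have h3 : ⟪(A - a • ContinuousLinearMap.id ℝ E) u, u⟫ = ⟪A u, u⟫ - a * ‖u‖ ^ 2 := by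
      simp [inner_sub_left, inner_smul_left]
    rw [h3]
    simpa using key

end FieldModel

end Model

/-! ### Affine functionals of a Gaussian field -/

section Gaussian

theorem inner_Lp_eq_integral {α : Type*} [MeasurableSpace α] {μ : Measure α} (f g : Lp ℝ 2 μ) :
    ⟪f, g⟫ = ∫ y, f y * g y ∂μ := by
  rw [L2.inner_def]
  refine integral_congr_ae (ae_of_all _ fun y => ?_)
  simp [mul_comm]

/-- The constant functional `1`. -/
def oneLp {α : Type*} [MeasurableSpace α] (μ : Measure α) [IsFiniteMeasure μ] :
    Lp ℝ 2 μ := Lp.const 2 μ (1 : ℝ)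

theorem coeFn_oneLp {α : Type*} [MeasurableSpace α]
    (μ : Measure α) [IsFiniteMeasure μ] : oneLp μ =ᵐ[μ] fun _ => (1 : ℝ) :=
  Lp.coeFn_const 2 μ 1

theorem inner_oneLp {α : Type*} [MeasurableSpace α]
    (μ : Measure α) [IsFiniteMeasure μ] (f : Lp ℝ 2 μ) :
    ⟪oneLp μ, f⟫ = ∫ y, f y ∂μ := by
  rw [inner_Lp_eq_integral]
  refine integral_congr_ae ?_
  filter_upwards [coeFn_oneLp μ] with y hy
  rw [hy, one_mul]

theorem norm_oneLp {α : Type*} [MeasurableSpace α] (μ : Measure α) [IsProbabilityMeasure μ] :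
    ‖oneLp μ‖ = 1 := by
  have h : ‖oneLp μ‖ ^ 2 = 1 ^ 2 := by
    rw [← real_inner_self_eq_norm_sq, inner_oneLp, integral_congr_ae (coeFn_oneLp μ)]
    simp
  exact (sq_eq_sq₀ (norm_nonneg _) zero_le_one).1 h

variable {E : Type*} [NormedAddCommGroup E] [InnerProductSpace ℝ E] [MeasurableSpace E]
  [BorelSpace E]

theorem memLp_inner (μ : Measure E) [IsGaussian μ] (w : E) :
    MemLp (fun y => ⟪w, y⟫) 2 μ :=
  IsGaussian.memLp_dual μ (innerSL ℝ w) 2 (by simp)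

/-- The linear functional `y ↦ ⟪w, y⟫` as an element of `L²(μ)`. -/
def linLp (μ : Measure E) [IsGaussian μ] : E →ₗ[ℝ] Lp ℝ 2 μ where
  toFun w := (memLp_inner μ w).toLp
  map_add' u v := by
    rw [← MemLp.toLp_add]
    exact MemLp.toLp_congr _ _ (ae_of_all _ fun y => inner_add_left _ _ _)
  map_smul' c u := by
    rw [RingHom.id_apply, ← MemLp.toLp_const_smul]
    exact MemLp.toLp_congr _ _ (ae_of_all _ fun y => by simp [inner_smul_left])

theorem coeFn_linLp (μ : Measure E) [IsGaussian μ] (w : E) :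
    linLp μ w =ᵐ[μ] fun y => ⟪w, y⟫ :=
  MemLp.coeFn_toLp (memLp_inner μ w)

/-- The centred linear functional `y ↦ ⟪w, y - m⟫` as an element of `L²(μ)`. -/
def centredLp (μ : Measure E) [IsGaussian μ] (m : E) : E →ₗ[ℝ] Lp ℝ 2 μ where
  toFun w := linLp μ w - ⟪w, m⟫ • oneLp μ
  map_add' u v := by
    simp only [map_add, inner_add_left]
    module
  map_smul' c u := by
    simp only [map_smul, inner_smul_left, RCLike.conj_to_real, RingHom.id_apply]
    module

theorem centredLp_apply (μ : Measure E) [IsGaussian μ] (m w : E) :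
    centredLp μ m w = linLp μ w - ⟪w, m⟫ • oneLp μ :=
  rfl

theorem coeFn_centredLp (μ : Measure E) [IsGaussian μ] (m w : E) :
    centredLp μ m w =ᵐ[μ] fun y => ⟪w, y - m⟫ := by
  rw [centredLp_apply]
  filter_upwards [Lp.coeFn_sub (linLp μ w) (⟪w, m⟫ • oneLp μ), coeFn_linLp μ w,
    Lp.coeFn_smul ⟪w, m⟫ (oneLp μ), coeFn_oneLp μ] with y h1 h2 h3 h4
  rw [h1, Pi.sub_apply, h2, h3, Pi.smul_apply, h4, inner_sub_right]
  simp

variable {μ : Measure E} {m : E} {C : E →L[ℝ] E} [IsGaussian μ]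

theorem inner_oneLp_linLp (hμ : IsNormal μ m C) (w : E) : ⟪oneLp μ, linLp μ w⟫ = ⟪w, m⟫ := by
  rw [inner_oneLp, integral_congr_ae (coeFn_linLp μ w), hμ.mean]

theorem inner_oneLp_centredLp (hμ : IsNormal μ m C) (w : E) :
    ⟪oneLp μ, centredLp μ m w⟫ = 0 := by
  rw [centredLp_apply, inner_sub_right, inner_oneLp_linLp hμ, inner_smul_right,
    real_inner_self_eq_norm_sq, norm_oneLp]
  simp

theorem inner_centredLp (hμ : IsNormal μ m C) (u v : E) :
    ⟪centredLp μ m u, centredLp μ m v⟫ = ⟪C u, v⟫ := by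
  have h1 : ⟪linLp μ u, linLp μ v⟫ = ⟪C u, v⟫ + ⟪u, m⟫ * ⟪v, m⟫ := by
    have h2 := covariance_eq_sub (memLp_inner μ u) (memLp_inner μ v)
    rw [hμ.cov, hμ.mean, hμ.mean] at h2
    rw [h2, sub_add_cancel, inner_Lp_eq_integral]
    refine integral_congr_ae ?_
    filter_upwards [coeFn_linLp μ u, coeFn_linLp μ v] with y hu hv
    rw [hu, hv, Pi.mul_apply]
  nth_rewrite 1 [centredLp_apply]
  rw [inner_sub_left, inner_smul_left, inner_oneLp_centredLp hμ, centredLp_apply, inner_sub_right,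
    inner_smul_right, h1, real_inner_comm (oneLp μ) (linLp μ u), inner_oneLp_linLp hμ]
  simp [mul_comm]

theorem norm_centredLp_sq (hμ : IsNormal μ m C) (w : E) :
    ‖centredLp μ m w‖ ^ 2 = ⟪C w, w⟫ := by
  rw [← real_inner_self_eq_norm_sq, inner_centredLp hμ]

/-- The covariance operator of a probability measure is symmetric. -/
theorem IsNormal.isStrictCov (hμ : IsNormal μ m C) (hpos : ∀ w, w ≠ 0 → 0 < ⟪C w, w⟫) :
    IsStrictCov C where
  symm u v := by
    rw [← inner_centredLp hμ u v, real_inner_comm (C v) u, ← inner_centredLp hμ v u,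
      real_inner_comm]
  pos := hpos

end Gaussian

section Common

variable {X : Type*} [MeasurableSpace X] {ν : Measure X}
  [MeasurableSpace (Lp ℝ 2 ν)] [BorelSpace (Lp ℝ 2 ν)]
  (μ μ' : Measure (Lp ℝ 2 ν)) [IsGaussian μ] [IsGaussian μ']

/-- The common functionals as a closed subspace of `L²(μ) × L²(μ')`. -/
def commonRel (m m' : Lp ℝ 2 ν) : Submodule ℝ (Lp ℝ 2 μ × Lp ℝ 2 μ') :=
  (LinearMap.range (modelMap (oneLp μ) (oneLp μ') (centredLp μ m) (centredLp μ' m')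
    (m' - m))).topologicalClosure

/-- The parametrization of affine functionals by their mean under `μ` differs from that by their
value at `0` only in the constant part. -/
theorem coe_commonRel (m m' : Lp ℝ 2 ν) :
    (commonRel μ μ' m m' : Set (Lp ℝ 2 μ × Lp ℝ 2 μ')) = commonFunctionals μ μ' := by
  rw [commonRel, Submodule.topologicalClosure_coe, commonFunctionals]
  congr 1
  have aff : ∀ (μ : Measure (Lp ℝ 2 ν)) [IsGaussian μ] (f : Lp ℝ 2 μ) (c : ℝ) (w : Lp ℝ 2 ν),
      (f =ᵐ[μ] fun y => c + ⟪w, y⟫) ↔ f = c • oneLp μ + linLp μ w := by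
    intro μ _ f c w
    have h : (c • oneLp μ + linLp μ w : Lp ℝ 2 μ) =ᵐ[μ] fun y => c + ⟪w, y⟫ := by
      filter_upwards [Lp.coeFn_add (c • oneLp μ) (linLp μ w), coeFn_linLp μ w,
        Lp.coeFn_smul c (oneLp μ), coeFn_oneLp μ] with y h1 h2 h3 h4
      rw [h1, Pi.add_apply, h2, h3, Pi.smul_apply, h4]
      simp
    exact ⟨fun hf => Lp.ext (hf.trans h.symm), fun hf => hf ▸ h⟩
  ext p
  constructor
  · rintro ⟨⟨c, w⟩, rfl⟩
    refine ⟨c - ⟪w, m⟫, w, (aff μ _ _ _).2 ?_, (aff μ' _ _ _).2 ?_⟩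
    · simp only [modelMap, LinearMap.coe_mk, AddHom.coe_mk, centredLp_apply]
      module
    · simp only [modelMap, LinearMap.coe_mk, AddHom.coe_mk, centredLp_apply, inner_sub_left,
        real_inner_comm]
      module
  · rintro ⟨c, w, h1, h2⟩
    refine ⟨(c + ⟪w, m⟫, w), Prod.ext ?_ ?_⟩
    · rw [(aff μ _ _ _).1 h1]
      simp only [modelMap, LinearMap.coe_mk, AddHom.coe_mk, centredLp_apply]
      module
    · rw [(aff μ' _ _ _).1 h2]
      simp only [modelMap, LinearMap.coe_mk, AddHom.coe_mk, centredLp_apply, inner_sub_left,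
        real_inner_comm]
      module

variable {μ μ'}

theorem mem_commonRel {m m' : Lp ℝ 2 ν} {p : Lp ℝ 2 μ × Lp ℝ 2 μ'} :
    p ∈ commonRel μ μ' m m' ↔ p ∈ commonFunctionals μ μ' := by
  rw [← SetLike.mem_coe, coe_commonRel]

theorem fieldModel_commonRel {m m' : Lp ℝ 2 ν} {C C' : Lp ℝ 2 ν →L[ℝ] Lp ℝ 2 ν}
    (hμ : IsNormal μ m C) (hμ' : IsNormal μ' m' C') (hpos : ∀ w, w ≠ 0 → 0 < ⟪C w, w⟫)
    (hpos' : ∀ w, w ≠ 0 → 0 < ⟪C' w, w⟫) :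
    FieldModel C C' (m' - m) (oneLp μ) (oneLp μ') (centredLp μ m) (centredLp μ' m')
      (commonRel μ μ' m m') where
  cov := hμ.isStrictCov hpos
  cov' := hμ'.isStrictCov hpos'
  norm_o := norm_oneLp μ
  norm_o' := norm_oneLp μ'
  inner_o := inner_oneLp_centredLp hμ
  inner_o' := inner_oneLp_centredLp hμ'
  norm_i := norm_centredLp_sq hμ
  norm_i' := norm_centredLp_sq hμ'
  rel := rfl

/-! ### Prediction errors in `L²` -/

theorem secondMoment_eq {E : Type*} [MeasurableSpace E] {μ : Measure E} (f : Lp ℝ 2 μ) :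
    secondMoment f = ENNReal.ofReal (‖f‖ ^ 2) := by
  have h1 : Integrable (fun y => f y ^ 2) μ := (Lp.memLp f).integrable_sq
  rw [secondMoment, ← ofReal_integral_eq_lintegral_ofReal h1 (ae_of_all _ fun y => sq_nonneg _),
    ← real_inner_self_eq_norm_sq, inner_Lp_eq_integral]
  simp only [sq]

theorem isBestPredictor_iff {E : Type*} [MeasurableSpace E] {μ : Measure E}
    {V : Submodule ℝ (Lp ℝ 2 μ)} {h g : Lp ℝ 2 μ} :
    IsBestPredictor V h g ↔ g ∈ V ∧ ∀ f ∈ V, ⟪f, g - h⟫ = 0 := by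
  refine and_congr_right fun _ => forall₂_congr fun f _ => ?_
  rw [inner_Lp_eq_integral]
  have : ∫ y, (g y - h y) * f y ∂μ = ∫ y, f y * (g - h) y ∂μ := by
    refine integral_congr_ae ?_
    filter_upwards [Lp.coeFn_sub g h] with y hy
    rw [hy, Pi.sub_apply, mul_comm]
  rw [this]

/-- An element of the right-hand side is obtained from the functional `-e.2`, whose predictors are
`e.1 - e.2` under `μ` and `0` under `μ'`. -/
theorem errorPairs_eq {m m' : Lp ℝ 2 ν} {V : Submodule ℝ (Lp ℝ 2 μ × Lp ℝ 2 μ')}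
    (hV : V ≤ commonRel μ μ' m m') : errorPairs μ μ' V = errorRel (commonRel μ μ' m m') V := by
  ext e
  constructor
  · rintro ⟨h, hh, g, hg, g', hg', hb, hb', hpos, rfl⟩
    rw [isBestPredictor_iff] at hb hb'
    have hhD := mem_commonRel (m := m) (m' := m').2 hh
    refine ⟨Submodule.sub_mem _ (hV hg) hhD, Submodule.sub_mem _ (hV hg') hhD, ?_,
      fun v hv => hb.2 _ ⟨v, hv, rfl⟩, fun v hv => hb'.2 _ ⟨v, hv, rfl⟩, fun h0 => ?_⟩
    · rw [sub_sub_sub_cancel_right]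
      exact V.sub_mem hg hg'
    · rw [secondMoment_eq, ENNReal.ofReal_pos] at hpos
      change (g - h).1 = 0 at h0
      rw [h0] at hpos
      simp at hpos
  · obtain ⟨e₁, e₂⟩ := e
    rintro ⟨h1, h2, h3, h4, h5, h6⟩
    refine ⟨-e₂, mem_commonRel (m := m) (m' := m').1 (Submodule.neg_mem _ h2), e₁ - e₂, h3, 0,
      V.zero_mem, isBestPredictor_iff.2 ⟨⟨_, h3, rfl⟩, ?_⟩,
      isBestPredictor_iff.2 ⟨⟨0, V.zero_mem, rfl⟩, ?_⟩, ?_, ?_⟩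
    · rintro _ ⟨v, hv, rfl⟩
      simpa using h4 v hv
    · rintro _ ⟨v, hv, rfl⟩
      simpa using h5 v hv
    · rw [secondMoment_eq, ENNReal.ofReal_pos]
      have : 0 < ‖e₁.1‖ := norm_pos_iff.2 h6
      simpa using by positivity
    · simp

/-- Constant functionals are those without variance. -/
theorem variance_eq_zero_iff_exists {E : Type*} [MeasurableSpace E] {μ : Measure E}
    [IsProbabilityMeasure μ] (f : Lp ℝ 2 μ) : Var[f; μ] = 0 ↔ ∃ c : ℝ, f = c • oneLp μ := by
  have h1 : Var[f; μ] = ‖f - ⟪oneLp μ, f⟫ • oneLp μ‖ ^ 2 := by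
    rw [variance_eq_sub (Lp.memLp f), norm_sub_sq_real, inner_smul_right, norm_smul, norm_oneLp,
      real_inner_comm (oneLp μ) f, inner_oneLp, ← real_inner_self_eq_norm_sq f,
      inner_Lp_eq_integral f f, mul_one, Real.norm_eq_abs, sq_abs]
    simp only [sq, Pi.mul_apply]
    ring
  rw [h1]
  constructor
  · intro h
    exact ⟨_, sub_eq_zero.1 (norm_eq_zero.1 (by simpa using h))⟩
  · rintro ⟨c, rfl⟩
    rw [inner_smul_right, real_inner_self_eq_norm_sq, norm_oneLp]
    simp

end Common

/-! ### Point values of the field -/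

section FullSpace

variable {X : Type*} [MetricSpace X] [MeasurableSpace X] {ν : Measure X}
  [MeasurableSpace (Lp ℝ 2 ν)] {μ : Measure (Lp ℝ 2 ν)} [IsFiniteMeasure μ] {m : Lp ℝ 2 ν}

theorem isClosed_fullSpace : IsClosed (fullSpace μ m : Set (Lp ℝ 2 μ)) := by
  rw [fullSpace, sup_comm]
  exact Submodule.isClosed_sup_finiteDimensional _ _ (Submodule.isClosed_topologicalClosure _)

theorem oneLp_mem_fullSpace : oneLp μ ∈ fullSpace μ m :=
  Submodule.mem_sup_left (Submodule.mem_span_singleton_self _)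

end FullSpace

section PointValues

variable {X : Type*} [MetricSpace X] [MeasurableSpace X] [BorelSpace X] {ν : Measure X}
  [IsFiniteMeasure ν]

/-- The normalized indicator function of the ball `B(x, r)`, as an element of `L²(ν)`. -/
def ballWeight (ν : Measure X) [IsFiniteMeasure ν] (x : X) (r : ℝ) : Lp ℝ 2 ν :=
  (ν.real (Metric.ball x r))⁻¹ •
    indicatorConstLp 2 (measurableSet_ball (x := x) (ε := r)) (measure_ne_top ν _) (1 : ℝ)

theorem inner_ballWeight (x : X) (r : ℝ) (f : Lp ℝ 2 ν) :
    ⟪ballWeight ν x r, f⟫ = ⨍ x' in Metric.ball x r, f x' ∂ν := by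
  rw [ballWeight, inner_smul_left, setAverage_eq]
  have := L2.inner_indicatorConstLp_one (𝕜 := ℝ) (measurableSet_ball (x := x) (ε := r))
    (measure_ne_top ν _) f
  rw [this]
  simp

section Field

variable [MeasurableSpace (Lp ℝ 2 ν)] [BorelSpace (Lp ℝ 2 ν)] {μ : Measure (Lp ℝ 2 ν)}
  [IsGaussian μ] {m : Lp ℝ 2 ν}

theorem isPointValue_iff {x : X} {ζ : Lp ℝ 2 μ} :
    IsPointValue μ m x ζ ↔
      Tendsto (fun r => centredLp μ m (ballWeight ν x r)) (𝓝[>] 0) (𝓝 ζ) := by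
  have h : ∀ r, eLpNorm (fun y : Lp ℝ 2 ν =>
      ζ y - ⨍ x' in Metric.ball x r, (y x' - m x') ∂ν) 2 μ =
      ‖centredLp μ m (ballWeight ν x r) - ζ‖ₑ := by
    intro r
    rw [← enorm_neg, neg_sub, Lp.enorm_def]
    refine eLpNorm_congr_ae ?_
    filter_upwards [Lp.coeFn_sub ζ (centredLp μ m (ballWeight ν x r)),
      coeFn_centredLp μ m (ballWeight ν x r)] with y h1 h2
    rw [h1, Pi.sub_apply, h2, inner_ballWeight]
    congr 1
    refine integral_congr_ae (Measure.ae_smul_measure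
      (ae_restrict_of_ae ?_) _)
    filter_upwards [Lp.coeFn_sub y m] with x' hx'
    rw [hx', Pi.sub_apply]
  rw [IsPointValue, tendsto_congr h, tendsto_iff_edist_tendsto_0]
  simp only [edist_eq_enorm_sub]

theorem centredSpace_le :
    centredSpace μ m ≤ (LinearMap.range (centredLp μ m)).topologicalClosure := by
  refine Submodule.topologicalClosure_minimal _ (Submodule.span_le.2 ?_)
    (Submodule.isClosed_topologicalClosure _)
  rintro ζ ⟨x, hx⟩
  rw [isPointValue_iff] at hx
  exact mem_closure_of_tendsto hx (Eventually.of_forall fun r => ⟨_, rfl⟩)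

end Field

variable [CompactSpace X]

theorem covOp_eq_toLp (ϱ : C(X × X, ℝ)) (v : Lp ℝ 2 ν) :
    covOp ν ϱ v = ContinuousMap.toLp (E := ℝ) 2 ν ℝ (integralFun ν ϱ v) :=
  rfl

section Mean

variable [MeasurableSpace (Lp ℝ 2 ν)] [BorelSpace (Lp ℝ 2 ν)] {μ : Measure (Lp ℝ 2 ν)}
  [IsGaussian μ] {m : Lp ℝ 2 ν} {ϱ : C(X × X, ℝ)}

theorem inner_oneLp_of_mem_centredSpace (hμ : IsNormal μ m (covOp ν ϱ)) {z : Lp ℝ 2 μ}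
    (hz : z ∈ centredSpace μ m) : ⟪oneLp μ, z⟫ = 0 := by
  refine (isClosed_eq (by fun_prop) continuous_const :
    IsClosed {z : Lp ℝ 2 μ | ⟪oneLp μ, z⟫ = 0}).closure_subset_iff.2 ?_ (centredSpace_le hz)
  rintro _ ⟨w, rfl⟩
  exact inner_oneLp_centredLp hμ w

theorem mem_centredSpace_of_mem_fullSpace (hμ : IsNormal μ m (covOp ν ϱ)) {z : Lp ℝ 2 μ}
    (hz : z ∈ fullSpace μ m) (hz1 : ⟪oneLp μ, z⟫ = 0) : z ∈ centredSpace μ m := by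
  obtain ⟨a, ha, z', hz', rfl⟩ := Submodule.mem_sup.1 hz
  obtain ⟨c, rfl⟩ := Submodule.mem_span_singleton.1 ha
  change ⟪oneLp μ, c • oneLp μ + z'⟫ = 0 at hz1
  rw [inner_add_right, inner_oneLp_of_mem_centredSpace hμ hz', inner_smul_right,
    real_inner_self_eq_norm_sq, norm_oneLp] at hz1
  have hc : c = 0 := by simpa using hz1
  simpa [hc] using hz'

end Mean

variable [ν.IsOpenPosMeasure]

/-- Averages of a continuous function over a ball are close to its values on the ball. -/
theorem abs_inner_ballWeight_sub_le {x : X} {r : ℝ} (hr : 0 < r) (g : C(X, ℝ)) {c ε : ℝ}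
    (h : ∀ a ∈ Metric.ball x r, |g a - c| ≤ ε) :
    |⟪ballWeight ν x r, ContinuousMap.toLp (E := ℝ) 2 ν ℝ g⟫ - c| ≤ ε := by
  have hpos : 0 < ν.real (Metric.ball x r) :=
    ENNReal.toReal_pos (Metric.measure_ball_pos ν x hr).ne' (measure_ne_top ν _)
  have hint : IntegrableOn (fun a => g a) (Metric.ball x r) ν :=
    ((g.continuous.integrable_of_hasCompactSupport
      (HasCompactSupport.of_compactSpace _))).integrableOn
  have h1 : ⟪ballWeight ν x r, ContinuousMap.toLp (E := ℝ) 2 ν ℝ g⟫ - c =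
      (ν.real (Metric.ball x r))⁻¹ * ∫ a in Metric.ball x r, (g a - c) ∂ν := by
    rw [inner_ballWeight, setAverage_eq, integral_sub hint (integrable_const _), setIntegral_const,
      smul_eq_mul, smul_eq_mul, mul_sub, ← mul_assoc, inv_mul_cancel₀ hpos.ne', one_mul]
    congr 2
    refine integral_congr_ae (ae_restrict_of_ae ?_)
    exact ContinuousMap.coeFn_toLp (p := 2) (𝕜 := ℝ) ν g
  rw [h1, abs_mul, abs_inv, abs_of_pos hpos, inv_mul_le_iff₀ hpos, mul_comm]
  exact norm_setIntegral_le_of_norm_le_const (f := fun a => g a - c) (C := ε)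
    (measure_lt_top ν _) h

theorem tendsto_inner_ballWeight (g : C(X, ℝ)) (x : X) :
    Tendsto (fun r => ⟪ballWeight ν x r, ContinuousMap.toLp (E := ℝ) 2 ν ℝ g⟫) (𝓝[>] 0)
      (𝓝 (g x)) := by
  refine Metric.tendsto_nhdsWithin_nhds.2 fun ε hε => ?_
  obtain ⟨δ, hδ, hg⟩ := Metric.continuous_iff.1 g.continuous x (ε / 2) (by positivity)
  refine ⟨δ, hδ, fun {r} hr hrδ => ?_⟩
  rw [Real.dist_eq]
  refine lt_of_le_of_lt (abs_inner_ballWeight_sub_le (ε := ε / 2) hr g fun a ha => ?_)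
    (half_lt_self hε)
  rw [dist_zero_right, Real.norm_of_nonneg (le_of_lt hr)] at hrδ
  have := hg a ((Metric.mem_ball.1 ha).trans hrδ)
  rw [Real.dist_eq] at this
  exact this.le

/-- The covariances of ball averages around `x` converge to `ϱ(x, x)`. -/
theorem exists_abs_inner_covOp_ballWeight_le (ϱ : C(X × X, ℝ)) (x : X) {ε : ℝ} (hε : 0 < ε) :
    ∃ δ > 0, ∀ r s, 0 < r → r < δ → 0 < s → s < δ →
      |⟪covOp ν ϱ (ballWeight ν x r), ballWeight ν x s⟫ - ϱ (x, x)| ≤ ε := by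
  obtain ⟨δ, hδ, hg⟩ := Metric.continuous_iff.1 ϱ.continuous (x, x) ε hε
  refine ⟨δ, hδ, fun r s hr hrδ hs hsδ => ?_⟩
  rw [covOp_eq_toLp, real_inner_comm]
  refine abs_inner_ballWeight_sub_le hs _ fun b hb => ?_
  rw [integralFun_apply, real_inner_comm]
  refine abs_inner_ballWeight_sub_le hr (ϱ.curry b) fun a ha => ?_
  have := hg (b, a) (by
    rw [Prod.dist_eq]
    exact max_lt ((Metric.mem_ball.1 hb).trans hsδ) ((Metric.mem_ball.1 ha).trans hrδ))
  rw [Real.dist_eq] at this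
  exact this.le

variable [MeasurableSpace (Lp ℝ 2 ν)] [BorelSpace (Lp ℝ 2 ν)] {μ : Measure (Lp ℝ 2 ν)}
  [IsGaussian μ] {m : Lp ℝ 2 ν} {ϱ : C(X × X, ℝ)}

theorem exists_isPointValue (hμ : IsNormal μ m (covOp ν ϱ)) (x : X) :
    ∃ ζ, IsPointValue μ m x ζ := by
  simp only [isPointValue_iff]
  refine cauchy_map_iff_exists_tendsto.1 (Metric.cauchy_iff.2 ⟨inferInstance, fun ε hε => ?_⟩)
  obtain ⟨δ, hδ, h⟩ := exists_abs_inner_covOp_ballWeight_le (ν := ν) ϱ x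
    (ε := ε ^ 2 / 8) (by positivity)
  refine ⟨_, image_mem_map (Ioo_mem_nhdsGT hδ), ?_⟩
  rintro _ ⟨r, ⟨hr0, hr⟩, rfl⟩ _ ⟨s, ⟨hs0, hs⟩, rfl⟩
  rw [dist_eq_norm]
  refine lt_of_pow_lt_pow_left₀ 2 hε.le ?_
  rw [norm_sub_sq_real, ← real_inner_self_eq_norm_sq, ← real_inner_self_eq_norm_sq,
    inner_centredLp hμ, inner_centredLp hμ, inner_centredLp hμ]
  have h1 := abs_le.1 (h r r hr0 hr hr0 hr)
  have h2 := abs_le.1 (h r s hr0 hr hs0 hs)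
  have h3 := abs_le.1 (h s s hs0 hs hs0 hs)
  have h4 : 0 < ε ^ 2 := by positivity
  linarith [h1.2, h2.1, h3.2]

theorem norm_sq_of_isPointValue (hμ : IsNormal μ m (covOp ν ϱ)) {x : X} {ζ : Lp ℝ 2 μ}
    (hζ : IsPointValue μ m x ζ) : ‖ζ‖ ^ 2 = ϱ (x, x) := by
  rw [isPointValue_iff] at hζ
  refine tendsto_nhds_unique (hζ.norm.pow 2) (Metric.tendsto_nhdsWithin_nhds.2 fun ε hε => ?_)
  obtain ⟨δ, hδ, h⟩ := exists_abs_inner_covOp_ballWeight_le (ν := ν) ϱ x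
    (ε := ε / 2) (by positivity)
  refine ⟨δ, hδ, fun {r} hr hrδ => ?_⟩
  rw [dist_zero_right, Real.norm_of_nonneg (le_of_lt hr)] at hrδ
  rw [norm_centredLp_sq hμ, Real.dist_eq]
  exact (h r r hr hrδ hr hrδ).trans_lt (half_lt_self hε)

theorem inner_centredLp_of_isPointValue (hμ : IsNormal μ m (covOp ν ϱ)) {x : X} {ζ : Lp ℝ 2 μ}
    (hζ : IsPointValue μ m x ζ) (v : Lp ℝ 2 ν) :
    ⟪centredLp μ m v, ζ⟫ = integralFun ν ϱ v x := by
  rw [isPointValue_iff] at hζ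
  refine tendsto_nhds_unique (tendsto_const_nhds.inner hζ) ?_
  refine (tendsto_inner_ballWeight (ν := ν) (integralFun ν ϱ v) x).congr fun r => ?_
  rw [inner_centredLp hμ, covOp_eq_toLp, real_inner_comm]

/-- The point values span a dense subspace: a vector `u = lim i v_n` orthogonal to all of them
satisfies `(𝒞 v_n)(x) → 0` uniformly in `x`, hence it is orthogonal to every `i w`. -/
theorem centredSpace_eq (hμ : IsNormal μ m (covOp ν ϱ)) :
    centredSpace μ m = (LinearMap.range (centredLp μ m)).topologicalClosure := by
  refine le_antisymm centredSpace_le fun z hz => ?_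
  have hcl : IsClosed (centredSpace μ m : Set (Lp ℝ 2 μ)) :=
    Submodule.isClosed_topologicalClosure _
  have : CompleteSpace (centredSpace μ m) := hcl.completeSpace_coe
  set u := z - (centredSpace μ m).starProjection z with hu
  have huR : u ∈ (LinearMap.range (centredLp μ m)).topologicalClosure :=
    Submodule.sub_mem _ hz (centredSpace_le ((centredSpace μ m).starProjection_apply_mem z))
  have huo : ∀ ζ ∈ centredSpace μ m, ⟪ζ, u⟫ = 0 :=
    (centredSpace μ m).sub_starProjection_mem_orthogonal z
  obtain ⟨b, hb, hbu⟩ := mem_closure_iff_seq_limit.1 huR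
  choose v hv using hb
  obtain rfl : b = fun n => centredLp μ m (v n) := funext fun n => (hv n).symm
  have hsup : ∀ n, ‖integralFun ν ϱ (v n)‖ ≤ √‖ϱ‖ * ‖centredLp μ m (v n) - u‖ := fun n => by
    refine (ContinuousMap.norm_le _ (by positivity)).2 fun x => ?_
    obtain ⟨ζ, hζ⟩ := exists_isPointValue hμ x
    have h1 : ⟪ζ, u⟫ = 0 :=
      huo ζ (Submodule.le_topologicalClosure _ (Submodule.subset_span ⟨x, hζ⟩))
    have h2 : integralFun ν ϱ (v n) x = ⟪ζ, centredLp μ m (v n) - u⟫ := by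
      rw [inner_sub_right, h1, sub_zero, ← inner_centredLp_of_isPointValue hμ hζ, real_inner_comm]
    rw [h2]
    refine (norm_inner_le_norm _ _).trans ?_
    gcongr
    rw [Real.le_sqrt (norm_nonneg _) (norm_nonneg _), norm_sq_of_isPointValue hμ hζ]
    exact (le_abs_self _).trans (ϱ.norm_coe_le_norm (x, x))
  have hsup0 : Tendsto (fun n => integralFun ν ϱ (v n)) atTop (𝓝 0) := by
    refine squeeze_zero_norm hsup ?_
    have := (tendsto_iff_norm_sub_tendsto_zero.1 hbu).const_mul √‖ϱ‖
    simpa using this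
  have hC0 : Tendsto (fun n => covOp ν ϱ (v n)) atTop (𝓝 0) := by
    have := ((ContinuousMap.toLp (E := ℝ) 2 ν ℝ).continuous.tendsto 0).comp hsup0
    rw [map_zero] at this
    exact this
  have hort : ∀ w, ⟪u, centredLp μ m w⟫ = 0 := fun w => by
    refine tendsto_nhds_unique (hbu.inner tendsto_const_nhds) ?_
    have h1 : Tendsto (fun n => ⟪covOp ν ϱ (v n), w⟫) atTop (𝓝 ⟪(0 : Lp ℝ 2 ν), w⟫) :=
      hC0.inner tendsto_const_nhds
    rw [inner_zero_left] at h1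
    exact h1.congr fun n => (inner_centredLp hμ _ _).symm
  have hu0 : u = 0 := by
    refine inner_self_eq_zero (𝕜 := ℝ).1 (tendsto_nhds_unique (tendsto_const_nhds.inner hbu) ?_)
    exact tendsto_const_nhds.congr fun n => (hort (v n)).symm
  rw [sub_eq_zero.1 hu0]
  exact (centredSpace μ m).starProjection_apply_mem z

variable {μ' : Measure (Lp ℝ 2 ν)} [IsGaussian μ'] {m' : Lp ℝ 2 ν}

/-- The first components of the common functionals are dense in `ℋ`. -/
theorem fullSpace_eq (hμ : IsNormal μ m (covOp ν ϱ)) :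
    fullSpace μ m = ((commonRel μ μ' m m').map
      (LinearMap.fst ℝ (Lp ℝ 2 μ) (Lp ℝ 2 μ'))).topologicalClosure := by
  have hgen : ∀ c w, c • oneLp μ + centredLp μ m w ∈ (commonRel μ μ' m m').map
      (LinearMap.fst ℝ (Lp ℝ 2 μ) (Lp ℝ 2 μ')) := fun c w =>
    ⟨_, Submodule.le_topologicalClosure _ ⟨(c, w), rfl⟩, rfl⟩
  refine le_antisymm (sup_le ?_ ?_) ?_
  · rw [Submodule.span_singleton_le_iff_mem]
    refine Submodule.le_topologicalClosure _ ?_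
    have := hgen 1 0
    rwa [one_smul, map_zero, add_zero] at this
  · rw [centredSpace_eq hμ]
    refine Submodule.topologicalClosure_mono ?_
    rintro _ ⟨w, rfl⟩
    have := hgen 0 w
    rwa [zero_smul, zero_add] at this
  · refine Submodule.topologicalClosure_minimal _ ?_ isClosed_fullSpace
    rintro _ ⟨p, hp, rfl⟩
    have hcl : IsClosed {p : Lp ℝ 2 μ × Lp ℝ 2 μ' | p.1 ∈ fullSpace μ m} :=
      isClosed_fullSpace.preimage continuous_fst
    refine hcl.closure_subset_iff.2 ?_ hp
    rintro _ ⟨q, rfl⟩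
    refine Submodule.add_mem _ (Submodule.smul_mem _ _ oneLp_mem_fullSpace)
      (Submodule.mem_sup_right ?_)
    rw [centredSpace_eq hμ]
    exact Submodule.le_topologicalClosure _ ⟨_, rfl⟩

end PointValues

/-! ### A standard sequence of observations -/

/-- A maximal linearly independent subset of a dense sequence has the same span. -/
theorem exists_linearIndependent_seq {E : Type*} [NormedAddCommGroup E] [NormedSpace ℝ E]
    [TopologicalSpace.SeparableSpace E] (hE : ¬ FiniteDimensional ℝ E) :
    ∃ w : ℕ → E, LinearIndependent ℝ w ∧
      (Submodule.span ℝ (Set.range w)).topologicalClosure = ⊤ := by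
  obtain ⟨b, hbs, hspan, hind⟩ :=
    exists_linearIndependent ℝ (Set.range (TopologicalSpace.denseSeq E))
  have hcl : (Submodule.span ℝ b).topologicalClosure = ⊤ := by
    rw [hspan, ← Submodule.dense_iff_topologicalClosure_eq_top]
    exact (TopologicalSpace.denseRange_denseSeq E).mono Submodule.subset_span
  have hinf : Infinite b := by
    rw [Set.infinite_coe_iff]
    intro hfin
    have : FiniteDimensional ℝ (Submodule.span ℝ b) := FiniteDimensional.span_of_finite ℝ hfin
    rw [(Submodule.closed_of_finiteDimensional _).submodule_topologicalClosure_eq] at hcl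
    rw [hcl] at this
    exact hE (LinearEquiv.finiteDimensional (Submodule.topEquiv (R := ℝ) (M := E)))
  have hcount : Countable b := ((Set.countable_range _).mono hbs).to_subtype
  obtain ⟨hden⟩ := nonempty_denumerable_iff.2 ⟨hcount, hinf⟩
  refine ⟨fun n => ((Denumerable.eqv b).symm n : E),
    hind.comp _ (Denumerable.eqv b).symm.injective, ?_⟩
  rw [← hcl]
  congr 2
  have := (Denumerable.eqv b).symm.surjective.range_comp (Subtype.val : b → E)
  rw [Subtype.range_coe] at this
  exact this

section GridSpace

variable {E H H' : Type*} [NormedAddCommGroup E] [InnerProductSpace ℝ E]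
  [NormedAddCommGroup H] [InnerProductSpace ℝ H] [NormedAddCommGroup H'] [InnerProductSpace ℝ H']

/-- The span of the constants and the functionals with the linear parts `w 0, …, w (n - 1)`. -/
def seqSpace (o : H) (o' : H') (i : E →ₗ[ℝ] H) (i' : E →ₗ[ℝ] H') (d : E) (w : ℕ → E) (n : ℕ) :
    Submodule ℝ (H × H') :=
  Submodule.span ℝ (insert (o, o') (Set.range fun j : Fin n => modelMap o o' i i' d (0, w j)))

variable {C C' : E →L[ℝ] E} {d : E} {o : H} {o' : H'} {i : E →ₗ[ℝ] H}
  {i' : E →ₗ[ℝ] H'} {D : Submodule ℝ (H × H')} {w : ℕ → E}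

instance finiteDimensional_seqSpace (n : ℕ) :
    FiniteDimensional ℝ (seqSpace o o' i i' d w n) :=
  FiniteDimensional.span_of_finite ℝ ((Set.finite_range _).insert _)

theorem mk_mem_seqSpace (n : ℕ) : (o, o') ∈ seqSpace o o' i i' d w n :=
  Submodule.subset_span (Set.mem_insert _ _)

theorem monotone_seqSpace : Monotone (seqSpace o o' i i' d w) := fun _ _ hkn =>
  Submodule.span_mono (Set.insert_subset_insert
    (Set.range_subset_iff.2 fun j => ⟨⟨j, j.2.trans_le hkn⟩, rfl⟩))

theorem modelMap_one_zero : modelMap o o' i i' d (1, 0) = (o, o') := by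
  simp [modelMap]

theorem seqSpace_le_range (n : ℕ) :
    seqSpace o o' i i' d w n ≤ LinearMap.range (modelMap o o' i i' d) := by
  refine Submodule.span_le.2 (Set.insert_subset ⟨_, modelMap_one_zero⟩ ?_)
  rintro _ ⟨j, rfl⟩
  exact ⟨_, rfl⟩

namespace FieldModel

theorem range_le (hM : FieldModel C C' d o o' i i' D) :
    LinearMap.range (modelMap o o' i i' d) ≤ D := by
  rw [hM.rel]
  exact Submodule.le_topologicalClosure _

theorem seqSpace_le (hM : FieldModel C C' d o o' i i' D) (n : ℕ) :
    seqSpace o o' i i' d w n ≤ D :=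
  (seqSpace_le_range n).trans hM.range_le

theorem mk_mem (hM : FieldModel C C' d o o' i i' D) : (o, o') ∈ D :=
  hM.range_le ⟨_, modelMap_one_zero⟩

theorem i_injective (hM : FieldModel C C' d o o' i i' D) : Function.Injective i := by
  refine (injective_iff_map_eq_zero i).2 fun v hv => ?_
  by_contra h
  have := hM.cov.pos v h
  rw [← hM.norm_i, hv] at this
  simp at this

theorem eq_zero_of_smul_add (hM : FieldModel C C' d o o' i i' D) {c : ℝ} {v : E}
    (h : c • o + i v = 0) : c = 0 ∧ v = 0 := by
  have h1 : ⟪o, c • o + i v⟫ = c := by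
    rw [inner_add_right, hM.inner_o, inner_smul_right, real_inner_self_eq_norm_sq, hM.norm_o]
    simp
  rw [h, inner_zero_right] at h1
  refine ⟨h1.symm, hM.i_injective ?_⟩
  rw [map_zero]
  simpa [← h1] using h

theorem eq_zero_of_fst_eq_zero (hM : FieldModel C C' d o o' i i' D) {p : H × H'}
    (hp : p ∈ LinearMap.range (modelMap o o' i i' d)) (h : p.1 = 0) : p = 0 := by
  obtain ⟨q, rfl⟩ := hp
  obtain ⟨h1, h2⟩ := hM.eq_zero_of_smul_add h
  rw [show q = 0 from Prod.ext h1 h2, map_zero]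

theorem eq_zero_of_snd_eq_zero (hM : FieldModel C C' d o o' i i' D) {p : H × H'}
    (hp : p ∈ LinearMap.range (modelMap o o' i i' d)) (h : p.2 = 0) : p = 0 := by
  obtain ⟨q, rfl⟩ := hp
  obtain ⟨h1, h2⟩ := hM.swap.eq_zero_of_smul_add h
  rw [h2, inner_zero_right, add_zero] at h1
  rw [show q = 0 from Prod.ext h1 h2, map_zero]

theorem not_finiteDimensional_map_fst (hM : FieldModel C C' d o o' i i' D)
    (hE : ¬ FiniteDimensional ℝ E) :
    ¬ FiniteDimensional ℝ (D.map (LinearMap.fst ℝ H H')) := fun _ => by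
  refine hE (FiniteDimensional.of_injective
    (i.codRestrict (D.map (LinearMap.fst ℝ H H')) fun v => ⟨_, hM.range_le ⟨(0, v), rfl⟩, ?_⟩)
    fun u v huv => hM.i_injective (congrArg Subtype.val huv))
  simp [modelMap]

theorem continuous_i [CompleteSpace E] (hM : FieldModel C C' d o o' i i' D) : Continuous i :=
  AddMonoidHomClass.continuous_of_bound i ‖posSqrt C‖ fun v => by
    rw [hM.norm_i_eq]
    exact (posSqrt C).le_opNorm v

theorem exists_mem_seqSpace [CompleteSpace E] (hM : FieldModel C C' d o o' i i' D)
    (hw : (Submodule.span ℝ (Set.range w)).topologicalClosure = ⊤) {p : H × H'} (hp : p ∈ D)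
    {η : ℝ} (hη : 0 < η) :
    ∀ᶠ n in atTop, ∃ v ∈ seqSpace o o' i i' d w n, ‖p.1 - v.1‖ ≤ η := by
  set U := ⨆ n, seqSpace o o' i i' d w n with hU
  have hmemU : ∀ {v}, v ∈ U → ∃ n, v ∈ seqSpace o o' i i' d w n := fun {v} hv =>
    (Submodule.mem_iSup_of_directed _ monotone_seqSpace.directed_le).1 hv
  have hcl : p.1 ∈ (U.map (LinearMap.fst ℝ H H')).topologicalClosure := by
    refine hM.induction_on (P := fun p => p.1 ∈ (U.map (LinearMap.fst ℝ H H')).topologicalClosure)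
      ((Submodule.isClosed_topologicalClosure _).preimage continuous_fst) (fun c v => ?_) hp
    refine Submodule.add_mem _ (Submodule.smul_mem _ _ (Submodule.le_topologicalClosure _
      ⟨(o, o'), le_iSup (seqSpace o o' i i' d w) 0 (mk_mem_seqSpace 0), rfl⟩)) ?_
    have hv : v ∈ (Submodule.span ℝ (Set.range w)).topologicalClosure := hw ▸ Submodule.mem_top
    have hsub : Submodule.span ℝ (Set.range w) ≤
        (U.map (LinearMap.fst ℝ H H')).comap i := by
      refine Submodule.span_le.2 ?_
      rintro _ ⟨j, rfl⟩
      refine ⟨_, le_iSup (seqSpace o o' i i' d w) (j + 1) (Submodule.subset_span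
        (Set.mem_insert_of_mem _ ⟨Fin.last j, rfl⟩)), ?_⟩
      simp [modelMap]
    exact map_mem_closure hM.continuous_i hv hsub
  obtain ⟨_, ⟨v, hv, rfl⟩, hvη⟩ := Metric.mem_closure_iff.1 hcl η hη
  obtain ⟨N, hN⟩ := hmemU hv
  refine eventually_atTop.2 ⟨N, fun n hn => ⟨v, monotone_seqSpace hn hN, ?_⟩⟩
  rw [dist_eq_norm] at hvη
  exact hvη.le

end FieldModel

end GridSpace

/-- A vanishing linear combination of the sections would be annihilated by the quadratic form. -/
theorem IsStrictlyPosDef.linearIndependent_curry {X : Type*} [MetricSpace X]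
    {ϱ : C(X × X, ℝ)} (hϱ : IsStrictlyPosDef ϱ) :
    LinearIndependent ℝ fun x => ϱ.curry x := by
  refine linearIndependent_iff'.2 fun s α h x hx => ?_
  by_contra hα
  refine (hϱ.pos s α ⟨x, hx, hα⟩).ne' ?_
  rw [Finset.sum_comm]
  refine Finset.sum_eq_zero fun x' _ => ?_
  have := congrArg (fun f : C(X, ℝ) => f x') h
  simp only [ContinuousMap.coe_sum, Finset.sum_apply, ContinuousMap.coe_smul, Pi.smul_apply,
    ContinuousMap.curry_apply, smul_eq_mul, ContinuousMap.zero_apply] at this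
  calc ∑ x ∈ s, α x * α x' * ϱ (x, x') = α x' * ∑ x ∈ s, α x * ϱ (x, x') := by
        rw [Finset.mul_sum]
        exact Finset.sum_congr rfl fun _ _ => by ring
    _ = 0 := by rw [this, mul_zero]

section Infinite

variable {X : Type*} [MetricSpace X] [CompactSpace X] [MeasurableSpace X]
  [BorelSpace X] (ν : Measure X) [IsFiniteMeasure ν]

theorem separableSpace_Lp : TopologicalSpace.SeparableSpace (Lp ℝ 2 ν) :=
  (ContinuousMap.toLp_denseRange (E := ℝ) (p := 2) ν (𝕜 := ℝ) (by simp)).separableSpace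
    (ContinuousMap.toLp (E := ℝ) 2 ν ℝ).continuous

theorem not_finiteDimensional_Lp [Infinite X] [ν.IsOpenPosMeasure] {ϱ : C(X × X, ℝ)}
    (hϱ : IsStrictlyPosDef ϱ) : ¬ FiniteDimensional ℝ (Lp ℝ 2 ν) := fun _ => by
  have hker : LinearMap.ker (ContinuousMap.toLp (E := ℝ) 2 ν ℝ).toLinearMap = ⊥ :=
    LinearMap.ker_eq_bot.2 (ContinuousMap.toLp_injective (E := ℝ) (p := 2) (𝕜 := ℝ) ν)
  have h := hϱ.linearIndependent_curry.map' _ hker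
  have := h.finite
  exact not_finite X

end Infinite

/-! ### Admissible observation sequences -/

section Observations

theorem norm_sub_le_of_isBestPredictor {α : Type*} [MeasurableSpace α] {μ : Measure α}
    {V : Submodule ℝ (Lp ℝ 2 μ)} {h g v : Lp ℝ 2 μ} (hg : IsBestPredictor V h g) (hv : v ∈ V) :
    ‖g - h‖ ≤ ‖h - v‖ := by
  rw [isBestPredictor_iff] at hg
  have h1 : ⟪v - g, g - h⟫ = 0 := hg.2 _ (V.sub_mem hv hg.1)
  have h2 : ‖h - v‖ ^ 2 = ‖v - g‖ ^ 2 + ‖g - h‖ ^ 2 := by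
    rw [norm_sub_rev h v, ← sub_add_sub_cancel v g h, norm_add_sq_real, h1]
    ring
  exact (sq_le_sq₀ (norm_nonneg _) (norm_nonneg _)).1 (by linarith [sq_nonneg ‖v - g‖])

section Span

variable {X : Type*} [MeasurableSpace X] {ν : Measure X} [MeasurableSpace (Lp ℝ 2 ν)]
  {μ μ' : Measure (Lp ℝ 2 ν)} [IsFiniteMeasure μ] [IsFiniteMeasure μ']

theorem map_fst_observationSpace {n : ℕ} (y : Fin n → Lp ℝ 2 μ × Lp ℝ 2 μ') :
    (observationSpace μ μ' y).map (LinearMap.fst ℝ (Lp ℝ 2 μ) (Lp ℝ 2 μ')) =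
      Submodule.span ℝ (insert (oneLp μ) (Set.range fun j => (y j).1)) := by
  rw [observationSpace, Submodule.map_span, Set.image_insert_eq, ← Set.range_comp]
  rfl

instance finiteDimensional_observationSpace {n : ℕ} (y : Fin n → Lp ℝ 2 μ × Lp ℝ 2 μ') :
    FiniteDimensional ℝ (observationSpace μ μ' y) :=
  FiniteDimensional.span_of_finite ℝ ((Set.finite_range _).insert _)

theorem mk_mem_observationSpace {n : ℕ} (y : Fin n → Lp ℝ 2 μ × Lp ℝ 2 μ') :
    (oneLp μ, oneLp μ') ∈ observationSpace μ μ' y :=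
  Submodule.subset_span (Set.mem_insert _ _)

/-- Adding `c • (1, 1)` to the last observation does not change the span. -/
theorem observationSpace_snoc {n : ℕ} (y : Fin n → Lp ℝ 2 μ × Lp ℝ 2 μ')
    (q : Lp ℝ 2 μ × Lp ℝ 2 μ') (c : ℝ) :
    observationSpace μ μ' (Fin.snoc (α := fun _ => Lp ℝ 2 μ × Lp ℝ 2 μ') y
      (q - c • (oneLp μ, oneLp μ'))) =
      observationSpace μ μ' y ⊔ Submodule.span ℝ {q} := by
  have h1 : observationSpace μ μ' (Fin.snoc (α := fun _ => Lp ℝ 2 μ × Lp ℝ 2 μ') y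
      (q - c • (oneLp μ, oneLp μ'))) =
      observationSpace μ μ' y ⊔ Submodule.span ℝ {q - c • (oneLp μ, oneLp μ')} := by
    rw [observationSpace, observationSpace, Fin.range_snoc, Set.insert_comm,
      Submodule.span_insert, sup_comm]
  rw [h1]
  have hc := Submodule.smul_mem _ c (mk_mem_observationSpace (μ := μ) (μ' := μ') y)
  refine le_antisymm (sup_le le_sup_left ?_) (sup_le le_sup_left ?_) <;>
    rw [Submodule.span_singleton_le_iff_mem]
  · exact Submodule.sub_mem _ (Submodule.mem_sup_right (Submodule.mem_span_singleton_self q))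
      (Submodule.mem_sup_left hc)
  · have h2 := Submodule.add_mem
      (observationSpace μ μ' y ⊔ Submodule.span ℝ {q - c • (oneLp μ, oneLp μ')})
      (Submodule.mem_sup_right (Submodule.mem_span_singleton_self _))
      (Submodule.mem_sup_left hc)
    rwa [sub_add_cancel] at h2

end Span

variable {X : Type*} [MetricSpace X] [MeasurableSpace X] {ν : Measure X}
  [MeasurableSpace (Lp ℝ 2 ν)] {μ μ' : Measure (Lp ℝ 2 ν)} {m m' : Lp ℝ 2 ν}

section Finite

variable [IsFiniteMeasure μ]

theorem isAdmissible_of_forall_exists {z : ∀ n : ℕ, Fin n → Lp ℝ 2 μ}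
    (hmem : ∀ n j, z n j ∈ centredSpace μ m) (hind : ∀ n, LinearIndependent ℝ (z n))
    (h : ∀ p ∈ fullSpace μ m, ∀ η > 0, ∀ᶠ n in atTop,
      ∃ v ∈ Submodule.span ℝ (insert (oneLp μ) (Set.range (z n))), ‖p - v‖ ≤ η) :
    IsAdmissible μ m z where
  mem := hmem
  indep := hind
  consistent := fun p hp g hg => by
    have h1 : Tendsto (fun n => g n - p) atTop (𝓝 0) := by
      refine squeeze_zero_norm' (a := fun n => ‖g n - p‖) (Eventually.of_forall fun _ => le_rfl)
        (Metric.tendsto_atTop'.2 fun ε hε => ?_)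
      obtain ⟨N, hN⟩ := eventually_atTop.1 (h p hp (ε / 2) (by positivity))
      refine ⟨N, fun n hn => ?_⟩
      obtain ⟨v, hv, hvp⟩ := hN n hn.le
      rw [dist_zero_right, norm_norm]
      exact (norm_sub_le_of_isBestPredictor (hg n) hv).trans_lt (hvp.trans_lt (half_lt_self hε))
    simp only [secondMoment_eq]
    have h2 := ENNReal.tendsto_ofReal (h1.norm.pow 2)
    simpa using h2

theorem IsAdmissible.eventually_exists {z : ∀ n : ℕ, Fin n → Lp ℝ 2 μ} (hz : IsAdmissible μ m z)
    {p : Lp ℝ 2 μ} (hp : p ∈ fullSpace μ m) {η : ℝ} (hη : 0 < η) :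
    ∀ᶠ n in atTop,
      ∃ v ∈ Submodule.span ℝ (insert (oneLp μ) (Set.range (z n))), ‖p - v‖ ≤ η := by
  set V : ℕ → Submodule ℝ (Lp ℝ 2 μ) :=
    fun n => Submodule.span ℝ (insert (oneLp μ) (Set.range (z n)))
  have hV : ∀ n, FiniteDimensional ℝ (V n) := fun n =>
    FiniteDimensional.span_of_finite ℝ ((Set.finite_range _).insert _)
  have h := hz.consistent p hp (fun n => (V n).starProjection p) fun n =>
    isBestPredictor_iff.2 ⟨(V n).starProjection_apply_mem p, fun f hf => by
      rw [← neg_sub, inner_neg_right, neg_eq_zero]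
      exact (V n).sub_starProjection_mem_orthogonal p f hf⟩
  simp only [secondMoment_eq] at h
  filter_upwards [h.eventually_lt_const (u := ENNReal.ofReal (η ^ 2))
    (ENNReal.ofReal_pos.2 (by positivity))] with n hn
  refine ⟨_, (V n).starProjection_apply_mem p, ?_⟩
  rw [ENNReal.ofReal_lt_ofReal_iff (by positivity)] at hn
  rw [norm_sub_rev]
  exact (lt_of_pow_lt_pow_left₀ 2 hη.le hn).le

end Finite

variable [BorelSpace (Lp ℝ 2 ν)] [IsGaussian μ] [IsGaussian μ'] {C C' : Lp ℝ 2 ν →L[ℝ] Lp ℝ 2 ν}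

theorem IsObservationSequence.observationSpace_le
    (hM : FieldModel C C' (m' - m) (oneLp μ) (oneLp μ') (centredLp μ m) (centredLp μ' m')
      (commonRel μ μ' m m'))
    {y : ∀ n : ℕ, Fin n → Lp ℝ 2 μ × Lp ℝ 2 μ'} (hy : IsObservationSequence μ μ' m y) (n : ℕ) :
    observationSpace μ μ' (y n) ≤ commonRel μ μ' m m' := by
  refine Submodule.span_le.2 (Set.insert_subset hM.mk_mem ?_)
  rintro _ ⟨j, rfl⟩
  exact mem_commonRel.2 (hy.1 n j)

variable [CompactSpace X] [BorelSpace X] [IsFiniteMeasure ν]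
  [ν.IsOpenPosMeasure] {ϱ : C(X × X, ℝ)}

theorem isObservationSequence_of_forall_exists (hμ : IsNormal μ m (covOp ν ϱ))
    {y : ∀ n : ℕ, Fin n → Lp ℝ 2 μ × Lp ℝ 2 μ'}
    (hmem : ∀ n j, y n j ∈ commonRel μ μ' m m') (h0 : ∀ n j, ⟪oneLp μ, (y n j).1⟫ = 0)
    (hind : ∀ n, LinearIndependent ℝ fun j => (y n j).1)
    (h : ∀ p ∈ commonRel μ μ' m m', ∀ η > 0, ∀ᶠ n in atTop,
      ∃ v ∈ observationSpace μ μ' (y n), ‖p.1 - v.1‖ ≤ η) :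
    IsObservationSequence μ μ' m y := by
  have hfull := fullSpace_eq (μ' := μ') (m' := m') hμ
  refine ⟨fun n j => mem_commonRel.1 (hmem n j), isAdmissible_of_forall_exists (fun n j =>
    mem_centredSpace_of_mem_fullSpace hμ ?_ (h0 n j)) hind fun p hp η hη => ?_⟩
  · rw [hfull]
    exact Submodule.le_topologicalClosure _ ⟨_, hmem n j, rfl⟩
  · rw [hfull] at hp
    obtain ⟨_, ⟨q, hq, rfl⟩, hqp⟩ := Metric.mem_closure_iff.1 hp (η / 2) (by positivity)
    filter_upwards [h q hq (η / 2) (by positivity)] with n hn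
    obtain ⟨v, hv, hvq⟩ := hn
    refine ⟨v.1, map_fst_observationSpace (y n) ▸ ⟨v, hv, rfl⟩, ?_⟩
    rw [dist_eq_norm] at hqp
    calc ‖p - v.1‖ ≤ ‖p - q.1‖ + ‖q.1 - v.1‖ := norm_sub_le_norm_sub_add_norm_sub _ _ _
      _ ≤ η / 2 + η / 2 := add_le_add hqp.le hvq
      _ = η := add_halves η

theorem IsObservationSequence.eventually_exists (hμ : IsNormal μ m (covOp ν ϱ))
    {y : ∀ n : ℕ, Fin n → Lp ℝ 2 μ × Lp ℝ 2 μ'} (hy : IsObservationSequence μ μ' m y)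
    {p : Lp ℝ 2 μ × Lp ℝ 2 μ'} (hp : p ∈ commonRel μ μ' m m') {η : ℝ} (hη : 0 < η) :
    ∀ᶠ n in atTop, ∃ v ∈ observationSpace μ μ' (y n), ‖p.1 - v.1‖ ≤ η := by
  have hp1 : p.1 ∈ fullSpace μ m := by
    rw [fullSpace_eq (μ' := μ') (m' := m') hμ]
    exact Submodule.le_topologicalClosure _ ⟨p, hp, rfl⟩
  filter_upwards [hy.2.eventually_exists hp1 hη] with n hn
  obtain ⟨v, hv, hvp⟩ := hn
  rw [← map_fst_observationSpace (y n)] at hv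
  obtain ⟨u, hu, rfl⟩ := hv
  exact ⟨u, hu, hvp⟩

theorem isObservationSequence_seq (hμ : IsNormal μ m (covOp ν ϱ))
    (hM : FieldModel C C' (m' - m) (oneLp μ) (oneLp μ') (centredLp μ m) (centredLp μ' m')
      (commonRel μ μ' m m')) {w : ℕ → Lp ℝ 2 ν} (hw : LinearIndependent ℝ w)
    (hwd : (Submodule.span ℝ (Set.range w)).topologicalClosure = ⊤) :
    IsObservationSequence μ μ' m fun n (j : Fin n) =>
      modelMap (oneLp μ) (oneLp μ') (centredLp μ m) (centredLp μ' m') (m' - m) (0, w j) := by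
  refine isObservationSequence_of_forall_exists (m' := m') hμ
    (fun n j => hM.range_le ⟨_, rfl⟩) (fun n j => ?_) (fun n => ?_)
    fun p hp η hη => hM.exists_mem_seqSpace hwd hp hη
  · simpa [modelMap] using hM.inner_o (w j)
  · have := (hw.comp (fun j : Fin n => (j : ℕ)) Fin.val_injective).map' (centredLp μ m)
      (LinearMap.ker_eq_bot.2 hM.i_injective)
    simpa [modelMap, Function.comp_def] using this

/-- Further admissible observations are obtained by adding to the first `n` standard observations
any functional `f n` that is not a linear combination of them and the constants. -/
theorem exists_isObservationSequence_sup (hμ : IsNormal μ m (covOp ν ϱ))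
    (hM : FieldModel C C' (m' - m) (oneLp μ) (oneLp μ') (centredLp μ m) (centredLp μ' m')
      (commonRel μ μ' m m')) {w : ℕ → Lp ℝ 2 ν} (hw : LinearIndependent ℝ w)
    (hwd : (Submodule.span ℝ (Set.range w)).topologicalClosure = ⊤)
    {W : ℕ → Submodule ℝ (Lp ℝ 2 μ × Lp ℝ 2 μ')}
    (hW : W = seqSpace (oneLp μ) (oneLp μ') (centredLp μ m) (centredLp μ' m') (m' - m) w)
    {f : ℕ → Lp ℝ 2 μ × Lp ℝ 2 μ'} (hf : ∀ n, f n ∈ commonRel μ μ' m m')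
    (hfW : ∀ n, (f n).1 ∉ (W n).map (LinearMap.fst ℝ (Lp ℝ 2 μ) (Lp ℝ 2 μ'))) :
    ∃ y : ∀ n : ℕ, Fin n → Lp ℝ 2 μ × Lp ℝ 2 μ', IsObservationSequence μ μ' m y ∧
      ∀ n, observationSpace μ μ' (y (n + 1)) = W n ⊔ Submodule.span ℝ {f n} := by
  have hstd := isObservationSequence_seq hμ hM hw hwd
  set b : ∀ n : ℕ, Fin n → Lp ℝ 2 μ × Lp ℝ 2 μ' := fun n j =>
    modelMap (oneLp μ) (oneLp μ') (centredLp μ m) (centredLp μ' m') (m' - m) (0, w j) with hb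
  have hWb : ∀ n, W n = observationSpace μ μ' (b n) := fun n => hW ▸ rfl
  set y : ∀ n : ℕ, Fin n → Lp ℝ 2 μ × Lp ℝ 2 μ' := fun n => match n with
    | 0 => Fin.elim0
    | n + 1 => Fin.snoc (α := fun _ => Lp ℝ 2 μ × Lp ℝ 2 μ') (b n)
        (f n - ⟪oneLp μ, (f n).1⟫ • (oneLp μ, oneLp μ')) with hy
  have hspan : ∀ n, observationSpace μ μ' (y (n + 1)) = W n ⊔ Submodule.span ℝ {f n} := fun n => by
    rw [hWb]
    exact observationSpace_snoc _ _ _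
  refine ⟨y, isObservationSequence_of_forall_exists (m' := m') hμ (fun n j => ?_) (fun n j => ?_)
    (fun n => ?_) (fun p hp η hη => ?_), hspan⟩
  · obtain _ | n := n
    · exact j.elim0
    · refine Fin.lastCases ?_ (fun k => ?_) j
      · simp only [hy, Fin.snoc_last]
        exact Submodule.sub_mem _ (hf n) (Submodule.smul_mem _ _ hM.mk_mem)
      · simp only [hy, Fin.snoc_castSucc]
        exact mem_commonRel.2 (hstd.1 n k)
  · obtain _ | n := n
    · exact j.elim0
    · refine Fin.lastCases ?_ (fun k => ?_) j
      · simp only [hy, Fin.snoc_last]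
        simp [inner_sub_right, inner_smul_right, norm_oneLp]
      · simp only [hy, Fin.snoc_castSucc]
        simpa [hb, modelMap] using hM.inner_o (w k)
  · obtain _ | n := n
    · exact linearIndependent_empty_type
    · have h1 : (fun j => (y (n + 1) j).1) = Fin.snoc (α := fun _ => Lp ℝ 2 μ)
          (fun j => (b n j).1) ((f n).1 - ⟪oneLp μ, (f n).1⟫ • oneLp μ) := by
        funext j
        refine Fin.lastCases ?_ (fun k => ?_) j
        · simp only [hy, Fin.snoc_last]
          rfl
        · simp only [hy, Fin.snoc_castSucc]
      rw [h1]
      refine LinearIndependent.finSnoc (hstd.2.indep n) fun hmem => hfW n ?_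
      rw [hWb, map_fst_observationSpace]
      rw [← sub_add_cancel (f n).1 (⟪oneLp μ, (f n).1⟫ • oneLp μ)]
      exact Submodule.add_mem _ (Submodule.span_mono (Set.subset_insert _ _) hmem)
        (Submodule.smul_mem _ _ (Submodule.subset_span (Set.mem_insert _ _)))
  · have h1 := (tendsto_sub_atTop_nat 1).eventually (hstd.eventually_exists (m' := m') hμ hp hη)
    filter_upwards [h1, eventually_ge_atTop 1] with n hn hn1
    obtain ⟨k, rfl⟩ := Nat.exists_eq_add_of_le' hn1
    rw [Nat.add_sub_cancel] at hn
    obtain ⟨v, hv, hvp⟩ := hn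
    refine ⟨v, ?_, hvp⟩
    rw [hspan, hWb]
    exact Submodule.mem_sup_left hv

/-- A property of the spaces of observations that eventually holds along every admissible sequence
holds, for large `n`, on the standard spaces `W n`, and uniformly on their extensions by one
further functional. -/
theorem eventually_of_forall_isObservationSequence (hμ : IsNormal μ m (covOp ν ϱ))
    (hM : FieldModel C C' (m' - m) (oneLp μ) (oneLp μ') (centredLp μ m) (centredLp μ' m')
      (commonRel μ μ' m m')) {w : ℕ → Lp ℝ 2 ν} (hw : LinearIndependent ℝ w)
    (hwd : (Submodule.span ℝ (Set.range w)).topologicalClosure = ⊤)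
    {W : ℕ → Submodule ℝ (Lp ℝ 2 μ × Lp ℝ 2 μ')}
    (hW : W = seqSpace (oneLp μ) (oneLp μ') (centredLp μ m) (centredLp μ' m') (m' - m) w)
    (hinf : ¬ FiniteDimensional ℝ
      ((commonRel μ μ' m m').map (LinearMap.fst ℝ (Lp ℝ 2 μ) (Lp ℝ 2 μ'))))
    {Q : Submodule ℝ (Lp ℝ 2 μ × Lp ℝ 2 μ') → Prop}
    (hQ : ∀ y, IsObservationSequence μ μ' m y →
      ∀ᶠ n in atTop, Q (observationSpace μ μ' (y n))) :
    (∀ᶠ n in atTop, Q (W n)) ∧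
      ∀ᶠ n in atTop, ∀ q ∈ commonRel μ μ' m m',
        q.1 ∉ (W n).map (LinearMap.fst ℝ (Lp ℝ 2 μ) (Lp ℝ 2 μ')) →
          Q (W n ⊔ Submodule.span ℝ {q}) := by
  refine ⟨by subst hW; exact hQ _ (isObservationSequence_seq hμ hM hw hwd), ?_⟩
  -- choose for every `n` an extension that violates `Q`, if there is one
  have hf : ∀ n, ∃ f ∈ commonRel μ μ' m m',
      f.1 ∉ (W n).map (LinearMap.fst ℝ (Lp ℝ 2 μ) (Lp ℝ 2 μ')) ∧
        (Q (W n ⊔ Submodule.span ℝ {f}) → ∀ q ∈ commonRel μ μ' m m',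
          q.1 ∉ (W n).map (LinearMap.fst ℝ (Lp ℝ 2 μ) (Lp ℝ 2 μ')) →
            Q (W n ⊔ Submodule.span ℝ {q})) := fun n => by
    by_cases h : ∃ f ∈ commonRel μ μ' m m',
        f.1 ∉ (W n).map (LinearMap.fst ℝ (Lp ℝ 2 μ) (Lp ℝ 2 μ')) ∧
          ¬ Q (W n ⊔ Submodule.span ℝ {f})
    · obtain ⟨f, hf, hfW, hfQ⟩ := h
      exact ⟨f, hf, hfW, fun h => absurd h hfQ⟩
    · have : FiniteDimensional ℝ (W n) := by subst hW; infer_instance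
      obtain ⟨f, hf, hfW⟩ := exists_notMem_map_fst hinf (W n)
      refine ⟨f, hf, hfW, fun _ q hq hqW => ?_⟩
      by_contra hqQ
      exact h ⟨q, hq, hqW, hqQ⟩
  choose f hf hfW hfQ using hf
  obtain ⟨y, hy, hspan⟩ := exists_isObservationSequence_sup hμ hM hw hwd hW hf hfW
  filter_upwards [(tendsto_add_atTop_nat 1).eventually (hQ y hy)] with n hn
  rw [hspan] at hn
  exact hfQ n hn

end Observations

/-! ### The assertions in terms of real inequalities -/

section Ratios

theorem ofReal_div_ofReal_le_iff {p q c : ℝ} (hq : 0 ≤ q) (hc : 0 ≤ c) :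
    ENNReal.ofReal p / ENNReal.ofReal q ≤ ENNReal.ofReal c ↔ p ≤ c * q := by
  rw [ENNReal.div_le_iff_le_mul (Or.inr ENNReal.ofReal_ne_top) (Or.inl ENNReal.ofReal_ne_top),
    ← ENNReal.ofReal_mul hc, ENNReal.ofReal_le_ofReal_iff (mul_nonneg hc hq)]

/-- The case `p = q = 0` has to be excluded, since the ratio is then `0`. -/
theorem absDiff_ofReal_div_le_iff {p q a δ : ℝ} (hp : 0 ≤ p) (hq : 0 ≤ q) (hpq : 0 < p ∨ 0 < q)
    (ha : 0 ≤ a) (hδ : 0 ≤ δ) :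
    absDiff (ENNReal.ofReal p / ENNReal.ofReal q) (ENNReal.ofReal a) ≤ ENNReal.ofReal δ ↔
      |p - a * q| ≤ δ * q := by
  obtain rfl | hq' := hq.eq_or_lt
  · have hp' : 0 < p := hpq.resolve_right (lt_irrefl 0)
    rw [ENNReal.ofReal_zero, ENNReal.div_zero (ENNReal.ofReal_pos.2 hp').ne', absDiff,
      ENNReal.top_sub ENNReal.ofReal_ne_top, max_eq_left le_top, top_le_iff]
    simpa using hp'.ne'
  · have h1 : |p - a * q| = |p / q - a| * q := by
      rw [← abs_of_pos hq', ← abs_mul, abs_of_pos hq', sub_mul, div_mul_cancel₀ _ hq'.ne']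
    rw [← ENNReal.ofReal_div_of_pos hq', absDiff, ← ENNReal.ofReal_sub _ ha,
      ← ENNReal.ofReal_sub _ (by positivity), max_le_iff, ENNReal.ofReal_le_ofReal_iff hδ,
      ENNReal.ofReal_le_ofReal_iff hδ, h1, mul_le_mul_iff_left₀ hq', abs_le']
    simp

theorem tendsto_nhds_zero_iff_ofReal {s : ℕ → ℝ≥0∞} :
    Tendsto s atTop (𝓝 0) ↔ ∀ δ > 0, ∀ᶠ n in atTop, s n ≤ ENNReal.ofReal δ := by
  rw [ENNReal.tendsto_nhds_zero]
  refine ⟨fun h δ hδ => h _ (ENNReal.ofReal_pos.2 hδ), fun h ε hε => ?_⟩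
  obtain rfl | hε' := eq_or_ne ε ⊤
  · simp
  · rw [← ENNReal.ofReal_toReal hε']
    exact h _ (ENNReal.toReal_pos hε.ne' hε')

theorem eventually_le_ofReal_of_tendsto_one {s : ℕ → ℝ≥0∞} (h : Tendsto s atTop (𝓝 1)) {δ : ℝ}
    (hδ : 0 < δ) : ∀ᶠ n in atTop, s n ≤ ENNReal.ofReal (1 + δ) := by
  refine h.eventually_le_const ?_
  rw [← ENNReal.ofReal_one, ENNReal.ofReal_lt_ofReal_iff (by linarith)]
  linarith

theorem tendsto_nhds_one_of_ofReal {s : ℕ → ℝ≥0∞} (h1 : ∀ n, 1 ≤ s n)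
    (h : ∀ δ > 0, ∀ᶠ n in atTop, s n ≤ ENNReal.ofReal (1 + δ)) : Tendsto s atTop (𝓝 1) := by
  refine tendsto_order.2 ⟨fun c hc => Eventually.of_forall fun n => hc.trans_le (h1 n),
    fun c hc => ?_⟩
  obtain ⟨r, hr1, hrc⟩ := ENNReal.lt_iff_exists_nnreal_btwn.1 hc
  have hr : (1 : ℝ) < r := by exact_mod_cast hr1
  filter_upwards [h (r - 1) (by linarith)] with n hn
  rw [add_sub_cancel, ENNReal.ofReal_coe_nnreal] at hn
  exact hn.trans_lt hrc

theorem one_le_ofReal_div_ofReal {p q : ℝ} (hq : 0 < q) (h : q ≤ p) :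
    1 ≤ ENNReal.ofReal p / ENNReal.ofReal q := by
  rw [← ENNReal.ofReal_div_of_pos hq, ← ENNReal.ofReal_one]
  exact ENNReal.ofReal_le_ofReal ((one_le_div hq).2 h)

end Ratios

section Assertions

variable {X : Type*} [MeasurableSpace X] {ν : Measure X} [MeasurableSpace (Lp ℝ 2 ν)]
  [BorelSpace (Lp ℝ 2 ν)] {μ μ' : Measure (Lp ℝ 2 ν)} [IsGaussian μ] [IsGaussian μ']
  {m m' : Lp ℝ 2 ν} {y : ∀ n : ℕ, Fin n → Lp ℝ 2 μ × Lp ℝ 2 μ'} {a : ℝ}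

theorem Efficient.eventually_effBound (hy : Efficient μ μ' y)
    (hD : ∀ n, observationSpace μ μ' (y n) ≤ commonRel μ μ' m m') {δ : ℝ} (hδ : 0 < δ) :
    ∀ᶠ n in atTop, EffBound (commonRel μ μ' m m') δ (observationSpace μ μ' (y n)) := by
  filter_upwards [eventually_le_ofReal_of_tendsto_one hy hδ] with n hn e he
  rw [errorPairs_eq (hD n)] at hn
  have := iSup₂_le_iff.1 hn e he
  rwa [secondMoment_eq, secondMoment_eq,
    ofReal_div_ofReal_le_iff (sq_nonneg _) (by linarith)] at this

theorem Efficient'.eventually_effBound (hy : Efficient' μ μ' y)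
    (hD : ∀ n, observationSpace μ μ' (y n) ≤ commonRel μ μ' m m') {δ : ℝ} (hδ : 0 < δ) :
    ∀ᶠ n in atTop, EffBound' (commonRel μ μ' m m') δ (observationSpace μ μ' (y n)) := by
  filter_upwards [eventually_le_ofReal_of_tendsto_one hy hδ] with n hn e he
  rw [errorPairs_eq (hD n)] at hn
  have := iSup₂_le_iff.1 hn e he
  rwa [secondMoment_eq, secondMoment_eq,
    ofReal_div_ofReal_le_iff (sq_nonneg _) (by linarith)] at this

theorem efficient_of_eventually (hD : ∀ n, observationSpace μ μ' (y n) ≤ commonRel μ μ' m m')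
    (hne : ∀ n, (errorRel (commonRel μ μ' m m') (observationSpace μ μ' (y n))).Nonempty)
    (h : ∀ δ > 0, ∀ᶠ n in atTop,
      EffBound (commonRel μ μ' m m') δ (observationSpace μ μ' (y n))) :
    Efficient μ μ' y := by
  refine tendsto_nhds_one_of_ofReal (fun n => ?_) fun δ hδ => ?_
  · obtain ⟨e, he⟩ := hne n
    rw [errorPairs_eq (hD n)]
    refine le_trans ?_ (le_iSup₂ e he)
    rw [secondMoment_eq, secondMoment_eq]
    have : 0 < ‖e.1.1‖ := norm_pos_iff.2 he.2.2.2.2.2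
    exact one_le_ofReal_div_ofReal (by positivity) (norm_fst_le_of_mem_errorRel he)
  · filter_upwards [h δ hδ] with n hn
    rw [errorPairs_eq (hD n)]
    refine iSup₂_le fun e he => ?_
    rw [secondMoment_eq, secondMoment_eq, ofReal_div_ofReal_le_iff (sq_nonneg _) (by linarith)]
    exact hn e he

theorem fst_ne_zero_of_mem_errorRel {H H' : Type*} [NormedAddCommGroup H] [InnerProductSpace ℝ H]
    [NormedAddCommGroup H'] [InnerProductSpace ℝ H'] {D V : Submodule ℝ (H × H')}
    {e : (H × H') × (H × H')} (he : e ∈ errorRel D V) : e.2.1 ≠ 0 := fun h => by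
  have := norm_fst_le_of_mem_errorRel he
  rw [h, norm_zero] at this
  exact he.2.2.2.2.2 (norm_eq_zero.1 (pow_eq_zero_iff two_ne_zero |>.1
    (le_antisymm (by simpa using this) (sq_nonneg _))))

theorem efficient'_of_eventually (hD : ∀ n, observationSpace μ μ' (y n) ≤ commonRel μ μ' m m')
    (hne : ∀ n, (errorRel (commonRel μ μ' m m') (observationSpace μ μ' (y n))).Nonempty)
    (hDa : AsympConformal (commonRel μ μ' m m') a)
    (h : ∀ δ > 0, ∀ᶠ n in atTop,
      EffBound' (commonRel μ μ' m m') δ (observationSpace μ μ' (y n))) :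
    Efficient' μ μ' y := by
  refine tendsto_nhds_one_of_ofReal (fun n => ?_) fun δ hδ => ?_
  · obtain ⟨e, he⟩ := hne n
    obtain ⟨R, hR⟩ := hDa.left
    rw [errorPairs_eq (hD n)]
    refine le_trans ?_ (le_iSup₂ e he)
    rw [secondMoment_eq, secondMoment_eq]
    have : 0 < ‖e.2.2‖ := norm_pos_iff.2 fun h0 =>
      fst_ne_zero_of_mem_errorRel he (by rw [hR _ he.2.1, h0, map_zero])
    exact one_le_ofReal_div_ofReal (by positivity) (norm_snd_le_of_mem_errorRel he)
  · filter_upwards [h δ hδ] with n hn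
    rw [errorPairs_eq (hD n)]
    refine iSup₂_le fun e he => ?_
    rw [secondMoment_eq, secondMoment_eq, ofReal_div_ofReal_le_iff (sq_nonneg _) (by linarith)]
    exact hn e he

theorem errorRatio_iff (hD : ∀ n, observationSpace μ μ' (y n) ≤ commonRel μ μ' m m')
    (ha : 0 < a) :
    ErrorRatio μ μ' a y ↔ ∀ δ > 0, ∀ᶠ n in atTop,
      RatioBound (commonRel μ μ' m m') a δ (observationSpace μ μ' (y n)) := by
  rw [ErrorRatio, tendsto_nhds_zero_iff_ofReal]
  refine forall₂_congr fun δ hδ => eventually_congr (Eventually.of_forall fun n => ?_)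
  rw [errorPairs_eq (hD n), iSup₂_le_iff]
  refine forall₂_congr fun e he => ?_
  have : 0 < ‖e.1.1‖ := norm_pos_iff.2 he.2.2.2.2.2
  rw [secondMoment_eq, secondMoment_eq, absDiff_ofReal_div_le_iff (sq_nonneg _) (sq_nonneg _)
    (Or.inr (by positivity)) ha.le hδ.le]

theorem errorRatio'_iff (hD : ∀ n, observationSpace μ μ' (y n) ≤ commonRel μ μ' m m')
    (ha : 0 < a) :
    ErrorRatio' μ μ' a y ↔ ∀ δ > 0, ∀ᶠ n in atTop,
      RatioBound' (commonRel μ μ' m m') a δ (observationSpace μ μ' (y n)) := by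
  rw [ErrorRatio', tendsto_nhds_zero_iff_ofReal]
  refine forall₂_congr fun δ hδ => eventually_congr (Eventually.of_forall fun n => ?_)
  rw [errorPairs_eq (hD n), iSup₂_le_iff]
  refine forall₂_congr fun e he => ?_
  have : 0 < ‖e.2.1‖ := norm_pos_iff.2 (fst_ne_zero_of_mem_errorRel he)
  rw [secondMoment_eq, secondMoment_eq, absDiff_ofReal_div_le_iff (sq_nonneg _) (sq_nonneg _)
    (Or.inl (by positivity)) (by positivity) hδ.le]

end Assertions

/-! ### Characterization of asymptotic efficiency -/

section Conformal

variable {X : Type*} [MeasurableSpace X] {ν : Measure X} [MeasurableSpace (Lp ℝ 2 ν)]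
  [BorelSpace (Lp ℝ 2 ν)] {μ μ' : Measure (Lp ℝ 2 ν)} [IsGaussian μ] [IsGaussian μ']
  {m m' : Lp ℝ 2 ν} {C C' : Lp ℝ 2 ν →L[ℝ] Lp ℝ 2 ν} {a : ℝ}

/-- A bounded operator that maps `1` to `1` preserves constants. -/
theorem varianceCompatible_of_asympConformal
    (hM : FieldModel C C' (m' - m) (oneLp μ) (oneLp μ') (centredLp μ m)
      (centredLp μ' m') (commonRel μ μ' m m'))
    (hDa : AsympConformal (commonRel μ μ' m m') a) : VarianceCompatible μ μ' := by
  intro p hp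
  obtain ⟨T, hT⟩ := hDa.right
  obtain ⟨R, hR⟩ := hDa.left
  have hTo : oneLp μ' = T (oneLp μ) := hT _ hM.mk_mem
  have hRo : oneLp μ = R (oneLp μ') := hR _ hM.mk_mem
  rw [← mem_commonRel (m := m) (m' := m')] at hp
  rw [variance_eq_zero_iff_exists, variance_eq_zero_iff_exists]
  refine exists_congr fun c => ⟨fun h => ?_, fun h => ?_⟩
  · rw [hT p hp, h, map_smul, ← hTo]
  · rw [hR p hp, h, map_smul, ← hRo]

theorem assumptions_iff_asympConformal
    (hM : FieldModel C C' (m' - m) (oneLp μ) (oneLp μ') (centredLp μ m)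
      (centredLp μ' m') (commonRel μ μ' m m')) :
    (AssumptionI C C' ∧ AssumptionII C m m' ∧
      AssumptionIII C C' a) ↔ AsympConformal (commonRel μ μ' m m') a := by
  have hII : AssumptionII C m m' ↔ m' - m ∈ cameronMartin C := by
    rw [AssumptionII, ← neg_sub, neg_mem_iff]
  rw [hII]
  exact ⟨fun h => hM.asympConformal_of_assumptions h.1 h.2.1 h.2.2,
    fun h => hM.assumptions_of_asympConformal h⟩

end Conformal

section Characterization

variable {X : Type*} [MetricSpace X] [CompactSpace X] [MeasurableSpace X] [BorelSpace X]
  {ν : Measure X} [IsFiniteMeasure ν] [ν.IsOpenPosMeasure]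
  [MeasurableSpace (Lp ℝ 2 ν)] [BorelSpace (Lp ℝ 2 ν)] {μ μ' : Measure (Lp ℝ 2 ν)}
  [IsGaussian μ] [IsGaussian μ'] {m m' : Lp ℝ 2 ν} {ϱ : C(X × X, ℝ)}
  {C' : Lp ℝ 2 ν →L[ℝ] Lp ℝ 2 ν} {a : ℝ}

theorem existsUnique_mk_mem_commonFunctionals (hμ : IsNormal μ m (covOp ν ϱ))
    (hM : FieldModel (covOp ν ϱ) C' (m' - m) (oneLp μ) (oneLp μ') (centredLp μ m)
      (centredLp μ' m') (commonRel μ μ' m m'))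
    (hI : AssumptionI (covOp ν ϱ) C') (hII : m' - m ∈ cameronMartin (covOp ν ϱ)) {h : Lp ℝ 2 μ}
    (hh : h ∈ fullSpace μ m) : ∃! h' : Lp ℝ 2 μ', (h, h') ∈ commonFunctionals μ μ' := by
  obtain ⟨T, hT⟩ := hM.exists_operator hI hII
  rw [fullSpace_eq (μ' := μ') (m' := m') hμ] at hh
  exact ⟨T h, mem_commonRel.1 (mk_mem_of_mem_closure hM.isClosed hT hh),
    fun h' hh' => hT _ (mem_commonRel.2 hh')⟩

section Sufficiency

variable {y : ∀ n : ℕ, Fin n → Lp ℝ 2 μ × Lp ℝ 2 μ'}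

theorem eventually_ratioBound_of_asympConformal (hμ : IsNormal μ m (covOp ν ϱ))
    (hM : FieldModel (covOp ν ϱ) C' (m' - m) (oneLp μ) (oneLp μ') (centredLp μ m)
      (centredLp μ' m') (commonRel μ μ' m m'))
    (ha : 0 < a) (hDa : AsympConformal (commonRel μ μ' m m') a)
    (hy : IsObservationSequence μ μ' m y) {δ : ℝ} (hδ : 0 < δ) :
    ∀ᶠ n in atTop, RatioBound (commonRel μ μ' m m') a δ (observationSpace μ μ' (y n)) ∧
      RatioBound' (commonRel μ μ' m m') a δ (observationSpace μ μ' (y n)) :=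
  (hDa.eventually_ratioBound hM.isClosed ha
    (fun _ hp _ hη => hy.eventually_exists hμ hp hη) hδ).and
  (hDa.eventually_ratioBound' hM.isClosed ha (hy.observationSpace_le hM)
    (fun _ hp _ hη => hy.eventually_exists hμ hp hη) hδ)

theorem eventually_effBound_of_asympConformal (hμ : IsNormal μ m (covOp ν ϱ))
    (hM : FieldModel (covOp ν ϱ) C' (m' - m) (oneLp μ) (oneLp μ') (centredLp μ m)
      (centredLp μ' m') (commonRel μ μ' m m'))
    (ha : 0 < a) (hDa : AsympConformal (commonRel μ μ' m m') a)
    (hy : IsObservationSequence μ μ' m y) {δ : ℝ} (hδ : 0 < δ) :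
    ∀ᶠ n in atTop, EffBound (commonRel μ μ' m m') δ (observationSpace μ μ' (y n)) ∧
      EffBound' (commonRel μ μ' m m') δ (observationSpace μ μ' (y n)) := by
  obtain ⟨η, hη, hηδ⟩ := exists_pos_mul_le ha hδ
  filter_upwards [eventually_ratioBound_of_asympConformal hμ hM ha hDa hy hη] with n hn
  exact effBound_of_ratioBound ha hη hηδ hn.1 hn.2

end Sufficiency

theorem asympConformal_of_errorRatio (hμ : IsNormal μ m (covOp ν ϱ))
    (hM : FieldModel (covOp ν ϱ) C' (m' - m) (oneLp μ) (oneLp μ') (centredLp μ m)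
      (centredLp μ' m') (commonRel μ μ' m m'))
    (hE : ¬ FiniteDimensional ℝ (Lp ℝ 2 ν)) (ha : 0 < a) (hV : VarianceCompatible μ μ')
    (h : ∀ y, IsObservationSequence μ μ' m y → ErrorRatio μ μ' a y) :
    AsympConformal (commonRel μ μ' m m') a := by
  have := separableSpace_Lp ν
  obtain ⟨w, hw, hwd⟩ := exists_linearIndependent_seq hE
  have hy := isObservationSequence_seq hμ hM hw hwd
  have hyD := hy.observationSpace_le hM
  refine asympConformal_of_ratioBound (o := oneLp μ) (o' := oneLp μ') hM.isClosed
    (hM.not_finiteDimensional_map_fst hE)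
    (norm_ne_zero_iff.1 (by rw [norm_oneLp]; exact one_ne_zero))
    hM.mk_mem (fun p hp => ?_) ha fun δ hδ => ?_
  · rw [← variance_eq_zero_iff_exists, ← variance_eq_zero_iff_exists]
    exact (hV p (mem_commonRel.1 hp)).2
  · obtain ⟨n, hn⟩ := ((errorRatio_iff hyD ha).1 (h _ hy) δ hδ).exists
    exact ⟨_, inferInstance, hyD n, hn⟩

theorem asympConformal_of_errorRatio' (hμ : IsNormal μ m (covOp ν ϱ))
    (hM : FieldModel (covOp ν ϱ) C' (m' - m) (oneLp μ) (oneLp μ') (centredLp μ m)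
      (centredLp μ' m') (commonRel μ μ' m m'))
    (hE : ¬ FiniteDimensional ℝ (Lp ℝ 2 ν)) (ha : 0 < a) (hV : VarianceCompatible μ μ')
    (h : ∀ y, IsObservationSequence μ μ' m y → ErrorRatio' μ μ' a y) :
    AsympConformal (commonRel μ μ' m m') a := by
  have := separableSpace_Lp ν
  obtain ⟨w, hw, hwd⟩ := exists_linearIndependent_seq hE
  have hy := isObservationSequence_seq hμ hM hw hwd
  have hyD := hy.observationSpace_le hM
  refine asympConformal_of_ratioBound' (o := oneLp μ) (o' := oneLp μ') hM.isClosed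
    (hM.not_finiteDimensional_map_fst hE)
    (norm_ne_zero_iff.1 (by rw [norm_oneLp]; exact one_ne_zero))
    (fun p hp => ?_) ha fun δ hδ => ?_
  · rw [← variance_eq_zero_iff_exists, ← variance_eq_zero_iff_exists]
    exact hV p (mem_commonRel.1 hp)
  · obtain ⟨n, hn⟩ := ((errorRatio'_iff hyD ha).1 (h _ hy) δ hδ).exists
    exact ⟨_, inferInstance, hyD n, mk_mem_observationSpace _, hn⟩

theorem exists_asympConformal_of_efficient (hμ : IsNormal μ m (covOp ν ϱ))
    (hM : FieldModel (covOp ν ϱ) C' (m' - m) (oneLp μ) (oneLp μ') (centredLp μ m)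
      (centredLp μ' m') (commonRel μ μ' m m'))
    (hE : ¬ FiniteDimensional ℝ (Lp ℝ 2 ν))
    (h : ∀ y, IsObservationSequence μ μ' m y → Efficient μ μ' y) :
    ∃ a, 0 < a ∧ AsympConformal (commonRel μ μ' m m') a := by
  have := separableSpace_Lp ν
  obtain ⟨w, hw, hwd⟩ := exists_linearIndependent_seq hE
  have hinf := hM.not_finiteDimensional_map_fst hE
  have key := fun δ hδ => eventually_of_forall_isObservationSequence hμ hM hw hwd rfl hinf
    (Q := EffBound (commonRel μ μ' m m') δ)
    fun y hy => (h y hy).eventually_effBound (hy.observationSpace_le hM) hδ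
  exact exists_asympConformal_of_effBound hM.isClosed hinf finiteDimensional_seqSpace hM.seqSpace_le
    (fun n v hv => hM.eq_zero_of_fst_eq_zero (seqSpace_le_range n hv)) monotone_seqSpace
    (fun δ hδ => (key δ hδ).1) fun δ hδ => (key δ hδ).2

theorem exists_asympConformal_of_efficient' (hμ : IsNormal μ m (covOp ν ϱ))
    (hM : FieldModel (covOp ν ϱ) C' (m' - m) (oneLp μ) (oneLp μ') (centredLp μ m)
      (centredLp μ' m') (commonRel μ μ' m m'))
    (hE : ¬ FiniteDimensional ℝ (Lp ℝ 2 ν))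
    (h : ∀ y, IsObservationSequence μ μ' m y → Efficient' μ μ' y) :
    ∃ a, 0 < a ∧ AsympConformal (commonRel μ μ' m m') a := by
  have := separableSpace_Lp ν
  obtain ⟨w, hw, hwd⟩ := exists_linearIndependent_seq hE
  have hinf := hM.not_finiteDimensional_map_fst hE
  have key := fun δ hδ => eventually_of_forall_isObservationSequence hμ hM hw hwd rfl hinf
    (Q := EffBound' (commonRel μ μ' m m') δ)
    fun y hy => (h y hy).eventually_effBound (hy.observationSpace_le hM) hδ
  exact exists_asympConformal_of_effBound' hM.isClosed hinf finiteDimensional_seqSpace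
    hM.seqSpace_le (fun n v hv => hM.eq_zero_of_snd_eq_zero (seqSpace_le_range n hv))
    (fun p hp η hη => hM.exists_mem_seqSpace hwd hp hη)
    (fun δ hδ => (key δ hδ).1) fun δ hδ => (key δ hδ).2

end Characterization

end Kriging

end

theorem mainTheorem1 {X : Type*} [MetricSpace X] [CompactSpace X] [ConnectedSpace X] [Infinite X]
    [MeasurableSpace X] [BorelSpace X]
    (ν : Measure X) [IsFiniteMeasure ν] [ν.IsOpenPosMeasure]
    [MeasurableSpace (Lp ℝ 2 ν)] [BorelSpace (Lp ℝ 2 ν)]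
    (ϱ ϱ' : C(X × X, ℝ))
    (hϱ : Kriging.IsStrictlyPosDef ϱ) (hϱ' : Kriging.IsStrictlyPosDef ϱ')
    (C C' : Lp ℝ 2 ν →L[ℝ] Lp ℝ 2 ν)
    (hC : C = Kriging.covOp ν ϱ) (hC' : C' = Kriging.covOp ν ϱ')
    (hCpos : ∀ w : Lp ℝ 2 ν, w ≠ 0 → 0 < ⟪C w, w⟫)
    (hCpos' : ∀ w : Lp ℝ 2 ν, w ≠ 0 → 0 < ⟪C' w, w⟫)
    (m m' : Lp ℝ 2 ν)
    (μ μ' : Measure (Lp ℝ 2 ν)) [IsProbabilityMeasure μ] [IsProbabilityMeasure μ']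
    (hμ : Kriging.IsNormal μ m C) (hμ' : Kriging.IsNormal μ' m' C') :
    (Kriging.AssumptionI C C' ∧ Kriging.AssumptionII C m m' →
      ∀ h ∈ Kriging.fullSpace μ m, ∃! h' : Lp ℝ 2 μ', (h, h') ∈ Kriging.commonFunctionals μ μ') ∧
    ((∀ y, Kriging.IsObservationSequence μ μ' m y → Kriging.Efficient μ μ' y) ↔
      Kriging.AssumptionI C C' ∧ Kriging.AssumptionII C m m' ∧
        ∃ a : ℝ, 0 < a ∧ Kriging.AssumptionIII C C' a) ∧
    ((∀ y, Kriging.IsObservationSequence μ μ' m y → Kriging.Efficient' μ μ' y) ↔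
      Kriging.AssumptionI C C' ∧ Kriging.AssumptionII C m m' ∧
        ∃ a : ℝ, 0 < a ∧ Kriging.AssumptionIII C C' a) ∧
    (∀ a : ℝ, 0 < a →
      ((Kriging.VarianceCompatible μ μ' ∧
          ∀ y, Kriging.IsObservationSequence μ μ' m y → Kriging.ErrorRatio μ μ' a y) ↔
        Kriging.AssumptionI C C' ∧ Kriging.AssumptionII C m m' ∧
          Kriging.AssumptionIII C C' a)) ∧
    (∀ a : ℝ, 0 < a →
      ((Kriging.VarianceCompatible μ μ' ∧
          ∀ y, Kriging.IsObservationSequence μ μ' m y → Kriging.ErrorRatio' μ μ' a y) ↔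
        Kriging.AssumptionI C C' ∧ Kriging.AssumptionII C m m' ∧
          Kriging.AssumptionIII C C' a)) := by
  subst hC hC'
  have := hμ.gaussian
  have := hμ'.gaussian
  have hM := Kriging.fieldModel_commonRel hμ hμ' hCpos hCpos'
  have hE := Kriging.not_finiteDimensional_Lp ν hϱ
  have hinf := hM.not_finiteDimensional_map_fst hE
  have hiff := fun a => Kriging.assumptions_iff_asympConformal (a := a) hM
  have hex : (Kriging.AssumptionI (Kriging.covOp ν ϱ) (Kriging.covOp ν ϱ') ∧
      Kriging.AssumptionII (Kriging.covOp ν ϱ) m m' ∧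
        ∃ a : ℝ, 0 < a ∧ Kriging.AssumptionIII (Kriging.covOp ν ϱ) (Kriging.covOp ν ϱ') a) ↔
      ∃ a, 0 < a ∧ Kriging.AsympConformal (Kriging.commonRel μ μ' m m') a := by
    simp only [← hiff]
    exact ⟨fun ⟨hI, hII, a, ha, hIII⟩ => ⟨a, ha, hI, hII, hIII⟩,
      fun ⟨a, ha, hI, hII, hIII⟩ => ⟨hI, hII, a, ha, hIII⟩⟩
  refine ⟨fun h => fun f hf => ?_, ?_, ?_, fun a ha => ?_, fun a ha => ?_⟩
  · refine Kriging.existsUnique_mk_mem_commonFunctionals hμ hM h.1 ?_ hf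
    rw [← neg_sub]
    exact neg_mem h.2
  · rw [hex]
    refine ⟨Kriging.exists_asympConformal_of_efficient hμ hM hE, fun ⟨a, ha, hDa⟩ y hy => ?_⟩
    have hyD := hy.observationSpace_le hM
    exact Kriging.efficient_of_eventually hyD (fun n => Kriging.errorRel_nonempty hinf (hyD n))
      fun δ hδ => (Kriging.eventually_effBound_of_asympConformal hμ hM ha hDa hy hδ).mono
        fun _ h => h.1
  · rw [hex]
    refine ⟨Kriging.exists_asympConformal_of_efficient' hμ hM hE, fun ⟨a, ha, hDa⟩ y hy => ?_⟩
    have hyD := hy.observationSpace_le hM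
    exact Kriging.efficient'_of_eventually hyD (fun n => Kriging.errorRel_nonempty hinf (hyD n))
      hDa fun δ hδ => (Kriging.eventually_effBound_of_asympConformal hμ hM ha hDa hy hδ).mono
        fun _ h => h.2
  · rw [hiff]
    refine ⟨fun h => Kriging.asympConformal_of_errorRatio hμ hM hE ha h.1 h.2, fun hDa =>
      ⟨Kriging.varianceCompatible_of_asympConformal hM hDa, fun y hy =>
        (Kriging.errorRatio_iff (hy.observationSpace_le hM) ha).2 fun δ hδ => ?_⟩⟩
    exact (Kriging.eventually_ratioBound_of_asympConformal hμ hM ha hDa hy hδ).mono fun _ h => h.1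
  · rw [hiff]
    refine ⟨fun h => Kriging.asympConformal_of_errorRatio' hμ hM hE ha h.1 h.2, fun hDa =>
      ⟨Kriging.varianceCompatible_of_asympConformal hM hDa, fun y hy =>
        (Kriging.errorRatio'_iff (hy.observationSpace_le hM) ha).2 fun δ hδ => ?_⟩⟩
    exact (Kriging.eventually_ratioBound_of_asympConformal hμ hM ha hDa hy hδ).mono fun _ h => h.2
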